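/- Let $T=\{z\in\mathbb C:|z|=1\}$, let $\tau(x)=x^{-1}$ on $T$ and on $T^2=T\times T$, and write $(T^2)^\tau=\{(\pm1,\pm1)\}$, $T^\tau=\{\pm1\}$ for the fixed points. *Data.* Let $V$ be a complex inner product space with an anti-unitary operator $\Theta$, $\Theta^2=-1$, and let $\mathcal H\subset T^2\times V$ be a rank $2$ Hilbert bundle with $\Theta\mathcal H_x=\mathcal H_{\tau x}$ and with a global continuous orthonormal frame $(s_1,s_2)$. Its transition function is $w(x)=\big(\langle s_i(x),-\Theta s_j(\tau x)\rangle\big)_{i,j}\in U(2)$; it satisfies $w(x)^T=-w(\tau x)$. Fix a continuous branch of $\sqrt{\det w}$ on $T^2$ and put $h(x)=\operatorname{pf}(w(x))/\sqrt{\det w(x)}\in\{\pm1\}$ at the fixed points $x$. For $M=T^2$, or $M$ a $\tau$-invariant circle in $T^2$, the Kane--Mele invariant is $\nu(M)=\prod_{x\in M^\tau}h(x)$. Let $T_N=T\times\{1\}$ and $T_S=T\times\{-1\}$ be the north and south circles. *Pfaffian bundles.* For $i=N,S$, let $Pf|_{T_i}\to T_i$ be the real line bundle with structure group $\{\pm1\}$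 obtained by gluing the trivial line bundles over the two half circles with the values of $h$ at the two fixed points of $T_i$. Let $g_i:T_i\to U(1)$ be any continuous extension of $h|_{T_i^\tau}$ with $g_i(\tau z)=g_i(z)^{-1}$ (such extensions exist). Let $Pf\to T^2$ be the complex line bundle obtained by gluing the trivial line bundles over the two halves $T\times\{\operatorname{Im}y\ge0\}$ and $T\times\{\operatorname{Im}y\le0\}$ of the torus along $T_N$ and $T_S$ with the transition functions $g_N$ and $g_S$; $w_2(Pf)\in H^2(T^2;\mathbb Z_2)=\mathbb Z_2$ is the second Stiefel--Whitney class of its underlying real bundle of rank $2$, and $w_1(Pf|_{T_i})\in H^1(T_i;\mathbb Z_2)=\mathbb Z_2$. The bundle $Pf\to T^2$ is called *orientable* when its top class $w_2(Pf)$ vanishes. *Cobordism.* Two real line bundles over closed $1$-manifolds $M$ and $N$ are *cobordant* if there are a compact smooth surface $W$ with $\partial W\cong M\sqcup N$ and a real line bundle over $W$ (equivalently a principal $\mathbb Z_2$-bundle) restricting to the given ones over $M$ and $N$. **Proposition.** For all such data and all extensions $g_N,g_S$: 1. $w_2(Pf)\equiv w_1(Pf|_{T_N})+w_1(Pf|_{T_S})\pmod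 2$. 2. $\nu(T^2)=(-1)^{w_2(Pf)}$, $\nu(T_N)=(-1)^{w_1(Pf|_{T_N})}$, $\nu(T_S)=(-1)^{w_1(Pf|_{T_S})}$, and $\nu(T^2)=\nu(T_N)\,\nu(T_S)$. 3. $Pf$ is orientable, i.e. $w_2(Pf)=0$, if and only if $\nu(T^2)=1$, if and only if $Pf|_{T_N}$ and $Pf|_{T_S}$ are cobordant; and they are cobordant if and only if $w_1(Pf|_{T_N})=w_1(Pf|_{T_S})$. 4. All of this is independent of the pairing of nearest neighbour fixed points: if the circles $\{1\}\times T$ and $\{-1\}\times T$ are used instead of $T_N$ and $T_S$ (with the Pfaffian bundle over $T^2$ glued along them, for any choice of extensions), then $\nu(T^2)$, $w_2(Pf)$, the sum of the two classes $w_1$, the product of the two circle invariants $\nu$, and the answer to whether the two restricted bundles are cobordant are the same. -/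

import Mathlib

open Set Bundle Manifold
open scoped ContDiff Topology Matrix

noncomputable section

namespace TopIns

/-! ### Hilbert bundle, transition function, signs of Pfaffians

Momentum spaces are the circle `T = Circle` and the torus `T² = Circle × Circle`; the time reversal
transformation is `τ x = x⁻¹`, that is, `θ ↦ -θ` in angular coordinates.  The fixed points are `±1`
on the circle and `(±1, ±1)` on the torus. -/

/-- A rank 2 Hilbert bundle `H ⊆ X × V` with time reversal symmetry, presented by a global
orthonormal frame: `Θ` is anti-unitary with `Θ² = -1`, the fibre over `x` is the span of
`s 0 x, s 1 x`, and `Θ` maps the fibre over `x` into the fibre over `τ x = x⁻¹`. -/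
structure HilbertFrame (X : Type*) [TopologicalSpace X] [InvolutiveInv X]
    (V : Type*) [NormedAddCommGroup V] [InnerProductSpace ℂ V] where
  Θ : V →ₗᵢ⋆[ℂ] V
  Θ_sq : ∀ v, Θ (Θ v) = -v
  s : Fin 2 → C(X, V)
  orthonormal : ∀ x, Orthonormal ℂ (fun i => s i x)
  invariant : ∀ i x, Θ (s i x) ∈ Submodule.span ℂ (range fun j => s j x⁻¹)

namespace HilbertFrame

variable {X : Type*} [TopologicalSpace X] [InvolutiveInv X]
  {V : Type*} [NormedAddCommGroup V] [InnerProductSpace ℂ V]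

/-- The transition function `w(x) = ⟨s(x), (σ s)(x)⟩`, where `σ t = - Θ ∘ t ∘ τ`. -/
def w (D : HilbertFrame X V) (x : X) : Matrix (Fin 2) (Fin 2) ℂ :=
  Matrix.of fun i j => inner ℂ (D.s i x) (-(D.Θ (D.s j x⁻¹)))

/-- The Pfaffian of `w(x)`: the upper right entry of a `2 × 2` matrix (used where `w(x)` is
skew-symmetric, that is, at the fixed points of `τ`). -/
def pf (D : HilbertFrame X V) (x : X) : ℂ := D.w x 0 1

end HilbertFrame

/-- A Hilbert bundle with frame, together with a continuous branch of `√(det w)`. -/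
structure PfaffianDatum (X : Type*) [TopologicalSpace X] [InvolutiveInv X]
    (V : Type*) [NormedAddCommGroup V] [InnerProductSpace ℂ V] extends HilbertFrame X V where
  sqrtDet : C(X, ℂ)
  sqrtDet_sq : ∀ x, sqrtDet x ^ 2 = (toHilbertFrame.w x).det

namespace PfaffianDatum

variable {X : Type*} [TopologicalSpace X] [InvolutiveInv X]
  {Y : Type*} [TopologicalSpace Y] [InvolutiveInv Y]
  {V : Type*} [NormedAddCommGroup V] [InnerProductSpace ℂ V]

/-- The pull-back along an equivariant map; for an embedding, the restriction to its image. -/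
def restrict (D : PfaffianDatum X V) (f : C(Y, X)) (hf : ∀ y, f y⁻¹ = (f y)⁻¹) :
    PfaffianDatum Y V where
  Θ := D.Θ
  Θ_sq := D.Θ_sq
  s i := (D.s i).comp f
  orthonormal y := D.orthonormal (f y)
  invariant i y := by
    have h := D.invariant i (f y)
    simpa [hf] using h
  sqrtDet := D.sqrtDet.comp f
  sqrtDet_sq y := by
    have h := D.sqrtDet_sq (f y)
    have e : D.w (f y) = HilbertFrame.w
        { Θ := D.Θ
          Θ_sq := D.Θ_sq
          s := fun i => (D.s i).comp f
          orthonormal := fun y => D.orthonormal (f y)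
          invariant := fun i y => by simpa [hf] using D.invariant i (f y) } y := by
      ext i j
      simp [HilbertFrame.w, hf]
    rw [← e]
    exact h

/-- The sign `h(x) = sgn pf(w(x)) = pf(w(x)) / √(det w(x))`, meaningful at the fixed points of `τ`,
see `coe_sgn`. -/
def sgn (D : PfaffianDatum X V) (x : X) : ℤˣ :=
  open Classical in if D.pf x / D.sqrtDet x = 1 then 1 else -1

/-- The Kane--Mele invariant: the product of the signs of the Pfaffians over the fixed points. -/
def kaneMele (D : PfaffianDatum X V) : ℤˣ := ∏ᶠ (x : X) (_ : x⁻¹ = x), D.sgn x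

theorem inner_Θ (D : PfaffianDatum X V) (u v : V) :
    inner ℂ (D.Θ u) (D.Θ v) = inner ℂ v u := by
  have hn : ∀ z, ‖D.Θ z‖ = ‖z‖ := D.Θ.norm_map
  have hI : ∀ z, D.Θ (Complex.I • z) = -(Complex.I • D.Θ z) := fun z => by
    rw [D.Θ.map_smulₛₗ, Complex.conj_I, neg_smul]
  have e1 : ‖D.Θ u + D.Θ v‖ = ‖v + u‖ := by rw [← map_add, hn, add_comm]
  have e2 : ‖D.Θ u - D.Θ v‖ = ‖v - u‖ := by rw [← map_sub, hn, norm_sub_rev]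
  have e3 : ‖D.Θ u - Complex.I • D.Θ v‖ = ‖v - Complex.I • u‖ := by
    have : D.Θ u - Complex.I • D.Θ v = D.Θ (u + Complex.I • v) := by
      rw [map_add, hI, sub_eq_add_neg]
    rw [this, hn]
    have : u + Complex.I • v = Complex.I • (v - Complex.I • u) := by
      simp [smul_sub, smul_smul, add_comm]
    rw [this, norm_smul]; simp
  have e4 : ‖D.Θ u + Complex.I • D.Θ v‖ = ‖v + Complex.I • u‖ := by
    have : D.Θ u + Complex.I • D.Θ v = D.Θ (u - Complex.I • v) := by
      rw [map_sub, hI, sub_neg_eq_add]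
    rw [this, hn]
    have : u - Complex.I • v = -(Complex.I • (v + Complex.I • u)) := by
      simp only [smul_add, smul_smul, Complex.I_mul_I, neg_smul, one_smul]
      abel
    rw [this, norm_neg, norm_smul]; simp
  rw [inner_eq_sum_norm_sq_div_four (𝕜 := ℂ) (D.Θ u), inner_eq_sum_norm_sq_div_four (𝕜 := ℂ) v]
  simp only [RCLike.I_to_complex, e1, e2, e3, e4]

/-- The basic symmetry `w(x)ᵀ = - w(τ x)`. -/
theorem w_transpose (D : PfaffianDatum X V) (x : X) : (D.w x)ᵀ = -D.w x⁻¹ := by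
  ext i j
  have h := D.inner_Θ (D.Θ (D.s i x⁻¹)) (D.s j x)
  rw [D.Θ_sq, inner_neg_left] at h
  simp only [HilbertFrame.w, Matrix.transpose_apply, Matrix.of_apply, inner_neg_right,
    Matrix.neg_apply, inv_inv, neg_neg]
  rw [← h, neg_neg]

/-- At a fixed point the Pfaffian does not vanish. -/
theorem pf_ne_zero (D : PfaffianDatum X V) {x : X} (hx : x⁻¹ = x) : D.pf x ≠ 0 := by
  intro h0
  have hT := D.w_transpose x
  rw [hx] at hT
  have h11 : D.w x 1 1 = 0 := by
    have := congrFun (congrFun hT 1) 1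
    simp only [Matrix.transpose_apply, Matrix.neg_apply] at this
    linear_combination this / 2
  have h01 : D.w x 0 1 = 0 := h0
  simp only [HilbertFrame.w, Matrix.of_apply, inner_neg_right, neg_eq_zero, hx] at h11 h01
  have hmem : D.Θ (D.s 1 x) ∈ Submodule.span ℂ (range fun j => D.s j x) := by
    have := D.invariant 1 x
    rwa [hx] at this
  have hort : ∀ y ∈ Submodule.span ℂ (range fun j => D.s j x),
      inner ℂ y (D.Θ (D.s 1 x)) = 0 := by
    intro y hy
    induction hy using Submodule.span_induction with
    | mem y hy =>
      obtain ⟨j, rfl⟩ := hy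
      fin_cases j
      · exact h01
      · exact h11
    | zero => simp
    | add a b _ _ ha hb => rw [inner_add_left, ha, hb, add_zero]
    | smul c a _ ha => rw [inner_smul_left, ha, mul_zero]
  have hz := inner_self_eq_zero.1 (hort _ hmem)
  have hn := D.Θ.norm_map (D.s 1 x)
  rw [hz, norm_zero, (D.orthonormal x).1 1] at hn
  exact zero_ne_one hn

/-- At a fixed point, `sgn` is the ratio `pf(w) / √(det w)`. -/
theorem coe_sgn (D : PfaffianDatum X V) {x : X} (hx : x⁻¹ = x) :
    (((D.sgn x : ℤˣ) : ℤ) : ℂ) = D.pf x / D.sqrtDet x := by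
  have hT := D.w_transpose x
  rw [hx] at hT
  have hdet : D.sqrtDet x ^ 2 = D.pf x ^ 2 := by
    have h00 := congrFun (congrFun hT 0) 0
    have h01 := congrFun (congrFun hT 0) 1
    simp only [Matrix.transpose_apply, Matrix.neg_apply] at h00 h01
    rw [D.sqrtDet_sq, Matrix.det_fin_two, HilbertFrame.pf]
    linear_combination D.w x 1 1 * h00 / 2 - D.w x 0 1 * h01
  have hp := D.pf_ne_zero hx
  unfold sgn
  rcases sq_eq_sq_iff_eq_or_eq_neg.1 hdet with h | h
  · rw [h, div_self hp]; simp
  · rw [h, div_neg, div_self hp]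
    have : (-1 : ℂ) ≠ 1 := by norm_num
    simp [this]

end PfaffianDatum

/-! ### The Pfaffian bundles -/

/-- The line bundle obtained by clutching: let `c : X → Circle`.  Take the trivial bundle with fibre
`F` over `{c ≠ -i}` and over `{c ≠ i}`, and glue them by multiplication with `u` where `Re c > 0`
and with `v` where `Re c < 0`. -/
def clutch {X : Type*} [TopologicalSpace X] (F : Type*) [NormedField F] [NormedAlgebra ℝ F]
    (c : C(X, Circle)) (u v : C(X, F)) (hu : ∀ x, u x ≠ 0) (hv : ∀ x, v x ≠ 0) :
    VectorBundleCore ℝ X F Bool where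
  baseSet i := if i then {x | (c x : ℂ) ≠ -Complex.I} else {x | (c x : ℂ) ≠ Complex.I}
  isOpen_baseSet i := by
    have hc : Continuous fun x => (c x : ℂ) := continuous_subtype_val.comp c.continuous
    cases i
    · exact isOpen_ne_fun hc continuous_const
    · exact isOpen_ne_fun hc continuous_const
  indexAt x := open Classical in decide (0 ≤ (c x : ℂ).im)
  mem_baseSet_at x := by
    by_cases h : 0 ≤ (c x : ℂ).im
    · simp only [h, decide_true, if_true, mem_ofPred_eq]
      intro e
      rw [e] at h
      norm_num at h
    · simp only [h, decide_false, Bool.false_eq_true, if_false, mem_ofPred_eq]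
      intro e
      rw [e] at h
      norm_num at h
  coordChange i j x := open Classical in
    if i = j then ContinuousLinearMap.id ℝ F
    else if i then ContinuousLinearMap.mul ℝ F (if 0 < (c x : ℂ).re then u x else v x)
    else ContinuousLinearMap.mul ℝ F (if 0 < (c x : ℂ).re then u x else v x)⁻¹
  coordChange_self i x _ y := by simp
  continuousOn_coordChange i j := by
    classical
    have hc : Continuous fun x => (c x : ℂ) := continuous_subtype_val.comp c.continuous
    have hre : Continuous fun x => (c x : ℂ).re := Complex.continuous_re.comp hc
    have key : ∀ x, (c x : ℂ) ≠ -Complex.I → (c x : ℂ) ≠ Complex.I →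
        ContinuousAt (fun x => if 0 < (c x : ℂ).re then u x else v x) x := by
      intro x h1 h2
      have hx : (c x : ℂ).re ≠ 0 := by
        intro h0
        have hn := Circle.normSq_coe (c x)
        rw [Complex.normSq_apply, h0] at hn
        have : ((c x : ℂ).im - 1) * ((c x : ℂ).im + 1) = 0 := by linarith
        rcases mul_eq_zero.1 this with h | h
        · exact h2 (Complex.ext (by simp [h0]) (by simp; linarith))
        · exact h1 (Complex.ext (by simp [h0]) (by simp; linarith))
      rcases lt_or_gt_of_ne hx with h | h
      · refine v.continuous.continuousAt.congr ?_
        filter_upwards [hre.continuousAt.eventually_lt continuousAt_const h] with y hy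
        rw [if_neg (not_lt.2 hy.le)]
      · refine u.continuous.continuousAt.congr ?_
        filter_upwards [continuousAt_const.eventually_lt hre.continuousAt h] with y hy
        rw [if_pos hy]
    have hne : ∀ x, (if 0 < (c x : ℂ).re then u x else v x) ≠ 0 := by
      intro x
      split_ifs
      · exact hu x
      · exact hv x
    cases i <;> cases j
    · simpa using continuousOn_const
    · intro x hx
      simp only [Bool.false_eq_true, if_false, if_true, mem_inter_iff, mem_ofPred_eq] at hx
      have h := (ContinuousLinearMap.mul ℝ F).continuous.continuousAt.comp
        ((key x hx.2 hx.1).inv₀ (hne x))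
      exact h.continuousWithinAt
    · intro x hx
      simp only [Bool.false_eq_true, if_false, if_true, mem_inter_iff, mem_ofPred_eq] at hx
      have h := (ContinuousLinearMap.mul ℝ F).continuous.continuousAt.comp
        (key x hx.1 hx.2)
      exact h.continuousWithinAt
    · simpa using continuousOn_const
  coordChange_comp i j k x _ y := by
    classical
    have hne : (if 0 < (c x : ℂ).re then u x else v x) ≠ 0 := by
      split_ifs
      · exact hu x
      · exact hv x
    cases i <;> cases j <;> cases k <;> simp only [reduceCtorEq, if_true, if_false,
      ContinuousLinearMap.mul_apply', ContinuousLinearMap.id_apply, Bool.false_eq_true]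
    · rw [mul_inv_cancel_left₀ hne]
    · rw [inv_mul_cancel_left₀ hne]

namespace PfaffianDatum

variable {V : Type*} [NormedAddCommGroup V] [InnerProductSpace ℂ V]

/-- The *real* Pfaffian line bundle over the circle, with structure group `{±1}`: the transition
function between the two half circles is `h(1)` near the fixed point `1` (angle `0`) and `h(-1)`
near the fixed point `-1` (angle `π`). -/
def circleBundle (D : PfaffianDatum Circle V) : VectorBundleCore ℝ Circle ℝ Bool :=
  clutch ℝ (ContinuousMap.id Circle)
    (ContinuousMap.const _ (((D.sgn 1 : ℤˣ) : ℤ) : ℝ))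
    (ContinuousMap.const _ (((D.sgn (-1) : ℤˣ) : ℤ) : ℝ))
    (fun _ => by simp) (fun _ => by simp)

/-- An extension of the transition function `h` from the fixed points to a phase `T → U(1)`
compatible with time reversal: `g(τ z) = g(z)⁻¹`, that is, `g = exp(iβ)` with
`exp(iβ(τ z)) = exp(-iβ(z))`. -/
structure PhaseExtension (D : PfaffianDatum Circle V) where
  g : C(Circle, Circle)
  map_inv : ∀ z, g z⁻¹ = (g z)⁻¹
  map_one : (g 1 : ℂ) = ((D.sgn 1 : ℤˣ) : ℤ)
  map_neg_one : (g (-1) : ℂ) = ((D.sgn (-1) : ℤˣ) : ℤ)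

/-- Phase extensions exist. -/
theorem nonempty_phaseExtension (D : PfaffianDatum Circle V) : Nonempty D.PhaseExtension := by
  rcases Int.units_eq_one_or (D.sgn 1) with h1 | h1 <;>
    rcases Int.units_eq_one_or (D.sgn (-1)) with h2 | h2
  · exact ⟨⟨ContinuousMap.const _ 1, by simp, by simp [h1], by simp [h2]⟩⟩
  · exact ⟨⟨ContinuousMap.id _, by simp, by simp [h1], by simp [h2]⟩⟩
  · exact ⟨⟨-ContinuousMap.id _, by intro z; apply Circle.ext; simp [inv_neg], by simp [h1],
      by simp [h2]⟩⟩
  · exact ⟨⟨ContinuousMap.const _ (-1), by intro z; apply Circle.ext; simp, by simp [h1],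
      by simp [h2]⟩⟩

/-- Restriction to the north circle `T_N = {(z, 1)}` through the fixed points
`(1, 1)` and `(-1, 1)`. -/
def north (D : PfaffianDatum (Circle × Circle) V) : PfaffianDatum Circle V :=
  D.restrict ⟨fun z => (z, 1), by fun_prop⟩ (by intro z; simp)

/-- Restriction to the south circle `T_S = {(z, -1)}` through the fixed points
`(1, -1)` and `(-1, -1)`. -/
def south (D : PfaffianDatum (Circle × Circle) V) : PfaffianDatum Circle V :=
  D.restrict ⟨fun z => (z, -1), by fun_prop⟩
    (by intro z; ext <;> simp)

/-- The same datum with the two coordinates of the torus exchanged.  The north and south circles of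
`D.swap` are the circles `{(1, z)}` and `{(-1, z)}` of `D`: this is the other pairing of nearest
neighbour fixed points. -/
def swap (D : PfaffianDatum (Circle × Circle) V) : PfaffianDatum (Circle × Circle) V :=
  D.restrict ⟨Prod.swap, continuous_swap⟩ (by intro z; rfl)

/-- The Pfaffian line bundle over the torus: the complex line bundle (regarded as a real bundle of
rank 2) which is trivial over the two halves of the torus (neighbourhoods of the effective
Brillouin zone `T × [0, π]` and of its mirror image `T × [-π, 0]`), with transition function
`(z, y) ↦ gN z` near the north circle and `(z, y) ↦ gS z` near the south circle. -/
def torusBundle (D : PfaffianDatum (Circle × Circle) V)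
    (gN : D.north.PhaseExtension) (gS : D.south.PhaseExtension) :
    VectorBundleCore ℝ (Circle × Circle) ℂ Bool :=
  clutch ℂ ⟨Prod.snd, continuous_snd⟩
    ⟨fun p => (gN.g p.1 : ℂ), by fun_prop⟩ ⟨fun p => (gS.g p.1 : ℂ), by fun_prop⟩
    (fun _ => Circle.coe_ne_zero _) (fun _ => Circle.coe_ne_zero _)

end PfaffianDatum

/-! ### Top Stiefel--Whitney classes of bundles over the circle and the torus

The top class `w_n` of a real vector bundle of rank `n` is the mod 2 obstruction to extending a
nowhere zero section from the `(n-1)`-skeleton.  For the standard cell structures of the circle and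
the torus, with one top cell, it is a number in `H^n(Tⁿ; ℤ/2) = ℤ/2`. -/

/-- The covering `ℝ → T`, `t ↦ exp(2πit)`. -/
def cov (t : ℝ) : Circle := Circle.exp (2 * Real.pi * t)

/-- `w₁` of a real line bundle over the circle, as an element of `H¹(T; ℤ/2) = ℤ/2`: it is `1` iff a
continuous nowhere zero section along the loop `t ↦ exp(2πit)`, `0 ≤ t ≤ 1`, comes back with the
opposite orientation. -/
def w₁ (E : Circle → Type*) [TopologicalSpace (TotalSpace ℝ E)] [∀ z, AddCommGroup (E z)]
    [∀ z, Module ℝ (E z)] [∀ z, TopologicalSpace (E z)] [FiberBundle ℝ E] [VectorBundle ℝ ℝ E] :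
    ZMod 2 :=
  open Classical in
  if ∃ (e : ∀ t : ℝ, E (cov t)) (a : ℝ),
      ContinuousOn (fun t => (⟨cov t, e t⟩ : TotalSpace ℝ E)) (Icc 0 1) ∧
      (∀ t ∈ Icc (0 : ℝ) 1, e t ≠ 0) ∧ a < 0 ∧
      (⟨cov 1, e 1⟩ : TotalSpace ℝ E) = ⟨cov 0, a • e 0⟩
  then 1 else 0

/-- The function `f : [a, b] → ℂ ∖ {0}` turns `n` times around the origin. -/
def Turns (f : ℝ → ℂ) (a b : ℝ) (n : ℤ) : Prop :=
  ∃ θ : ℝ → ℝ, ContinuousOn θ (Icc a b) ∧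
    (∀ t ∈ Icc a b, f t ≠ 0 ∧ f t = ‖f t‖ * Complex.exp (θ t * Complex.I)) ∧
    θ b - θ a = 2 * Real.pi * n

/-- The covering `ℝ² → T²`; the image of `[0,1]²` is the 2-cell of the torus. -/
def cov₂ (p : ℝ × ℝ) : Circle × Circle := (cov p.1, cov p.2)

/-- The boundary of the unit square, run through counterclockwise for `0 ≤ t ≤ 4`. -/
def squareLoop (t : ℝ) : ℝ × ℝ :=
  if t ≤ 1 then (t, 0) else if t ≤ 2 then (1, t - 1) else if t ≤ 3 then (3 - t, 1) else (0, 4 - t)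

/-- `n` is the obstruction number of some section over the 1-skeleton `{z = 1 or y = 1}` of the
torus: `s` is a nowhere zero section over the 1-skeleton, `e₁, e₂` is a frame of the bundle over the
2-cell, and `n` is the number of turns that `s`, in coordinates with respect to this frame, makes
along the boundary of the 2-cell. -/
def IsObstructionNumber (E : Circle × Circle → Type*) [TopologicalSpace (TotalSpace ℂ E)]
    [∀ x, AddCommGroup (E x)] [∀ x, Module ℝ (E x)] (n : ℤ) : Prop :=
  ∃ (s : ∀ x, E x) (e₁ e₂ : ∀ p : ℝ × ℝ, E (cov₂ p)) (f : ℝ → ℂ),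
    ContinuousOn (fun x => (⟨x, s x⟩ : TotalSpace ℂ E)) {x | x.1 = 1 ∨ x.2 = 1} ∧
    (∀ x : Circle × Circle, x.1 = 1 ∨ x.2 = 1 → s x ≠ 0) ∧
    ContinuousOn (fun p => (⟨cov₂ p, e₁ p⟩ : TotalSpace ℂ E)) (Icc 0 1 ×ˢ Icc 0 1) ∧
    ContinuousOn (fun p => (⟨cov₂ p, e₂ p⟩ : TotalSpace ℂ E)) (Icc 0 1 ×ˢ Icc 0 1) ∧
    (∀ p ∈ (Icc 0 1 ×ˢ Icc 0 1 : Set (ℝ × ℝ)), LinearIndependent ℝ ![e₁ p, e₂ p]) ∧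
    (∀ t ∈ Icc (0 : ℝ) 4, s (cov₂ (squareLoop t)) =
      (f t).re • e₁ (squareLoop t) + (f t).im • e₂ (squareLoop t)) ∧
    Turns f 0 4 n

/-- `w₂` of a real vector bundle of rank 2 over the torus, as an element of `H²(T²; ℤ/2) = ℤ/2`: the
residue mod 2 of the obstruction numbers (every such bundle has obstruction numbers, and they all
have the same parity). -/
def w₂ (E : Circle × Circle → Type*) [TopologicalSpace (TotalSpace ℂ E)]
    [∀ x, AddCommGroup (E x)] [∀ x, Module ℝ (E x)] [∀ x, TopologicalSpace (E x)]
    [FiberBundle ℂ E] [VectorBundle ℝ ℂ E] : ZMod 2 :=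
  open Classical in if ∃ n, IsObstructionNumber E n ∧ Odd n then 1 else 0

/-! ### Unoriented cobordism of manifolds with real line bundles -/

/-- The line bundle `L` over `M` is the restriction of the line bundle `E` over `W` along
`f : M → W`. -/
def IsRestriction {M W : Type*} [TopologicalSpace M] [TopologicalSpace W] (f : M → W)
    (L : M → Type*) [TopologicalSpace (TotalSpace ℝ L)] [∀ x, AddCommGroup (L x)]
    [∀ x, Module ℝ (L x)]
    (E : W → Type*) [TopologicalSpace (TotalSpace ℝ E)] [∀ x, AddCommGroup (E x)]
    [∀ x, Module ℝ (E x)] : Prop :=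
  ∃ φ : ∀ x, L x ≃ₗ[ℝ] E (f x),
    Continuous fun q : TotalSpace ℝ L => (⟨f q.1, φ q.1 q.2⟩ : TotalSpace ℝ E)

/-- Closed `n`-manifolds `M` and `N` with real line bundles `L` and `L'` are cobordant: there are a
compact smooth `(n+1)`-manifold `W` with boundary `M ⊔ N` and a real line bundle over `W` which
restricts to `L` on `M` and to `L'` on `N`. -/
def Cobordant (n : ℕ)
    {M : Type} [TopologicalSpace M] [CompactSpace M] [T2Space M]
    [ChartedSpace (EuclideanSpace ℝ (Fin n)) M] [IsManifold (𝓡 n) ∞ M]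
    {N : Type} [TopologicalSpace N] [CompactSpace N] [T2Space N]
    [ChartedSpace (EuclideanSpace ℝ (Fin n)) N] [IsManifold (𝓡 n) ∞ N]
    (L : M → Type) [TopologicalSpace (TotalSpace ℝ L)] [∀ x, AddCommGroup (L x)]
    [∀ x, Module ℝ (L x)] [∀ x, TopologicalSpace (L x)] [FiberBundle ℝ L] [VectorBundle ℝ ℝ L]
    (L' : N → Type) [TopologicalSpace (TotalSpace ℝ L')] [∀ x, AddCommGroup (L' x)]
    [∀ x, Module ℝ (L' x)] [∀ x, TopologicalSpace (L' x)] [FiberBundle ℝ L']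
    [VectorBundle ℝ ℝ L'] : Prop :=
  ∃ (W : Type) (_ : TopologicalSpace W) (_ : CompactSpace W) (_ : T2Space W)
    (_ : ChartedSpace (EuclideanHalfSpace (n + 1)) W) (_ : IsManifold (𝓡∂ (n + 1)) ∞ W)
    (ι : M → W) (ι' : N → W)
    (E : W → Type) (_ : TopologicalSpace (TotalSpace ℝ E)) (_ : ∀ x, AddCommGroup (E x))
    (_ : ∀ x, Module ℝ (E x)) (_ : ∀ x, TopologicalSpace (E x)) (_ : FiberBundle ℝ E)
    (_ : VectorBundle ℝ ℝ E),
    IsSmoothEmbedding (𝓡 n) (𝓡∂ (n + 1)) ∞ ι ∧ IsSmoothEmbedding (𝓡 n) (𝓡∂ (n + 1)) ∞ ι' ∧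
    Disjoint (range ι) (range ι') ∧ range ι ∪ range ι' = (𝓡∂ (n + 1)).boundary W ∧
    IsRestriction ι L E ∧ IsRestriction ι' L' E

end TopIns

end

/-! Everything is determined by the four signs `a, b, c, d` of the Pfaffian at `(1,1), (-1,1),
(1,-1), (-1,-1)`. The Kane--Mele invariants are `ab`, `cd` and `abcd`; it is shown that the two
classes `w₁` are the classes of `ab` and `cd`, that `w₂` is the class of `abcd`, and that the
restricted bundles are cobordant exactly when `ab = cd`. The proposition is then arithmetic in `{1,
-1}`, and the other pairing of fixed points only exchanges `b` and `c`.

For `w₁` (`w₁_circleClutch`): a nowhere zero section has a coordinate of constant sign on each half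
circle, so its holonomy has the sign of the product of the two transition constants.

For `w₂` (`w₂_torusClutch`): over the square the bundle is trivial, and the coordinates of one
vector on the top and the bottom side differ by the factor `gN / gS`. The obstruction numbers are
therefore `± (deg gN - deg gS)`. If `β` lifts the phase of `g`, the symmetry `g(τz) = g(z)⁻¹` makes
`β(1 - t) + β(t)` constant, so half of the total turn is reached at `t = 1/2` and `(-1)^deg g = g(1)
g(-1)` (`exists_degree`).

For cobordism, if `ab = cd` then the transition constants differ by a common factor and the cylinder
is a cobordism (`cobordant_circleClutch`). The converse says that the holonomies of a line bundle
along two circles which bound a compact surface have positive product (`line_holonomy_mul_pos`). A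
generic section is transverse to zero, also on the boundary. Its zeros form a compact 1-manifold
whose ends are the zeros on the boundary, so these are even in number (`even_ncard_of_arcs`). Along
a boundary circle every zero is a change of sign, so the parity of their number is the holonomy
(`even_ncard_iff`).

Genericity is obtained from Hausdorff dimension instead of Sard's theorem (`exists_generic`): in a
finite-dimensional family containing all affine functions of the local coordinates, the parameters
of bad sections are `C¹` images of sets with one variable less. The evenness of the number of ends
is a handshake count over the edges into which finitely many arcs are cut, without the
classification of 1-manifolds. -/

noncomputable section

namespace TopIns

/-! ### The number of end points of a compact one-dimensional manifold is even -/

/-- `a : [0, 1] → Z` is an arc which is a neighbourhood in `Z` of the points with parameter in `J`;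
either `J = (0, 1)`, or `J = [0, 1)` and the arc starts at a point of `B`. -/
structure IsArc {X : Type*} [TopologicalSpace X] (Z B : Set X) (a : ℝ → X) (J : Set ℝ) : Prop where
  cont : ContinuousOn a (Icc 0 1)
  inj : InjOn a (Icc 0 1)
  maps : MapsTo a (Icc 0 1) Z
  notMem : ∀ t ∈ Ioo (0 : ℝ) 1, a t ∉ B
  param : J = Ioo 0 1 ∨ J = Ico 0 1 ∧ a 0 ∈ B
  nhd : ∃ O, IsOpen O ∧ Z ∩ O = a '' J

namespace IsArc

variable {X : Type*} [TopologicalSpace X] {Z B : Set X} {a : ℝ → X} {J : Set ℝ}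

theorem Ioo_subset (h : IsArc Z B a J) : Ioo 0 1 ⊆ J := by
  rcases h.param with h | h
  · rw [h]
  · rw [h.1]; exact Ioo_subset_Ico_self

theorem subset_Ico (h : IsArc Z B a J) : J ⊆ Ico 0 1 := by
  rcases h.param with h | h
  · rw [h]; exact Ioo_subset_Ico_self
  · rw [h.1]

variable [T2Space X]

/-- The removed part `Icc 0 1 \ S` is compact, so its image is closed in the Hausdorff space.
Deleting this image from the open set of `nhd` leaves exactly `a '' S`, by injectivity. -/
theorem exists_isOpen (h : IsArc Z B a J) {S : Set ℝ} (hS : S ⊆ J)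
    (hc : IsClosed (Icc 0 1 \ S)) : ∃ O, IsOpen O ∧ Z ∩ O = a '' S := by
  obtain ⟨O, hO, hZ⟩ := h.nhd
  have hK : IsCompact (a '' (Icc 0 1 \ S)) :=
    (isCompact_Icc.of_isClosed_subset hc sdiff_subset).image_of_continuousOn
      (h.cont.mono sdiff_subset)
  refine ⟨O ∩ (a '' (Icc 0 1 \ S))ᶜ, hO.inter hK.isClosed.isOpen_compl, ?_⟩
  rw [← inter_assoc, hZ]
  have hJ : J ⊆ Icc 0 1 := h.subset_Ico.trans Ico_subset_Icc_self
  ext x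
  constructor
  · rintro ⟨⟨t, ht, rfl⟩, hx⟩
    by_contra hn
    exact hx ⟨t, ⟨hJ ht, fun hs => hn ⟨t, hs, rfl⟩⟩, rfl⟩
  · rintro ⟨t, ht, rfl⟩
    refine ⟨⟨t, hS ht, rfl⟩, ?_⟩
    rintro ⟨s, ⟨hs, hs'⟩, e⟩
    exact hs' (h.inj hs (hJ (hS ht)) e ▸ ht)

theorem exists_isOpen_Ioo (h : IsArc Z B a J) {p q : ℝ} (hp : 0 ≤ p) (hq : q ≤ 1) :
    ∃ O, IsOpen O ∧ Z ∩ O = a '' Ioo p q :=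
  h.exists_isOpen ((Ioo_subset_Ioo hp hq).trans h.Ioo_subset) (isClosed_Icc.sdiff isOpen_Ioo)

end IsArc

/-- The open edges into which a finite set `P` of vertices cuts the arc `a`. -/
def IsEdge {X : Type*} (P : Set X) (a : ℝ → X) (p q : ℝ) : Prop :=
  0 ≤ p ∧ p < q ∧ q ≤ 1 ∧ a p ∈ P ∧ a q ∈ P ∧ ∀ t ∈ Ioo p q, a t ∉ P

namespace IsArc

variable {X : Type*} [TopologicalSpace X] [T2Space X] {Z B P : Set X} {a : ℝ → X} {J : Set ℝ}
  {p q : ℝ}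

theorem closure_edge (h : IsArc Z B a J) (he : IsEdge P a p q) :
    closure (a '' Ioo p q) = a '' Icc p q := by
  obtain ⟨h0, hpq, h1, -⟩ := he
  have hc := h.cont.mono (Icc_subset_Icc h0 h1)
  refine subset_antisymm ?_ ?_
  · exact closure_minimal (image_mono Ioo_subset_Icc_self)
      (isCompact_Icc.image_of_continuousOn hc).isClosed
  · rw [← closure_Ioo hpq.ne] at hc ⊢
    exact hc.image_closure

theorem closure_edge_inter (h : IsArc Z B a J) (he : IsEdge P a p q) :
    closure (a '' Ioo p q) ∩ P = {a p, a q} := by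
  rw [h.closure_edge he]
  obtain ⟨h0, hpq, h1, hp, hq, hn⟩ := he
  ext x
  constructor
  · rintro ⟨⟨t, ht, rfl⟩, hx⟩
    rcases eq_or_lt_of_le ht.1 with e | e
    · left; rw [e]
    rcases eq_or_lt_of_le ht.2 with e' | e'
    · right; rw [e']; rfl
    exact absurd hx (hn t ⟨e, e'⟩)
  · rintro (rfl | rfl)
    · exact ⟨⟨p, ⟨le_rfl, hpq.le⟩, rfl⟩, hp⟩
    · exact ⟨⟨q, ⟨hpq.le, le_rfl⟩, rfl⟩, hq⟩

/-- An edge is relatively open in `Z`, and its closure adds only two vertices, so it is also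
relatively closed away from `P`. The second edge is connected and avoids `P`; if it meets the first
edge, it cannot leave it. -/
theorem edge_subset (h : IsArc Z B a J) (he : IsEdge P a p q)
    {a' : ℝ → X} {J' : Set ℝ} (h' : IsArc Z B a' J') {p' q' : ℝ} (he' : IsEdge P a' p' q')
    (hne : (a '' Ioo p q ∩ a' '' Ioo p' q').Nonempty) : a' '' Ioo p' q' ⊆ a '' Ioo p q := by
  have hcl := h.closure_edge_inter he
  obtain ⟨O, hO, hZO⟩ := h.exists_isOpen_Ioo he.1 he.2.2.1
  have hP' : ∀ x ∈ a' '' Ioo p' q', x ∉ P := by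
    rintro _ ⟨t, ht, rfl⟩; exact he'.2.2.2.2.2 t ht
  have hZ' : a' '' Ioo p' q' ⊆ Z := by
    rintro _ ⟨t, ht, rfl⟩
    exact h'.maps ⟨he'.1.trans ht.1.le, ht.2.le.trans he'.2.2.1⟩
  have hpre : IsPreconnected (a' '' Ioo p' q') := isPreconnected_Ioo.image _
    (h'.cont.mono fun t ht => ⟨he'.1.trans ht.1.le, ht.2.le.trans he'.2.2.1⟩)
  have hin : ∀ x ∈ a' '' Ioo p' q', x ∈ closure (a '' Ioo p q) → x ∈ a '' Ioo p q := by
    intro x hx hx'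
    rw [h.closure_edge he] at hx'
    obtain ⟨t, ht, rfl⟩ := hx'
    refine ⟨t, ⟨lt_of_le_of_ne ht.1 ?_, lt_of_le_of_ne ht.2 ?_⟩, rfl⟩
    · rintro rfl; exact hP' _ hx he.2.2.2.1
    · rintro rfl; exact hP' _ hx he.2.2.2.2.1
  by_contra hns
  obtain ⟨y, hy, hy'⟩ := not_subset.1 hns
  obtain ⟨x, hx, hx'⟩ := hne
  have hxO : x ∈ O := (hZO.symm ▸ hx : x ∈ Z ∩ O).2
  obtain ⟨z, hz, hz1, hz2⟩ := hpre O (closure (a '' Ioo p q))ᶜ hO isClosed_closure.isOpen_compl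
    (fun z hz => by
      by_cases hc : z ∈ closure (a '' Ioo p q)
      · exact Or.inl (hZO.symm ▸ hin z hz hc : z ∈ Z ∩ O).2
      · exact Or.inr hc)
    ⟨x, hx', hxO⟩ ⟨y, hy, fun hc => hy' (hin y hy hc)⟩
  exact hz2 (subset_closure (hZO ▸ ⟨hZ' hz, hz1⟩))

theorem edge_eq (h : IsArc Z B a J) (he : IsEdge P a p q)
    {a' : ℝ → X} {J' : Set ℝ} (h' : IsArc Z B a' J') {p' q' : ℝ} (he' : IsEdge P a' p' q')
    (hne : (a '' Ioo p q ∩ a' '' Ioo p' q').Nonempty) : a '' Ioo p q = a' '' Ioo p' q' :=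
  subset_antisymm (h'.edge_subset he' h he (by rwa [inter_comm])) (h.edge_subset he h' he' hne)

end IsArc

theorem exists_isEdge_right {X : Type*} {P : Set X} {a : ℝ → X}
    (hT : (a ⁻¹' P ∩ Icc 0 1).Finite) (h1 : a 1 ∈ P) {t : ℝ} (ht : t ∈ Ico (0 : ℝ) 1)
    (htP : a t ∈ P) : ∃ q, IsEdge P a t q := by
  obtain ⟨q, ⟨⟨hq1, hq2⟩, hq3⟩, hmin⟩ := (hT.inter_of_left (Ioi t)).exists_minimal
    ⟨1, ⟨h1, by simp⟩, ht.2⟩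
  refine ⟨q, ht.1, hq3, hq2.2, htP, hq1, fun s hs hsP => ?_⟩
  have := hmin ⟨⟨hsP, ht.1.trans hs.1.le, hs.2.le.trans hq2.2⟩, hs.1⟩ hs.2.le
  exact absurd hs.2 (not_lt.2 this)

theorem exists_isEdge_left {X : Type*} {P : Set X} {a : ℝ → X}
    (hT : (a ⁻¹' P ∩ Icc 0 1).Finite) (h0 : a 0 ∈ P) {t : ℝ} (ht : t ∈ Ioc (0 : ℝ) 1)
    (htP : a t ∈ P) : ∃ p, IsEdge P a p t := by
  obtain ⟨q, ⟨⟨hq1, hq2⟩, hq3⟩, hmax⟩ := (hT.inter_of_left (Iio t)).exists_maximal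
    ⟨0, ⟨h0, by simp⟩, ht.1⟩
  refine ⟨q, hq2.1, hq3, ht.2, hq1, htP, fun s hs hsP => ?_⟩
  have := hmax ⟨⟨hsP, hq2.1.trans hs.1.le, hs.2.le.trans ht.2⟩, hs.2⟩ hs.1.le
  exact absurd hs.1 (not_lt.2 this)

/-- A space which is covered by finitely many arcs has an even number of end points. -/
theorem even_ncard_of_arcs {X : Type*} [TopologicalSpace X] [T2Space X] {Z B : Set X} (hB : B ⊆ Z)
    {κ : Type*} [Finite κ] (a : κ → ℝ → X) (J : κ → Set ℝ) (ha : ∀ k, IsArc Z B (a k) (J k))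
    (hcov : ∀ z ∈ Z, ∃ k, z ∈ a k '' J k) : B.Finite ∧ Even B.ncard := by
  classical
  cases nonempty_fintype κ
  have hB0 : ∀ k, ∀ t ∈ J k, a k t ∈ B → t = 0 ∧ J k = Ico 0 1 := by
    intro k t ht hb
    rcases (ha k).param with h | h
    · exact absurd hb ((ha k).notMem t (h ▸ ht))
    · refine ⟨?_, h.1⟩
      rcases eq_or_lt_of_le ((ha k).subset_Ico ht).1 with e | e
      · exact e.symm
      · exact absurd hb ((ha k).notMem t ⟨e, ((ha k).subset_Ico ht).2⟩)
  obtain ⟨P, hP⟩ : ∃ P : Finset X, ∀ x, x ∈ P ↔ ∃ k, x = a k 0 ∨ x = a k 1 := by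
    refine ⟨Finset.univ.image (fun k => a k 0) ∪ Finset.univ.image fun k => a k 1, fun x => ?_⟩
    simp only [Finset.mem_union, Finset.mem_image, Finset.mem_univ, true_and]
    constructor
    · rintro (⟨k, rfl⟩ | ⟨k, rfl⟩)
      exacts [⟨k, .inl rfl⟩, ⟨k, .inr rfl⟩]
    · rintro ⟨k, rfl | rfl⟩
      exacts [.inl ⟨k, rfl⟩, .inr ⟨k, rfl⟩]
  have hPZ : ∀ x ∈ P, x ∈ Z := by
    intro x hx
    obtain ⟨k, rfl | rfl⟩ := (hP x).1 hx
    exacts [(ha k).maps (by simp), (ha k).maps (by simp)]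
  have hBP : B ⊆ (P : Set X) := by
    intro b hb
    obtain ⟨k, t, ht, rfl⟩ := hcov b (hB hb)
    obtain ⟨rfl, -⟩ := hB0 k t ht hb
    exact (hP _).2 ⟨k, .inl rfl⟩
  have hBf : B.Finite := P.finite_toSet.subset hBP
  refine ⟨hBf, ?_⟩
  have h0 : ∀ k, a k 0 ∈ (P : Set X) := fun k => (hP _).2 ⟨k, .inl rfl⟩
  have h1 : ∀ k, a k 1 ∈ (P : Set X) := fun k => (hP _).2 ⟨k, .inr rfl⟩
  have hT : ∀ k, (a k ⁻¹' (P : Set X) ∩ Icc 0 1).Finite := fun k => by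
    refine Finite.of_finite_image (f := a k) (P.finite_toSet.subset ?_)
      ((ha k).inj.mono inter_subset_right)
    rintro _ ⟨t, ht, rfl⟩; exact ht.1
  -- Edges are recorded as subsets of `X`, not as parameter intervals, since overlapping arcs can
  -- contain the same edge.
  have hEf : {e : Set X | ∃ k p q, IsEdge (P : Set X) (a k) p q ∧ e = a k '' Ioo p q}.Finite := by
    have : (⋃ k, (fun x : ℝ × ℝ => a k '' Ioo x.1 x.2) ''
        ((a k ⁻¹' (P : Set X) ∩ Icc 0 1) ×ˢ (a k ⁻¹' (P : Set X) ∩ Icc 0 1))).Finite :=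
      finite_iUnion fun k => ((hT k).prod (hT k)).image _
    refine this.subset ?_
    rintro _ ⟨k, p, q, ⟨i0, i1, i2, i3, i4, -⟩, rfl⟩
    exact mem_iUnion.2 ⟨k, (p, q), ⟨⟨i3, i0, i1.le.trans i2⟩, ⟨i4, i0.trans i1.le, i2⟩⟩, rfl⟩
  set E : Finset (Set X) := hEf.toFinset with hEdef
  have hE : ∀ e, e ∈ E ↔ ∃ k p q, IsEdge (P : Set X) (a k) p q ∧ e = a k '' Ioo p q := by
    intro e; simp [hEdef]
  have hdeg2 : ∀ e ∈ E, (P.filter fun v => v ∈ closure e).card = 2 := by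
    intro e he
    obtain ⟨k, p, q, hpq, rfl⟩ := (hE e).1 he
    have := (ha k).closure_edge_inter hpq
    have hne : a k p ≠ a k q := fun h => hpq.2.1.ne <| (ha k).inj
      ⟨hpq.1, hpq.2.1.le.trans hpq.2.2.1⟩ ⟨hpq.1.trans hpq.2.1.le, hpq.2.2.1⟩ h
    rw [← Finset.card_pair hne]
    congr 1
    ext v
    rw [Finset.mem_filter]
    have hv : v ∈ closure (a k '' Ioo p q) ∩ (P : Set X) ↔ v ∈ ({a k p, a k q} : Set X) := by
      rw [this]
    simpa [and_comm] using hv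
  -- Every neighbourhood of a vertex in the closure of an edge contains points of that edge. If the
  -- neighbourhood is a piece of one arc, this identifies the edge with an edge of that arc through
  -- `edge_eq`.
  have hmeet : ∀ e ∈ E, ∀ v ∈ P, v ∈ closure e → ∀ O, IsOpen O → v ∈ O →
      ∃ x ∈ e, x ∈ Z ∩ O ∧ x ≠ v := by
    intro e he v hv hve O hO hvO
    obtain ⟨k, p, q, hpq, rfl⟩ := (hE e).1 he
    obtain ⟨x, hxO, hxe⟩ := mem_closure_iff.1 hve O hO hvO
    refine ⟨x, hxe, ?_⟩
    obtain ⟨t, ht, rfl⟩ := hxe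
    refine ⟨⟨(ha k).maps ⟨hpq.1.trans ht.1.le, ht.2.le.trans hpq.2.2.1⟩, hxO⟩, ?_⟩
    rintro rfl
    exact hpq.2.2.2.2.2 t ht hv
  -- Near a vertex in `B` the space is a half-open arc, with one edge leaving; near any other vertex
  -- it is an open arc, with one edge on either side.
  have hdeg : ∀ v ∈ P, (E.filter fun e => v ∈ closure e).card = if v ∈ B then 1 else 2 := by
    intro v hv
    obtain ⟨k, t, ht, rfl⟩ := hcov v (hPZ v hv)
    have htI := (ha k).subset_Ico ht
    obtain ⟨q, hq⟩ := exists_isEdge_right (hT k) (h1 k) htI hv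
    have hqm : a k t ∈ closure (a k '' Ioo t q) := by
      rw [(ha k).closure_edge hq]; exact ⟨t, ⟨le_rfl, hq.2.1.le⟩, rfl⟩
    by_cases hb : a k t ∈ B
    · rw [if_pos hb, Finset.card_eq_one]
      obtain ⟨rfl, hJ⟩ := hB0 k t ht hb
      refine ⟨a k '' Ioo 0 q, ?_⟩
      ext e
      rw [Finset.mem_filter, Finset.mem_singleton]
      constructor
      · rintro ⟨he, hve⟩
        obtain ⟨O, hO, hZO⟩ := (ha k).exists_isOpen (S := Ico 0 q)
          (hJ ▸ Ico_subset_Ico_right hq.2.2.1)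
          (by
            rw [show Icc (0 : ℝ) 1 \ Ico 0 q = Icc 0 1 \ Iio q by
              ext x; simp +contextual]
            exact isClosed_Icc.sdiff isOpen_Iio)
        have hvO : a k 0 ∈ Z ∩ O := hZO ▸ ⟨0, ⟨le_rfl, hq.2.1⟩, rfl⟩
        obtain ⟨x, hxe, hx, hxv⟩ := hmeet e he _ hv hve O hO hvO.2
        rw [hZO] at hx
        obtain ⟨s, hs, rfl⟩ := hx
        have hs0 : 0 < s := lt_of_le_of_ne hs.1 (by rintro rfl; exact hxv rfl)
        obtain ⟨k', p', q', he', rfl⟩ := (hE e).1 he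
        exact (ha k').edge_eq he' (ha k) hq ⟨_, hxe, ⟨s, ⟨hs0, hs.2⟩, rfl⟩⟩
      · rintro rfl
        exact ⟨(hE _).2 ⟨k, _, _, hq, rfl⟩, hqm⟩
    · rw [if_neg hb]
      have ht0 : 0 < t := by
        refine lt_of_le_of_ne htI.1 ?_
        rintro rfl
        rcases (ha k).param with h | h
        · rw [h] at ht; exact lt_irrefl _ ht.1
        · exact hb h.2
      obtain ⟨p, hp⟩ := exists_isEdge_left (hT k) (h0 k) ⟨ht0, htI.2.le⟩ hv
      have hpm : a k t ∈ closure (a k '' Ioo p t) := by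
        rw [(ha k).closure_edge hp]; exact ⟨t, ⟨hp.2.1.le, le_rfl⟩, rfl⟩
      have hne : a k '' Ioo p t ≠ a k '' Ioo t q := by
        intro h
        obtain ⟨s, hs⟩ := exists_between hp.2.1
        obtain ⟨s', hs', e⟩ : a k s ∈ a k '' Ioo t q := h ▸ ⟨s, hs, rfl⟩
        have := (ha k).inj ⟨htI.1.trans hs'.1.le, hs'.2.le.trans hq.2.2.1⟩
          ⟨hp.1.trans hs.1.le, hs.2.le.trans htI.2.le⟩ e
        exact (this ▸ hs'.1).not_gt hs.2
      rw [← Finset.card_pair hne]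
      congr 1
      ext e
      rw [Finset.mem_filter, Finset.mem_insert, Finset.mem_singleton]
      constructor
      · rintro ⟨he, hve⟩
        obtain ⟨O, hO, hZO⟩ := (ha k).exists_isOpen_Ioo hp.1 hq.2.2.1
        have hvO : a k t ∈ Z ∩ O := hZO ▸ ⟨t, ⟨hp.2.1, hq.2.1⟩, rfl⟩
        obtain ⟨x, hxe, hx, hxv⟩ := hmeet e he _ hv hve O hO hvO.2
        rw [hZO] at hx
        obtain ⟨s, hs, rfl⟩ := hx
        obtain ⟨k', p', q', he', rfl⟩ := (hE e).1 he
        rcases lt_trichotomy s t with h | h | h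
        · exact .inl ((ha k').edge_eq he' (ha k) hp ⟨_, hxe, ⟨s, ⟨hs.1, h⟩, rfl⟩⟩)
        · rw [h] at hxv; exact absurd rfl hxv
        · exact .inr ((ha k').edge_eq he' (ha k) hq ⟨_, hxe, ⟨s, ⟨h, hs.2⟩, rfl⟩⟩)
      · rintro (rfl | rfl)
        · exact ⟨(hE _).2 ⟨k, _, _, hp, rfl⟩, hpm⟩
        · exact ⟨(hE _).2 ⟨k, _, _, hq, rfl⟩, hqm⟩
  -- Handshake count of the pairs (vertex, edge) with the vertex in the closure of the edge: `|B| +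
  -- 2 |P \ B| = 2 |E|`.
  have hsum := Finset.sum_card_bipartiteAbove_eq_sum_card_bipartiteBelow (s := P) (t := E)
    (fun v e => v ∈ closure e)
  simp only [Finset.bipartiteAbove, Finset.bipartiteBelow] at hsum
  rw [Finset.sum_congr rfl hdeg, Finset.sum_congr rfl hdeg2, Finset.sum_ite] at hsum
  simp only [Finset.sum_const, smul_eq_mul, mul_one] at hsum
  have hcard : (P.filter fun v => v ∈ B).card = B.ncard := by
    rw [← ncard_coe_finset]
    congr 1
    ext x
    simpa using fun h => hBP h
  rw [← hcard]
  rw [Nat.even_iff]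
  omega

/-! ### Zero sets in a box -/

/-- An implicit function theorem that is valid up to the ends of the interval. If `c` is not `g x`,
then `F (x', c)` keeps its sign for `x'` near `x`, and monotonicity keeps `g x'` on the same side of
`c`; this is the continuity of `g`. -/
theorem exists_graph_of_strictMonoOn {F : ℝ × ℝ → ℝ} {x₁ x₂ y₁ y₂ : ℝ} (hy : y₁ ≤ y₂)
    (hF : ContinuousOn F (Icc x₁ x₂ ×ˢ Icc y₁ y₂))
    (hm : ∀ x ∈ Icc x₁ x₂, StrictMonoOn (fun y => F (x, y)) (Icc y₁ y₂))
    (h₁ : ∀ x ∈ Icc x₁ x₂, F (x, y₁) < 0) (h₂ : ∀ x ∈ Icc x₁ x₂, 0 < F (x, y₂)) :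
    ∃ g : ℝ → ℝ, ContinuousOn g (Icc x₁ x₂) ∧ (∀ x ∈ Icc x₁ x₂, g x ∈ Ioo y₁ y₂) ∧
      ∀ x ∈ Icc x₁ x₂, ∀ y ∈ Icc y₁ y₂, F (x, y) = 0 ↔ y = g x := by
  have hex : ∀ x ∈ Icc x₁ x₂, ∃ y ∈ Icc y₁ y₂, F (x, y) = 0 := by
    intro x hx
    have hc : ContinuousOn (fun y => F (x, y)) (Icc y₁ y₂) :=
      hF.comp (by fun_prop) fun y hy => ⟨hx, hy⟩
    exact intermediate_value_Icc hy hc ⟨(h₁ x hx).le, (h₂ x hx).le⟩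
  choose! g hg hg0 using hex
  have hgI : ∀ x ∈ Icc x₁ x₂, g x ∈ Ioo y₁ y₂ := by
    intro x hx
    refine ⟨lt_of_le_of_ne (hg x hx).1 fun e => ?_, lt_of_le_of_ne (hg x hx).2 fun e => ?_⟩
    · have := h₁ x hx; rw [e, hg0 x hx] at this; exact lt_irrefl _ this
    · have := h₂ x hx; rw [← e, hg0 x hx] at this; exact lt_irrefl _ this
  refine ⟨g, ?_, hgI, fun x hx y hy => ⟨fun h => ?_, fun h => h ▸ hg0 x hx⟩⟩
  · intro x hx
    have hev : ∀ c ∈ Icc y₁ y₂, Filter.Tendsto (fun x => F (x, c)) (𝓝[Icc x₁ x₂] x)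
        (𝓝 (F (x, c))) := fun c hc =>
      (hF.comp (f := fun x => (x, c)) (by fun_prop) (fun x hx => ⟨hx, hc⟩)) x hx
    refine tendsto_order.2 ⟨fun c hc => ?_, fun c hc => ?_⟩
    · by_cases hcy : c < y₁
      · filter_upwards [self_mem_nhdsWithin] with x' hx' using hcy.trans (hgI x' hx').1
      have hcI : c ∈ Icc y₁ y₂ := ⟨not_lt.1 hcy, hc.le.trans (hg x hx).2⟩
      have hneg : F (x, c) < 0 := (hm x hx hcI (hg x hx) hc).trans_eq (hg0 x hx)
      filter_upwards [self_mem_nhdsWithin, (hev c hcI).eventually_lt_const hneg] with x' hx' h'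
      exact ((hm x' hx').lt_iff_lt hcI (hg x' hx')).1 (h'.trans_eq (hg0 x' hx').symm)
    · by_cases hcy : y₂ < c
      · filter_upwards [self_mem_nhdsWithin] with x' hx' using (hgI x' hx').2.trans hcy
      have hcI : c ∈ Icc y₁ y₂ := ⟨(hg x hx).1.trans hc.le, not_lt.1 hcy⟩
      have hpos : 0 < F (x, c) := (hg0 x hx).symm.trans_lt (hm x hx (hg x hx) hcI hc)
      filter_upwards [self_mem_nhdsWithin, (hev c hcI).eventually_const_lt hpos] with x' hx' h'
      exact ((hm x' hx').lt_iff_lt (hg x' hx') hcI).1 ((hg0 x' hx').trans_lt h')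
  · exact (hm x hx).injOn hy (hg x hx) (h.trans (hg0 x hx).symm)

/-- If the zero set of `F` in a box is a graph over the first coordinate, then the corresponding
subset of the range of an injective parametrization `ψ` of the box is an arc. -/
theorem exists_isArc_of_box {X : Type*} [TopologicalSpace X] {Z B : Set X}
    {ψ : ℝ × ℝ → X} {F : ℝ × ℝ → ℝ} {x₁ x₂ y₁ y₂ : ℝ} (hx : x₁ < x₂) (hy : y₁ < y₂)
    (hF : ContinuousOn F (Icc x₁ x₂ ×ˢ Icc y₁ y₂))
    (hm : ∀ x ∈ Icc x₁ x₂, StrictMonoOn (fun y => F (x, y)) (Icc y₁ y₂))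
    (h₁ : ∀ x ∈ Icc x₁ x₂, F (x, y₁) < 0) (h₂ : ∀ x ∈ Icc x₁ x₂, 0 < F (x, y₂))
    (hψ : ContinuousOn ψ (Icc x₁ x₂ ×ˢ Icc y₁ y₂)) (hinj : InjOn ψ (Icc x₁ x₂ ×ˢ Icc y₁ y₂))
    (hZ : ∀ p ∈ Icc x₁ x₂ ×ˢ Icc y₁ y₂, ψ p ∈ Z ↔ F p = 0)
    {S : Set ℝ} (hS : S = Ioo x₁ x₂ ∧ (∀ p ∈ Icc x₁ x₂ ×ˢ Icc y₁ y₂, ψ p ∉ B) ∨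
      S = Ico x₁ x₂ ∧ ∀ p ∈ Icc x₁ x₂ ×ˢ Icc y₁ y₂, ψ p ∈ Z → (ψ p ∈ B ↔ p.1 = x₁))
    (hO : IsOpen (ψ '' (S ×ˢ Ioo y₁ y₂))) :
    ∃ a J, IsArc Z B a J ∧ ∀ p ∈ S ×ˢ Ioo y₁ y₂, ψ p ∈ Z → ψ p ∈ a '' J := by
  obtain ⟨g, hg, hgI, hg0⟩ := exists_graph_of_strictMonoOn hy.le hF hm h₁ h₂
  have hgc : ∀ x ∈ Icc x₁ x₂, (x, g x) ∈ Icc x₁ x₂ ×ˢ Icc y₁ y₂ := fun x hx =>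
    ⟨hx, Ioo_subset_Icc_self (hgI x hx)⟩
  have hd : 0 < x₂ - x₁ := sub_pos.2 hx
  let l : ℝ → ℝ := fun t => x₁ + t * (x₂ - x₁)
  have hl : ∀ t ∈ Icc (0 : ℝ) 1, l t ∈ Icc x₁ x₂ := by
    intro t ht
    have h1 := mul_nonneg ht.1 hd.le
    have h2 := mul_nonneg (sub_nonneg.2 ht.2) hd.le
    constructor <;> simp only [l] <;> linarith
  have hl' : ∀ x, l ((x - x₁) / (x₂ - x₁)) = x := by
    intro x; simp only [l]; field_simp; ring
  have hSI : S ⊆ Icc x₁ x₂ := by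
    rcases hS with h | h
    · rw [h.1]; exact Ioo_subset_Icc_self
    · rw [h.1]; exact Ico_subset_Icc_self
  have key : ∀ J : Set ℝ, J ⊆ Icc 0 1 → (∀ t ∈ Icc (0 : ℝ) 1, t ∈ J ↔ l t ∈ S) →
      Z ∩ ψ '' (S ×ˢ Ioo y₁ y₂) = (fun t => ψ (l t, g (l t))) '' J := by
    intro J hJ01 hJ
    ext w
    constructor
    · rintro ⟨hw, ⟨x, y⟩, ⟨hxS, hyI⟩, rfl⟩
      have hxI := hSI hxS
      have hyI' := Ioo_subset_Icc_self hyI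
      have := (hg0 x hxI y hyI').1 ((hZ (x, y) ⟨hxI, hyI'⟩).1 hw)
      refine ⟨(x - x₁) / (x₂ - x₁), (hJ _ ?_).2 ?_, ?_⟩
      · exact ⟨div_nonneg (sub_nonneg.2 hxI.1) hd.le,
          (div_le_one hd).2 (sub_le_sub_right hxI.2 _)⟩
      · rw [hl']; exact hxS
      · simp only [hl']; rw [this]
    · rintro ⟨t, ht, rfl⟩
      have hlt := hl t (hJ01 ht)
      exact ⟨(hZ _ (hgc _ hlt)).2 ((hg0 _ hlt _ (hgc _ hlt).2).2 rfl),
        ⟨(l t, g (l t)), ⟨(hJ t (hJ01 ht)).1 ht, hgI _ hlt⟩, rfl⟩⟩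
  have hlc : Continuous l := by fun_prop
  have hl0 : ∀ t : ℝ, 0 < t → x₁ < l t := fun t ht => by
    have := mul_pos ht hd
    simp only [l]; linarith
  have hl1 : ∀ t : ℝ, t < 1 → l t < x₂ := fun t ht => by
    have := mul_pos (sub_pos.2 ht) hd
    simp only [l]; linarith
  have hl00 : l 0 = x₁ := by simp [l]
  have hl11 : l 1 = x₂ := by simp [l]
  have hlZ : ∀ t ∈ Icc (0 : ℝ) 1, ψ (l t, g (l t)) ∈ Z := fun t ht =>
    (hZ _ (hgc _ (hl t ht))).2 ((hg0 _ (hl t ht) _ (hgc _ (hl t ht)).2).2 rfl)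
  have build : ∀ J : Set ℝ, J ⊆ Icc 0 1 → (∀ t ∈ Icc (0 : ℝ) 1, t ∈ J ↔ l t ∈ S) →
      (J = Ioo 0 1 ∨ J = Ico 0 1 ∧ ψ (l 0, g (l 0)) ∈ B) →
      (∀ t ∈ Ioo (0 : ℝ) 1, ψ (l t, g (l t)) ∉ B) →
      ∃ a J, IsArc Z B a J ∧ ∀ p ∈ S ×ˢ Ioo y₁ y₂, ψ p ∈ Z → ψ p ∈ a '' J := by
    intro J hJ01 hJ hJ' hB
    refine ⟨fun t => ψ (l t, g (l t)), J, ⟨?_, ?_, hlZ, hB, hJ', _, hO, key J hJ01 hJ⟩, ?_⟩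
    · refine hψ.comp (hlc.continuousOn.prodMk (hg.comp hlc.continuousOn hl)) ?_
      exact fun t ht => hgc _ (hl t ht)
    · intro t ht t' ht' e
      have := hinj (hgc _ (hl t ht)) (hgc _ (hl t' ht')) e
      have h1 := (Prod.mk.inj this).1
      simp only [l] at h1
      exact mul_right_cancel₀ hd.ne' (by linarith)
    · intro p hp hpZ
      rw [← key J hJ01 hJ]
      exact ⟨hpZ, p, hp, rfl⟩
  rcases hS with ⟨rfl, hB⟩ | ⟨rfl, hB⟩
  · refine build (Ioo 0 1) Ioo_subset_Icc_self (fun t ht => ⟨fun h => ⟨hl0 t h.1, hl1 t h.2⟩,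
      fun h => ⟨lt_of_le_of_ne ht.1 ?_, lt_of_le_of_ne ht.2 ?_⟩⟩) (.inl rfl)
      fun t ht => hB _ (hgc _ (hl t (Ioo_subset_Icc_self ht)))
    · rintro rfl; exact h.1.ne' hl00
    · rintro rfl; exact h.2.ne hl11
  · refine build (Ico 0 1) Ico_subset_Icc_self (fun t ht => ⟨fun h => ⟨(hl t ht).1, hl1 t h.2⟩,
      fun h => ⟨ht.1, lt_of_le_of_ne ht.2 ?_⟩⟩) (.inr ⟨rfl, ?_⟩) fun t ht hb => ?_
    · rintro rfl; exact h.2.ne hl11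
    · exact (hB _ (hgc _ (hl 0 (by simp))) (hlZ 0 (by simp))).2 hl00
    · have ht' := Ioo_subset_Icc_self ht
      exact (hl0 t ht.1).ne' ((hB _ (hgc _ (hl t ht')) (hlZ t ht')).1 hb)

/-! ### Counting sign changes -/

theorem mul_pos_of_ne_zero_on_Icc {f : ℝ → ℝ} {a b : ℝ} (hab : a ≤ b)
    (hf : ContinuousOn f (Icc a b)) (h : ∀ t ∈ Icc a b, f t ≠ 0) : 0 < f a * f b := by
  by_contra hn
  have ha := h a ⟨le_rfl, hab⟩
  have hb := h b ⟨hab, le_rfl⟩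
  have hlt : f a * f b < 0 := lt_of_le_of_ne (not_lt.1 hn) (mul_ne_zero ha hb)
  rcases mul_neg_iff.1 hlt with ⟨h1, h2⟩ | ⟨h1, h2⟩
  · obtain ⟨t, ht, h0⟩ := intermediate_value_Icc' hab hf ⟨h2.le, h1.le⟩
    exact h t ht h0
  · obtain ⟨t, ht, h0⟩ := intermediate_value_Icc hab hf ⟨h1.le, h2.le⟩
    exact h t ht h0

/-- If all zeros of `f` on `[a, b]` are sign changes, then the parity of their number tells whether
the signs at the end points agree. -/
theorem even_ncard_zeros_iff {f : ℝ → ℝ} {a b : ℝ} (hab : a ≤ b) (hf : ContinuousOn f (Icc a b))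
    (ha : f a ≠ 0) (hb : f b ≠ 0) (hfin : {t ∈ Icc a b | f t = 0}.Finite)
    (hs : ∀ z ∈ Ioo a b, f z = 0 → ∃ ε > 0, ∀ s ∈ Ioo (z - ε) z, ∀ t ∈ Ioo z (z + ε),
      f s * f t < 0) :
    Even {t ∈ Icc a b | f t = 0}.ncard ↔ 0 < f a * f b := by
  induction hn : {t ∈ Icc a b | f t = 0}.ncard generalizing b with
  | zero =>
    rw [ncard_eq_zero hfin] at hn
    refine ⟨fun _ => mul_pos_of_ne_zero_on_Icc hab hf fun t ht h0 => ?_, fun _ => by simp⟩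
    exact (hn ▸ (⟨ht, h0⟩ : t ∈ {t ∈ Icc a b | f t = 0}) : t ∈ (∅ : Set ℝ))
  | succ n ih =>
    have hne : {t ∈ Icc a b | f t = 0}.Nonempty := by
      apply nonempty_of_ncard_ne_zero; omega
    obtain ⟨z, ⟨hzI, hz0⟩, hmax⟩ := hfin.exists_maximal hne
    have haz : a < z := lt_of_le_of_ne hzI.1 (by rintro rfl; exact ha hz0)
    have hzb : z < b := lt_of_le_of_ne hzI.2 (by rintro rfl; exact hb hz0)
    obtain ⟨ε, hε, hsg⟩ := hs z ⟨haz, hzb⟩ hz0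
    -- `m` and `m'` lie within `ε` of the largest zero `z`, on its two sides. The sign change at `z`
    -- excludes zeros in `[m, z)`, so replacing `b` by `m` removes exactly one zero and reverses the
    -- sign of the end value.
    obtain ⟨m, hm1, hm2⟩ := exists_between (max_lt haz (sub_lt_self z hε))
    obtain ⟨m', hm'1, hm'2⟩ := exists_between (lt_min hzb (lt_add_of_pos_right z hε))
    obtain ⟨ham, hεm⟩ := max_lt_iff.1 hm1
    obtain ⟨hmb, hmε⟩ := lt_min_iff.1 hm'2
    have hneg := hsg m ⟨hεm, hm2⟩ m' ⟨hm'1, hmε⟩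
    have hpos : 0 < f m' * f b := mul_pos_of_ne_zero_on_Icc hmb.le
      (hf.mono (Icc_subset_Icc_left (haz.trans hm'1).le)) fun t ht h0 =>
        (hmax ⟨⟨(haz.trans hm'1).le.trans ht.1, ht.2⟩, h0⟩ (hm'1.le.trans ht.1)).not_gt
          (hm'1.trans_le ht.1)
    have hm0 : f m ≠ 0 := left_ne_zero_of_mul hneg.ne
    have hset : {t ∈ Icc a m | f t = 0} = {t ∈ Icc a b | f t = 0} \ {z} := by
      ext t
      simp only [mem_sdiff, mem_singleton_iff]
      constructor
      · rintro ⟨ht, h0⟩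
        exact ⟨⟨⟨ht.1, ht.2.trans (hm2.trans hzb).le⟩, h0⟩, (ht.2.trans_lt hm2).ne⟩
      · rintro ⟨⟨ht, h0⟩, htz⟩
        have htz' : t < z := lt_of_le_of_ne (not_lt.1 fun h => (hmax ⟨ht, h0⟩ h.le).not_gt h) htz
        refine ⟨⟨ht.1, not_lt.1 fun hmt => ?_⟩, h0⟩
        have := hsg t ⟨hεm.trans hmt, htz'⟩ m' ⟨hm'1, hmε⟩
        rw [h0, zero_mul] at this
        exact lt_irrefl _ this
    have hmb' : m ≤ b := (hm2.trans hzb).le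
    have hzm : z ∈ {t | t ∈ Icc a b ∧ f t = 0} := ⟨hzI, hz0⟩
    have := ih ham.le (hf.mono (Icc_subset_Icc_right hmb')) hm0
      (hset ▸ hfin.subset sdiff_subset)
      (fun w hw h0 => hs w ⟨hw.1, hw.2.trans_le hmb'⟩ h0)
      (by rw [hset, ncard_sdiff_singleton_of_mem hzm, hn]; simp)
    rw [Nat.even_add_one, this]
    have h1 : 0 < f a * f m ↔ ¬ 0 < f a * f b := by
      rcases lt_or_gt_of_ne ha with h | h <;> rcases lt_or_gt_of_ne hb with h' | h' <;>
        rcases lt_or_gt_of_ne hm0 with h'' | h'' <;>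
        rcases lt_or_gt_of_ne (right_ne_zero_of_mul hneg.ne) with h3 | h3 <;>
        first
        | (exfalso; nlinarith)
        | simp [h, h', h'', mul_pos_iff, h.not_gt, h'.not_gt, h''.not_gt]
    rw [h1, not_not]

/-! ### Generic members of a linear family of functions on a planar domain -/

section Generic

variable {ι : Type*} [DecidableEq ι]

/-- A `C¹` map on a convex set does not raise Hausdorff dimension. A set parametrized by fewer
variables than the dimension of the ambient space therefore has dense complement. -/
theorem dimH_image_le_finrank {E F : Type*} [NormedAddCommGroup E] [NormedSpace ℝ E]
    [FiniteDimensional ℝ E] [NormedAddCommGroup F] [NormedSpace ℝ F] {f : E → F} {s : Set E}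
    (hf : ContDiffOn ℝ 1 f s) (hs : Convex ℝ s) : dimH (f '' s) ≤ Module.finrank ℝ E :=
  (hf.dimH_image_le hs Subset.rfl).trans
    ((dimH_mono (subset_univ s)).trans_eq (Real.dimH_univ_eq_finrank E))

/-- Assemble a parameter vector from its components with first index `j` and the others. -/
def insertParam (j : ι) (a : Fin 3 → ℝ) (t : {q : ι × Fin 3 // q.1 ≠ j} → ℝ) (q : ι × Fin 3) : ℝ :=
  if h : q.1 ≠ j then t ⟨q, h⟩ else a q.2

theorem insertParam_restrict (j : ι) (t : ι × Fin 3 → ℝ) :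
    insertParam j (fun i => t (j, i)) (fun q => t q.1) = t := by
  ext ⟨k, i⟩
  by_cases h : k = j
  · subst h; simp [insertParam]
  · simp [insertParam, h]

variable [Fintype ι]

theorem sum_param (j : ι) (f : ι × Fin 3 → ℝ) :
    ∑ q, f q = ∑ q : {q : ι × Fin 3 // q.1 ≠ j}, f q.1 + (f (j, 0) + f (j, 1) + f (j, 2)) := by
  rw [← Fintype.sum_subtype_add_sum_subtype (fun q : ι × Fin 3 => q.1 ≠ j) f]
  congr 1
  let e : Fin 3 ≃ {q : ι × Fin 3 // ¬ q.1 ≠ j} :=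
    { toFun := fun i => ⟨(j, i), by simp⟩
      invFun := fun q => q.1.2
      left_inv := fun i => rfl
      right_inv := by
        rintro ⟨⟨k, i⟩, h⟩
        simp only [ne_eq, not_not] at h
        subst h; rfl }
  rw [← e.sum_comp, Fin.sum_univ_three]
  rfl

theorem card_param (j : ι) :
    Fintype.card {q : ι × Fin 3 // q.1 ≠ j} + 3 = Module.finrank ℝ (ι × Fin 3 → ℝ) := by
  have h := sum_param j (fun _ => (1 : ℝ))
  simp only [Finset.sum_const, Finset.card_univ, nsmul_eq_mul, mul_one] at h
  rw [Module.finrank_fintype_fun_eq_card]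
  have : (Fintype.card (ι × Fin 3) : ℝ) =
      ((Fintype.card {q : ι × Fin 3 // q.1 ≠ j} + 3 : ℕ) : ℝ) := by
    rw [h]; push_cast; ring
  exact_mod_cast this.symm

theorem contDiffOn_insertParam {E : Type*} [NormedAddCommGroup E] [NormedSpace ℝ E] {s : Set E}
    (j : ι) {a₀ a₁ a₂ : E → ℝ} {t : E → {q : ι × Fin 3 // q.1 ≠ j} → ℝ}
    (h₀ : ContDiffOn ℝ 1 a₀ s) (h₁ : ContDiffOn ℝ 1 a₁ s) (h₂ : ContDiffOn ℝ 1 a₂ s)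
    (ht : ContDiffOn ℝ 1 t s) :
    ContDiffOn ℝ 1 (fun x => insertParam j ![a₀ x, a₁ x, a₂ x] (t x)) s := by
  rw [contDiffOn_pi]
  rintro ⟨k, i⟩
  by_cases h : k = j
  · subst h
    fin_cases i
    · simpa [TopIns.insertParam] using h₀
    · simpa [TopIns.insertParam] using h₁
    · simpa [TopIns.insertParam] using h₂
  · simpa [TopIns.insertParam, h] using contDiffOn_pi.1 ht ⟨(k, i), h⟩

/-- In a family of functions on a planar domain whose members can be changed by arbitrary affine
functions, all parameters outside of a set of codimension 1 have only regular zeros, and on the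
vertical axis only zeros which are regular for the restriction to the axis. -/
theorem dimH_singular_le (j : ι) {D : Set (ℝ × ℝ)} (hD : Convex ℝ D) (hU : UniqueDiffOn ℝ D)
    {G : ι × Fin 3 → ℝ × ℝ → ℝ} (hG : ∀ q, ContDiffOn ℝ 2 (G q) D)
    (h0 : ∀ z ∈ D, G (j, 0) z = 1) (h1 : ∀ z ∈ D, G (j, 1) z = z.1)
    (h2 : ∀ z ∈ D, G (j, 2) z = z.2) :
    dimH {t : ι × Fin 3 → ℝ | ∃ z ∈ D, ∑ q, t q * G q z = 0 ∧
      ∑ q, t q * fderivWithin ℝ (G q) D z (0, 1) = 0 ∧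
      (∑ q, t q * fderivWithin ℝ (G q) D z (1, 0) = 0 ∨ z.1 = 0)} ≤
      ((Module.finrank ℝ (ι × Fin 3 → ℝ) - 1 : ℕ) : ENNReal) := by
  have hdG : ∀ q v, ContDiffOn ℝ 1 (fun z => fderivWithin ℝ (G q) D z v) D := fun q v =>
    ((hG q).fderivWithin hU (by norm_num)).clm_apply contDiffOn_const
  have hd0 : ∀ z ∈ D, ∀ v, fderivWithin ℝ (G (j, 0)) D z v = 0 := by
    intro z hz v
    rw [fderivWithin_congr (f := fun _ => (1 : ℝ)) h0 (h0 z hz)]; simp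
  have hd1 : ∀ z ∈ D, ∀ v, fderivWithin ℝ (G (j, 1)) D z v = v.1 := by
    intro z hz v
    rw [fderivWithin_congr (f := fun z : ℝ × ℝ => z.1) h1 (h1 z hz), fderivWithin_fst (hU z hz)]
    rfl
  have hd2 : ∀ z ∈ D, ∀ v, fderivWithin ℝ (G (j, 2)) D z v = v.2 := by
    intro z hz v
    rw [fderivWithin_congr (f := fun z : ℝ × ℝ => z.2) h2 (h2 z hz), fderivWithin_snd (hU z hz)]
    rfl
  let Q := {q : ι × Fin 3 // q.1 ≠ j} → ℝ
  let d : ℝ × ℝ → ℝ × ℝ → Q → ℝ := fun v z t => ∑ q, t q * fderivWithin ℝ (G q.1) D z v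
  let V : ℝ × ℝ → Q → ℝ := fun z t => ∑ q, t q * G q.1 z
  have hd : ∀ v, ContDiffOn ℝ 1 (fun x : (ℝ × ℝ) × Q => d v x.1 x.2) (D ×ˢ univ) := by
    intro v
    refine ContDiffOn.sum fun q _ => ContDiffOn.mul (by fun_prop) ?_
    exact (hdG q.1 v).comp contDiff_fst.contDiffOn fun x hx => hx.1
  have hV : ContDiffOn ℝ 1 (fun x : (ℝ × ℝ) × Q => V x.1 x.2) (D ×ˢ univ) := by
    refine ContDiffOn.sum fun q _ => ContDiffOn.mul (by fun_prop) ?_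
    exact ((hG q.1).of_le (by norm_num)).comp contDiff_fst.contDiffOn fun x hx => hx.1
  -- On `D` the functions with first index `j` are `1, x, y`. Hence the vanishing of the value and
  -- of the `y`-derivative at `z` can be solved for `t (j, 0)` and `t (j, 2)`; the parameter `a = t
  -- (j, 1)` stays free.
  let Φ : (ℝ × ℝ) → ℝ → Q → ι × Fin 3 → ℝ := fun z a t => insertParam j
    ![-(V z t + a * z.1 + (-d (0, 1) z t) * z.2), a, -d (0, 1) z t] t
  have hΦ : ∀ t : ι × Fin 3 → ℝ, ∀ z ∈ D, ∑ q, t q * G q z = 0 →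
      ∑ q, t q * fderivWithin ℝ (G q) D z (0, 1) = 0 →
      t = Φ z (t (j, 1)) fun q => t q.1 := by
    intro t z hz e1 e2
    rw [sum_param j, h0 z hz, h1 z hz, h2 z hz] at e1
    rw [sum_param j, hd0 z hz, hd1 z hz, hd2 z hz] at e2
    conv_lhs => rw [← insertParam_restrict j t]
    simp only [Φ]
    congr 1
    have e3 : t (j, 2) = -d (0, 1) z fun q => t q.1 := by
      simp only [d]; linarith
    have e4 : t (j, 0) = -(V z (fun q => t q.1) + t (j, 1) * z.1 +
        (-d (0, 1) z fun q => t q.1) * z.2) := by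
      rw [← e3]
      simp only [V]; linarith
    ext i
    fin_cases i
    · exact e4
    · rfl
    · exact e3
  have hcard := card_param j
  -- With `N` parameters in all, `Q` has `N - 3`. In `Φ₁` the vanishing `x`-derivative also fixes `t
  -- (j, 1)`, which leaves `z` and `Q`; in `Φ₂` the point lies on the axis, which leaves its second
  -- coordinate, `t (j, 1)` and `Q`. Both have `N - 1` variables.
  let Φ₁ : (ℝ × ℝ) × Q → ι × Fin 3 → ℝ := fun x => Φ x.1 (-d (1, 0) x.1 x.2) x.2
  let Φ₂ : ℝ × ℝ × Q → ι × Fin 3 → ℝ := fun x => Φ (0, x.1) x.2.1 x.2.2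
  have hΦ₁ : ContDiffOn ℝ 1 Φ₁ (D ×ˢ univ) := by
    refine contDiffOn_insertParam j ?_ (hd _).neg (hd _).neg (by fun_prop)
    refine ((hV.add ((hd _).neg.mul ?_)).add ((hd _).neg.mul ?_)).neg <;> fun_prop
  have hmap : MapsTo (fun x : ℝ × ℝ × Q => (((0, x.1), x.2.2) : (ℝ × ℝ) × Q))
      {x | ((0, x.1) : ℝ × ℝ) ∈ D} (D ×ˢ univ) := fun x hx => ⟨hx, mem_univ _⟩
  have hΦ₂ : ContDiffOn ℝ 1 Φ₂ {x | ((0, x.1) : ℝ × ℝ) ∈ D} := by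
    have hc : ContDiffOn ℝ 1 (fun x : ℝ × ℝ × Q => (((0, x.1), x.2.2) : (ℝ × ℝ) × Q))
      {x | ((0, x.1) : ℝ × ℝ) ∈ D} := by fun_prop
    refine contDiffOn_insertParam j ?_ (by fun_prop) ((hd (0, 1)).comp hc hmap).neg (by fun_prop)
    refine (((hV.comp hc hmap).add (ContDiffOn.mul ?_ ?_)).add
      (((hd (0, 1)).comp hc hmap).neg.mul ?_)).neg <;> fun_prop
  have hc₂ : Convex ℝ {x : ℝ × ℝ × Q | ((0, x.1) : ℝ × ℝ) ∈ D} := by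
    exact hD.linear_preimage ((LinearMap.inr ℝ ℝ ℝ).comp (LinearMap.fst ℝ ℝ (ℝ × Q)))
  have b₁ := dimH_image_le_finrank hΦ₁ (hD.prod convex_univ)
  have b₂ := dimH_image_le_finrank hΦ₂ hc₂
  have hQ : Module.finrank ℝ Q = Fintype.card {q : ι × Fin 3 // q.1 ≠ j} :=
    Module.finrank_fintype_fun_eq_card ℝ
  have f₁ : Module.finrank ℝ ((ℝ × ℝ) × Q) = Module.finrank ℝ (ι × Fin 3 → ℝ) - 1 := by
    rw [Module.finrank_prod, Module.finrank_prod, hQ, Module.finrank_self]; omega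
  have f₂ : Module.finrank ℝ (ℝ × ℝ × Q) = Module.finrank ℝ (ι × Fin 3 → ℝ) - 1 := by
    rw [Module.finrank_prod, Module.finrank_prod, hQ, Module.finrank_self]; omega
  rw [f₁] at b₁
  rw [f₂] at b₂
  refine (dimH_mono ?_).trans ((dimH_union (Φ₁ '' (D ×ˢ univ)) (Φ₂ '' _)).trans_le (max_le b₁ b₂))
  rintro t ⟨z, hz, e1, e2, e3⟩
  have ht := hΦ t z hz e1 e2
  rcases e3 with e3 | e3
  · left
    refine ⟨(z, fun q => t q.1), ⟨hz, mem_univ _⟩, ?_⟩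
    rw [sum_param j, hd0 z hz, hd1 z hz, hd2 z hz] at e3
    have e4 : t (j, 1) = -d (1, 0) z fun q => t q.1 := by
      simp only [d]; linarith
    rw [e4] at ht
    exact ht.symm
  · right
    have hz' : ((0, z.2) : ℝ × ℝ) = z := by rw [← e3]
    refine ⟨(z.2, t (j, 1), fun q => t q.1), by simpa [hz'] using hz, ?_⟩
    simp only [Φ₂, hz']
    exact ht.symm

/-- The coefficient of `t (j, 0)` is `1`, so this set is a hyperplane, a graph over the other
parameters. -/
theorem dimH_zero_le (j : ι) {G : ι × Fin 3 → ℝ} (h0 : G (j, 0) = 1) :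
    dimH {t : ι × Fin 3 → ℝ | ∑ q, t q * G q = 0} ≤
      ((Module.finrank ℝ (ι × Fin 3 → ℝ) - 1 : ℕ) : ENNReal) := by
  let Q := {q : ι × Fin 3 // q.1 ≠ j} → ℝ
  let Φ : ℝ × ℝ × Q → ι × Fin 3 → ℝ := fun x => insertParam j
    ![-(∑ q, x.2.2 q * G q.1 + x.1 * G (j, 1) + x.2.1 * G (j, 2)), x.1, x.2.1] x.2.2
  have hΦ : ContDiffOn ℝ 1 Φ univ := by
    refine contDiffOn_insertParam j ?_ ?_ ?_ ?_ <;> fun_prop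
  have b := dimH_image_le_finrank hΦ convex_univ
  have hcard := card_param j
  have hQ : Module.finrank ℝ Q = Fintype.card {q : ι × Fin 3 // q.1 ≠ j} :=
    Module.finrank_fintype_fun_eq_card ℝ
  have f : Module.finrank ℝ (ℝ × ℝ × Q) = Module.finrank ℝ (ι × Fin 3 → ℝ) - 1 := by
    rw [Module.finrank_prod, Module.finrank_prod, hQ, Module.finrank_self]; omega
  rw [f] at b
  refine (dimH_mono ?_).trans b
  intro t ht
  refine ⟨(t (j, 1), t (j, 2), fun q => t q.1), mem_univ _, ?_⟩
  rw [mem_ofPred_eq, sum_param j, h0] at ht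
  conv_rhs => rw [← insertParam_restrict j t]
  simp only [Φ]
  congr 1
  ext i
  fin_cases i
  · simp; linarith
  · rfl
  · rfl

end Generic

/-- The bad parameters form a finite union of sets of dimension at most `N - 1`, one for each domain
and one for each marked point, so some parameter avoids them all. The marked points will be the base
points of the boundary circles, where the section must not vanish. -/
theorem exists_generic {ι κ : Type*} [Fintype ι] [Nonempty ι] [Finite κ] {D : ι → Set (ℝ × ℝ)}
    (hD : ∀ j, Convex ℝ (D j)) (hU : ∀ j, UniqueDiffOn ℝ (D j))
    {G : ι → ι × Fin 3 → ℝ × ℝ → ℝ} (hG : ∀ j q, ContDiffOn ℝ 2 (G j q) (D j))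
    (h0 : ∀ j, ∀ z ∈ D j, G j (j, 0) z = 1) (h1 : ∀ j, ∀ z ∈ D j, G j (j, 1) z = z.1)
    (h2 : ∀ j, ∀ z ∈ D j, G j (j, 2) z = z.2)
    (c : κ → ι) (p : κ → ℝ × ℝ) (hp : ∀ k, p k ∈ D (c k)) :
    ∃ t : ι × Fin 3 → ℝ, (∀ j, ∀ z ∈ D j, ∑ q, t q * G j q z = 0 →
      ∑ q, t q * fderivWithin ℝ (G j q) (D j) z (0, 1) ≠ 0 ∨
      ∑ q, t q * fderivWithin ℝ (G j q) (D j) z (1, 0) ≠ 0 ∧ z.1 ≠ 0) ∧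
      ∀ k, ∑ q, t q * G (c k) q (p k) ≠ 0 := by
  classical
  have b₁ := fun j => dimH_singular_le j (hD j) (hU j) (hG j) (h0 j) (h1 j) (h2 j)
  have b₂ := fun k => dimH_zero_le (c k) (G := fun q => G (c k) q (p k)) (h0 _ _ (hp k))
  have hlt : ((Module.finrank ℝ (ι × Fin 3 → ℝ) - 1 : ℕ) : ENNReal) <
      Module.finrank ℝ (ι × Fin 3 → ℝ) := by
    have := card_param (Classical.arbitrary ι)
    exact_mod_cast (by omega)
  have hb := (dimH_union _ _).trans_le (max_le ((dimH_iUnion _).trans_le (iSup_le b₁))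
    ((dimH_iUnion _).trans_le (iSup_le b₂)))
  obtain ⟨t, ht⟩ := (dense_compl_of_dimH_lt_finrank (hb.trans_lt hlt)).nonempty
  simp only [compl_union, compl_iUnion, mem_inter_iff, mem_iInter, mem_compl_iff,
    mem_ofPred_eq, not_exists, not_and, not_or] at ht
  refine ⟨t, fun j z hz e => ?_, fun k => ht.2 k⟩
  by_contra hn
  push Not at hn
  have := ht.1 j z hz e hn.1
  by_cases h : ∑ q, t q * fderivWithin ℝ (G j q) (D j) z (1, 0) = 0
  · exact this.1 h
  · exact this.2 (hn.2 h)

/-! ### Regular sections over surfaces with boundary -/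

/-- By continuity `Fy` is positive on a small box, so `F` increases strictly along its vertical
segments; narrowing the box fixes the signs on its horizontal sides. The set `S` of admissible first
coordinates is `univ` at interior points and `Ici 0` at boundary points. -/
theorem exists_box {S : Set ℝ} {D : Set (ℝ × ℝ)} {F Fy : ℝ × ℝ → ℝ}
    (hF : ContinuousOn F D) (hFy : ContinuousOn Fy D)
    (hder : ∀ x y₁ y₂, (∀ y ∈ Icc y₁ y₂, (x, y) ∈ D) → ∀ y ∈ Icc y₁ y₂,
      HasDerivWithinAt (fun y => F (x, y)) (Fy (x, y)) (Icc y₁ y₂) y)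
    {z : ℝ × ℝ} (hzS : z.1 ∈ S) (hD : D ∈ 𝓝[S ×ˢ univ] z) (hz0 : F z = 0) (hz : 0 < Fy z) :
    ∃ δ > 0, ∃ y₁ y₂, y₁ < z.2 ∧ z.2 < y₂ ∧ ∀ x ∈ S, |x - z.1| ≤ δ →
      (∀ y ∈ Icc y₁ y₂, (x, y) ∈ D) ∧ StrictMonoOn (fun y => F (x, y)) (Icc y₁ y₂) ∧
      F (x, y₁) < 0 ∧ 0 < F (x, y₂) := by
  have hzS' : z ∈ S ×ˢ (univ : Set ℝ) := ⟨hzS, mem_univ _⟩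
  have hzD : z ∈ D := mem_of_mem_nhdsWithin hzS' hD
  have hpos : ∀ᶠ p in 𝓝[S ×ˢ univ] z, p ∈ D ∧ 0 < Fy p := by
    have h1 : ContinuousWithinAt Fy (S ×ˢ univ ∩ D) z := (hFy z hzD).mono inter_subset_right
    have h2 : ∀ᶠ p in 𝓝[S ×ˢ univ ∩ D] z, 0 < Fy p := h1.eventually_const_lt hz
    rw [inter_comm, nhdsWithin_inter_of_mem hD] at h2
    exact (Filter.eventually_mem_set.2 hD).and h2
  obtain ⟨r, hr, hball⟩ := Metric.mem_nhdsWithin_iff.1 hpos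
  have hbox : ∀ x ∈ S, |x - z.1| < r → ∀ y, |y - z.2| < r → (x, y) ∈ D ∧ 0 < Fy (x, y) := by
    intro x hx hxr y hyr
    refine hball ⟨?_, hx, mem_univ _⟩
    rw [Metric.mem_ball, Prod.dist_eq, max_lt_iff, Real.dist_eq, Real.dist_eq]
    exact ⟨hxr, hyr⟩
  have hy : ∀ y ∈ Icc (z.2 - r / 2) (z.2 + r / 2), |y - z.2| < r := by
    intro y hy
    rw [abs_lt]; constructor <;> linarith [hy.1, hy.2]
  have hmono : ∀ x ∈ S, |x - z.1| < r →
      StrictMonoOn (fun y => F (x, y)) (Icc (z.2 - r / 2) (z.2 + r / 2)) := by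
    intro x hx hxr
    have hD' : ∀ y ∈ Icc (z.2 - r / 2) (z.2 + r / 2), (x, y) ∈ D := fun y h =>
      (hbox x hx hxr y (hy y h)).1
    have hd := hder x _ _ hD'
    refine strictMonoOn_of_hasDerivWithinAt_pos (f' := fun y => Fy (x, y)) (convex_Icc _ _)
      (fun y h => (hd y h).continuousWithinAt)
      (fun y h => (hd y (interior_subset h)).mono interior_subset) fun y h => ?_
    exact (hbox x hx hxr y (hy y (interior_subset h))).2
  have hIl : z.2 - r / 2 ∈ Icc (z.2 - r / 2) (z.2 + r / 2) := ⟨le_rfl, by linarith⟩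
  have hIm : z.2 ∈ Icc (z.2 - r / 2) (z.2 + r / 2) := ⟨by linarith, by linarith⟩
  have hIr : z.2 + r / 2 ∈ Icc (z.2 - r / 2) (z.2 + r / 2) := ⟨by linarith, le_rfl⟩
  have hz1 : |z.1 - z.1| < r := by simpa using hr
  have hl : F (z.1, z.2 - r / 2) < 0 :=
    (hmono z.1 hzS hz1 hIl hIm (by linarith)).trans_eq hz0
  have hu : 0 < F (z.1, z.2 + r / 2) :=
    hz0.symm.trans_lt (hmono z.1 hzS hz1 hIm hIr (by linarith))
  have hcont : ∀ y ∈ Icc (z.2 - r / 2) (z.2 + r / 2),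
      Filter.Tendsto (fun x => F (x, y)) (𝓝[S ∩ Metric.ball z.1 r] z.1) (𝓝 (F (z.1, y))) := by
    intro y h
    refine hF.comp (s := S ∩ Metric.ball z.1 r) (f := fun x => (x, y)) (by fun_prop)
      (fun x hx => ?_) z.1 ⟨hzS, Metric.mem_ball_self hr⟩
    exact (hbox x hx.1 (by simpa [Real.dist_eq] using hx.2) y (hy y h)).1
  obtain ⟨ρ, hρ, hρ'⟩ := Metric.mem_nhdsWithin_iff.1
    (((hcont _ hIl).eventually_lt_const hl).and ((hcont _ hIr).eventually_const_lt hu))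
  refine ⟨min r ρ / 2, by positivity, z.2 - r / 2, z.2 + r / 2, by linarith, by linarith, ?_⟩
  intro x hx hxδ
  have hm : 0 < min r ρ := lt_min hr hρ
  have hxr : |x - z.1| < r := lt_of_le_of_lt hxδ (by linarith [min_le_left r ρ])
  have hxρ : |x - z.1| < ρ := lt_of_le_of_lt hxδ (by linarith [min_le_right r ρ])
  have := hρ' ⟨by simpa [Real.dist_eq] using hxρ, hx, by simpa [Real.dist_eq] using hxr⟩
  exact ⟨fun y h => (hbox x hx hxr y (hy y h)).1, hmono x hx hxr, this.1, this.2⟩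

/-- `ψ`, with inverse `φ`, parametrizes an open subset of a surface with boundary `∂` by an open
subset `D` of the half plane. -/
structure HalfChart {W : Type*} [TopologicalSpace W] (bd : Set W) (D : Set (ℝ × ℝ))
    (ψ : ℝ × ℝ → W) (φ : W → ℝ × ℝ) : Prop where
  nonneg : ∀ z ∈ D, 0 ≤ z.1
  nhds : ∀ z ∈ D, D ∈ 𝓝[Ici 0 ×ˢ univ] z
  cont : ContinuousOn ψ D
  left_inv : ∀ z ∈ D, φ (ψ z) = z
  cont_inv : ContinuousOn φ (ψ '' D)
  isOpen : ∀ O, IsOpen O → O ∩ Ici 0 ×ˢ univ ⊆ D → IsOpen (ψ '' (O ∩ Ici 0 ×ˢ univ))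
  mem_bd : ∀ z ∈ D, ψ z ∈ bd ↔ z.1 = 0

namespace HalfChart

variable {W : Type*} [TopologicalSpace W] {bd : Set W} {D : Set (ℝ × ℝ)}
    {ψ : ℝ × ℝ → W} {φ : W → ℝ × ℝ}

theorem injOn (h : HalfChart bd D ψ φ) : InjOn ψ D := fun x hx y hy e => by
  rw [← h.left_inv x hx, ← h.left_inv y hy, e]

theorem isOpen_image (h : HalfChart bd D ψ φ) : IsOpen (ψ '' D) := by
  rw [isOpen_iff_mem_nhds]
  rintro _ ⟨z, hz, rfl⟩
  obtain ⟨O, hO, hzO, hOD⟩ := mem_nhdsWithin.1 (h.nhds z hz)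
  exact Filter.mem_of_superset ((h.isOpen O hO hOD).mem_nhds ⟨z, ⟨hzO, h.nonneg z hz, mem_univ _⟩, rfl⟩)
    (image_mono hOD)

end HalfChart

/-- A section `s` (in coordinates with respect to some frame of norm 1 which need not be
continuous) of a real line bundle over a surface, with its coordinates `F j` in local trivializations
over half plane charts.  The section is transverse to zero, also after restriction to the
boundary. -/
structure RegularSection (W : Type*) [TopologicalSpace W] (bd : Set W) (ι : Type*) where
  D : ι → Set (ℝ × ℝ)
  ψ : ι → ℝ × ℝ → W
  φ : ι → W → ℝ × ℝ
  chart : ∀ j, HalfChart bd (D j) (ψ j) (φ j)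
  cover : ∀ w, ∃ j, w ∈ ψ j '' D j
  s : W → ℝ
  sgn : ι → W → ℝ
  abs_sgn : ∀ j w, |sgn j w| = 1
  F : ι → ℝ × ℝ → ℝ
  dF : ι → ℝ × ℝ → ℝ × ℝ →L[ℝ] ℝ
  F_eq : ∀ j, ∀ z ∈ D j, F j z = sgn j (ψ j z) * s (ψ j z)
  hasFDerivWithinAt : ∀ j, ∀ z ∈ D j, HasFDerivWithinAt (F j) (dF j z) (D j) z
  cont_dF : ∀ j, ContinuousOn (dF j) (D j)
  regular : ∀ j, ∀ z ∈ D j, F j z = 0 → dF j z (0, 1) ≠ 0 ∨ dF j z (1, 0) ≠ 0 ∧ z.1 ≠ 0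

namespace RegularSection

variable {W : Type*} [TopologicalSpace W] {bd : Set W} {ι : Type*} (R : RegularSection W bd ι)

theorem sgn_ne_zero (j : ι) (w : W) : R.sgn j w ≠ 0 := fun h => by
  have := R.abs_sgn j w
  rw [h, abs_zero] at this
  exact zero_ne_one this

theorem cont_F (j : ι) : ContinuousOn (R.F j) (R.D j) := fun z hz =>
  (R.hasFDerivWithinAt j z hz).continuousWithinAt

theorem F_eq_zero_iff {j : ι} {z : ℝ × ℝ} (hz : z ∈ R.D j) : R.s (R.ψ j z) = 0 ↔ R.F j z = 0 := by
  rw [R.F_eq j z hz, mul_eq_zero, or_iff_right (R.sgn_ne_zero _ _)]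

/-- The function `s` need not be continuous, being written in a discontinuous frame, but locally its
zeros are those of the continuous coordinates `F j`. -/
theorem isClosed_zeros : IsClosed {w | R.s w = 0} := by
  rw [← isOpen_compl_iff, isOpen_iff_mem_nhds]
  intro w hw
  obtain ⟨j, z, hz, rfl⟩ := R.cover w
  have hc := R.chart j
  have h1 : ContinuousOn (fun w => R.F j (R.φ j w)) (R.ψ j '' R.D j) :=
    (R.cont_F j).comp hc.cont_inv (by rintro _ ⟨z, hz, rfl⟩; rwa [hc.left_inv z hz])
  have hm : R.ψ j '' R.D j ∈ 𝓝 (R.ψ j z) := hc.isOpen_image.mem_nhds ⟨z, hz, rfl⟩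
  have h2 := h1.continuousAt hm
  have h3 : R.F j (R.φ j (R.ψ j z)) ≠ 0 := by
    rw [hc.left_inv z hz]; exact fun h => hw ((R.F_eq_zero_iff hz).2 h)
  filter_upwards [h2.eventually_ne h3, hm] with w' h4 h5
  obtain ⟨z', hz', rfl⟩ := h5
  rw [hc.left_inv z' hz'] at h4
  exact fun h => h4 ((R.F_eq_zero_iff hz').1 h)

theorem hasDerivWithinAt_snd {j : ι} {x y₁ y₂ : ℝ} (h : ∀ y ∈ Icc y₁ y₂, (x, y) ∈ R.D j) {y : ℝ}
    (hy : y ∈ Icc y₁ y₂) :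
    HasDerivWithinAt (fun y => R.F j (x, y)) (R.dF j (x, y) (0, 1)) (Icc y₁ y₂) y := by
  have := (R.hasFDerivWithinAt j (x, y) (h y hy)).comp_hasDerivWithinAt (s := Icc y₁ y₂) y
    (f := fun y => (x, y)) (f' := (0, 1))
    ((hasDerivWithinAt_const _ _ _).prodMk (hasDerivWithinAt_id _ _)) h
  exact this

theorem hasDerivWithinAt_fst {j : ι} {x y₁ y₂ : ℝ} (h : ∀ y ∈ Icc y₁ y₂, (y, x) ∈ R.D j) {y : ℝ}
    (hy : y ∈ Icc y₁ y₂) :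
    HasDerivWithinAt (fun y => R.F j (y, x)) (R.dF j (y, x) (1, 0)) (Icc y₁ y₂) y := by
  have := (R.hasFDerivWithinAt j (y, x) (h y hy)).comp_hasDerivWithinAt (s := Icc y₁ y₂) y
    (f := fun y => (y, x)) (f' := (1, 0))
    ((hasDerivWithinAt_id _ _).prodMk (hasDerivWithinAt_const _ _ _)) h
  exact this

/-- Near a zero where the second partial derivative does not vanish, the coordinate function has
the shape of `exists_graph_of_strictMonoOn`, up to a sign `e`. -/
theorem exists_box_snd {j : ι} {S : Set ℝ} {z : ℝ × ℝ} (hzS : z.1 ∈ S)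
    (hD : R.D j ∈ 𝓝[S ×ˢ univ] z) (hz0 : R.F j z = 0) (hz : R.dF j z (0, 1) ≠ 0) :
    ∃ e : ℝ, e ≠ 0 ∧ ∃ δ > 0, ∃ y₁ y₂, y₁ < z.2 ∧ z.2 < y₂ ∧ ∀ x ∈ S, |x - z.1| ≤ δ →
      (∀ y ∈ Icc y₁ y₂, (x, y) ∈ R.D j) ∧
      StrictMonoOn (fun y => e * R.F j (x, y)) (Icc y₁ y₂) ∧
      e * R.F j (x, y₁) < 0 ∧ 0 < e * R.F j (x, y₂) := by
  refine ⟨R.dF j z (0, 1), hz, ?_⟩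
  refine exists_box (Fy := fun p => R.dF j z (0, 1) * R.dF j p (0, 1))
    (continuousOn_const.mul (R.cont_F j))
    (continuousOn_const.mul ((R.cont_dF j).clm_apply continuousOn_const)) ?_ hzS hD
    (by simp [hz0]) (mul_self_pos.2 hz)
  exact fun x y₁ y₂ h y hy => (R.hasDerivWithinAt_snd h hy).const_mul _

/-- Needed where only the `x`-derivative is nonzero, which regularity allows at interior points
alone. The coordinates are exchanged, and the intersection with `0 < p.1` keeps the box off the
boundary. -/
theorem exists_box_fst {j : ι} {z : ℝ × ℝ} (hpos : 0 < z.1)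
    (hD : R.D j ∈ 𝓝 z) (hz0 : R.F j z = 0) (hz : R.dF j z (1, 0) ≠ 0) :
    ∃ e : ℝ, e ≠ 0 ∧ ∃ δ > 0, ∃ y₁ y₂, y₁ < z.1 ∧ z.1 < y₂ ∧ ∀ x, |x - z.2| ≤ δ →
      (∀ y ∈ Icc y₁ y₂, (y, x) ∈ R.D j ∩ {p | 0 < p.1}) ∧
      StrictMonoOn (fun y => e * R.F j (y, x)) (Icc y₁ y₂) ∧
      e * R.F j (y₁, x) < 0 ∧ 0 < e * R.F j (y₂, x) := by
  refine ⟨R.dF j z (1, 0), hz, ?_⟩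
  have hsw : MapsTo (Prod.swap : ℝ × ℝ → ℝ × ℝ) (Prod.swap ⁻¹' (R.D j ∩ {p | 0 < p.1}))
      (R.D j) := fun p hp => hp.1
  have := exists_box (S := univ) (D := Prod.swap ⁻¹' (R.D j ∩ {p | 0 < p.1})) (z := z.swap)
    (F := fun p => R.dF j z (1, 0) * R.F j p.swap)
    (Fy := fun p => R.dF j z (1, 0) * R.dF j p.swap (1, 0))
    (continuousOn_const.mul ((R.cont_F j).comp continuous_swap.continuousOn hsw))
    (continuousOn_const.mul
      (((R.cont_dF j).comp continuous_swap.continuousOn hsw).clm_apply continuousOn_const))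
    (fun x y₁ y₂ h y hy => (R.hasDerivWithinAt_fst (fun y hy => (h y hy).1) hy).const_mul _) (mem_univ _)
    (by
      rw [univ_prod_univ, nhdsWithin_univ]
      exact continuous_swap.continuousAt.preimage_mem_nhds (by
        rw [Prod.swap_swap]
        exact Filter.inter_mem hD ((isOpen_lt continuous_const continuous_fst).mem_nhds hpos)))
    (by simp [hz0]) (mul_self_pos.2 hz)
  simpa using this

/-- The zeros of a regular section form a one-dimensional manifold. -/
theorem exists_isArc {w : W} (hw : R.s w = 0) :
    ∃ a J, IsArc {w | R.s w = 0} ({w | R.s w = 0} ∩ bd) a J ∧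
      ∃ N ∈ 𝓝 w, ∀ w' ∈ N, R.s w' = 0 → w' ∈ a '' J := by
  obtain ⟨j, z, hz, rfl⟩ := R.cover w
  have hc := R.chart j
  have hF0 := (R.F_eq_zero_iff hz).1 hw
  -- arcs over an interval of the first coordinate, `x₁ = 0` at the boundary
  have main : ∀ (sw : ℝ × ℝ → ℝ × ℝ), (∀ p, sw (sw p) = p) → Continuous sw →
      ∀ {x₁ x₂ y₁ y₂ e : ℝ} {S : Set ℝ}, x₁ < x₂ → y₁ < y₂ → e ≠ 0 →
      (∀ x ∈ Icc x₁ x₂, (∀ y ∈ Icc y₁ y₂, sw (x, y) ∈ R.D j) ∧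
        StrictMonoOn (fun y => e * R.F j (sw (x, y))) (Icc y₁ y₂) ∧
        e * R.F j (sw (x, y₁)) < 0 ∧ 0 < e * R.F j (sw (x, y₂))) →
      ((S = Ioo x₁ x₂ ∧ ∀ p ∈ Icc x₁ x₂ ×ˢ Icc y₁ y₂, 0 < (sw p).1) ∨
        (S = Ico x₁ x₂ ∧ ∀ p, (sw p).1 = 0 ↔ p.1 = x₁)) →
      (∃ O, IsOpen O ∧ sw '' (S ×ˢ Ioo y₁ y₂) = O ∩ Ici 0 ×ˢ univ) →
      z ∈ sw '' (S ×ˢ Ioo y₁ y₂) →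
      ∃ a J, IsArc {w | R.s w = 0} ({w | R.s w = 0} ∩ bd) a J ∧
        ∃ N ∈ 𝓝 (R.ψ j z), ∀ w' ∈ N, R.s w' = 0 → w' ∈ a '' J := by
    intro sw hsw hswc x₁ x₂ y₁ y₂ e S hx hy he hbox hS ⟨O, hO, hOS⟩ hzS
    have hDbox : MapsTo sw (Icc x₁ x₂ ×ˢ Icc y₁ y₂) (R.D j) := fun p hp =>
      (hbox p.1 hp.1).1 p.2 hp.2
    have hSI : S ⊆ Icc x₁ x₂ := by
      rcases hS with h | h
      · rw [h.1]; exact Ioo_subset_Icc_self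
      · rw [h.1]; exact Ico_subset_Icc_self
    have hopen : IsOpen ((fun p => R.ψ j (sw p)) '' (S ×ˢ Ioo y₁ y₂)) := by
      rw [← image_image, hOS]
      refine hc.isOpen O hO (hOS ▸ ?_)
      rintro _ ⟨p, hp, rfl⟩
      exact hDbox ⟨hSI hp.1, Ioo_subset_Icc_self hp.2⟩
    obtain ⟨a, J, ha, hcov⟩ := exists_isArc_of_box (Z := {w | R.s w = 0})
      (B := {w | R.s w = 0} ∩ bd) (ψ := fun p => R.ψ j (sw p)) (F := fun p => e * R.F j (sw p))
      (S := S) hx hy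
      (continuousOn_const.mul ((R.cont_F j).comp hswc.continuousOn hDbox))
      (fun x h => (hbox x h).2.1) (fun x h => (hbox x h).2.2.1) (fun x h => (hbox x h).2.2.2)
      (hc.cont.comp hswc.continuousOn hDbox)
      (fun p hp q hq h => by
        have := hc.injOn (hDbox hp) (hDbox hq) h
        rw [← hsw p, ← hsw q, this])
      (fun p hp => by
        rw [mem_ofPred_eq, R.F_eq_zero_iff (hDbox hp), mul_eq_zero, or_iff_right he])
      (by
        rcases hS with ⟨hS, h⟩ | ⟨hS, h⟩
        · refine .inl ⟨hS, fun p hp hb => ?_⟩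
          exact (h p hp).ne' ((hc.mem_bd _ (hDbox hp)).1 hb.2)
        · refine .inr ⟨hS, fun p hp hpZ => ?_⟩
          rw [← h p, ← hc.mem_bd _ (hDbox hp)]
          exact ⟨fun hb => hb.2, fun hb => ⟨hpZ, hb⟩⟩)
      hopen
    refine ⟨a, J, ha, _, hopen.mem_nhds ?_, ?_⟩
    · obtain ⟨p, hp, rfl⟩ := hzS
      exact ⟨p, hp, rfl⟩
    · rintro _ ⟨p, hp, rfl⟩ h0
      exact hcov p hp h0
  have hzn := hc.nonneg z hz
  have hint : 0 < z.1 → R.D j ∈ 𝓝 z := fun hpos => by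
    have := hc.nhds z hz
    rwa [nhdsWithin_eq_nhds.2] at this
    exact prod_mem_nhds (Ici_mem_nhds hpos) Filter.univ_mem
  have hregular := R.regular j z hz hF0
  by_cases hy : R.dF j z (0, 1) ≠ 0
  -- On the boundary, `x₁ = 0` and the half-open interval `Ico 0 δ` give an arc that starts at a
  -- point of `bd`.
  · rcases eq_or_lt_of_le hzn with h0 | hpos
    · obtain ⟨e, he, δ, hδ, y₁, y₂, hy₁, hy₂, hbox⟩ := R.exists_box_snd (S := Ici 0) hzn
        (hc.nhds z hz) hF0 hy
      refine main id (fun _ => rfl) continuous_id (x₁ := 0) (x₂ := δ) (S := Ico 0 δ) hδ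
        (hy₁.trans hy₂) he (fun x hx => hbox x hx.1 ?_) (.inr ⟨rfl, fun p => Iff.rfl⟩)
        ⟨Iio δ ×ˢ Ioo y₁ y₂, isOpen_Iio.prod isOpen_Ioo, ?_⟩ ?_
      · rw [← h0, sub_zero, abs_of_nonneg hx.1]; exact hx.2
      · ext p
        simp only [image_id, mem_prod, mem_Ico, mem_Ioo, mem_inter_iff, mem_Iio, mem_Ici, mem_univ,
          and_true]
        tauto
      · rw [image_id]; exact ⟨⟨hzn, h0 ▸ hδ⟩, hy₁, hy₂⟩
    · have hDn := hint hpos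
      obtain ⟨e, he, δ, hδ, y₁, y₂, hy₁, hy₂, hbox⟩ := R.exists_box_snd (S := univ) (mem_univ _)
        (by rwa [univ_prod_univ, nhdsWithin_univ]) hF0 hy
      -- Taking `ρ < z.1` keeps the whole closed box away from the boundary.
      obtain ⟨ρ, hρ0, hρ⟩ := exists_between (lt_min hδ hpos)
      obtain ⟨hρδ, hρz⟩ := lt_min_iff.1 hρ
      refine main id (fun _ => rfl) continuous_id (x₁ := z.1 - ρ) (x₂ := z.1 + ρ)
        (S := Ioo (z.1 - ρ) (z.1 + ρ)) (by linarith)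
        (hy₁.trans hy₂) he (fun x hx => hbox x (mem_univ _) ?_)
        (.inl ⟨rfl, fun p hp => ?_⟩)
        ⟨Ioo (z.1 - ρ) (z.1 + ρ) ×ˢ Ioo y₁ y₂, isOpen_Ioo.prod isOpen_Ioo, ?_⟩ ?_
      · rw [abs_le]; constructor <;> linarith [hx.1, hx.2]
      · have := hp.1.1; simp only [id]; linarith
      · rw [image_id, inter_eq_left.2]
        intro p hp
        have := hp.1.1
        exact ⟨by simp only [mem_Ici]; linarith, mem_univ _⟩
      · rw [image_id]; exact ⟨⟨by linarith, by linarith⟩, hy₁, hy₂⟩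
  · obtain ⟨hx, hz1⟩ := hregular.resolve_left hy
    have hpos : 0 < z.1 := lt_of_le_of_ne hzn (Ne.symm hz1)
    obtain ⟨e, he, δ, hδ, y₁, y₂, hy₁, hy₂, hbox⟩ := R.exists_box_fst hpos (hint hpos) hF0 hx
    have hδ' : ∀ x ∈ Icc (z.2 - δ) (z.2 + δ), |x - z.2| ≤ δ := fun x hx => by
      rw [abs_le]; constructor <;> linarith [hx.1, hx.2]
    have hshrink : 0 < y₁ := ((hbox z.2 (by simpa using hδ.le)).1 y₁
      ⟨le_rfl, (hy₁.trans hy₂).le⟩).2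
    refine main Prod.swap (fun _ => rfl) continuous_swap (x₁ := z.2 - δ) (x₂ := z.2 + δ)
      (S := Ioo (z.2 - δ) (z.2 + δ)) (by linarith)
      (hy₁.trans hy₂) he
      (fun x hx => ⟨fun y hy => ((hbox x (hδ' x hx)).1 y hy).1, (hbox x (hδ' x hx)).2⟩)
      (.inl ⟨rfl, fun p hp => ?_⟩)
      ⟨Ioo y₁ y₂ ×ˢ Ioo (z.2 - δ) (z.2 + δ), isOpen_Ioo.prod isOpen_Ioo, ?_⟩ ?_
    · exact hshrink.trans_le hp.2.1
    · rw [image_swap_prod, inter_eq_left.2]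
      intro p hp
      exact ⟨hshrink.le.trans hp.1.1.le, mem_univ _⟩
    · exact ⟨(z.2, z.1), ⟨⟨by simp [hδ], by simp [hδ]⟩, hy₁, hy₂⟩, rfl⟩

end RegularSection

/-! ### Zeros on the boundary circles and holonomy -/

namespace RegularSection

variable {W : Type*} [TopologicalSpace W] {bd : Set W} {ι : Type*} (R : RegularSection W bd ι)

/-- A simple closed curve `γ` in the boundary, along which `η` compares a continuous frame of the
line bundle with the frame in which the section `s` is written.  The value `η 0 * η 1` is the
holonomy of the line bundle along `γ`. -/
structure BoundaryLoop (γ : ℝ → W) (η : ℝ → ℝ) : Prop where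
  cont : ContinuousOn γ (Icc 0 1)
  inj : InjOn γ (Ico 0 1)
  closed : γ 1 = γ 0
  mem_bd : ∀ t ∈ Icc (0 : ℝ) 1, γ t ∈ bd
  abs_eta : ∀ t, |η t| = 1
  cont_eta : ∀ j, ContinuousOn (fun t => η t * R.sgn j (γ t))
    (Icc 0 1 ∩ γ ⁻¹' (R.ψ j '' R.D j))
  ne_zero : R.s (γ 0) ≠ 0

theorem sgn_mul_self (j : ι) (w : W) : R.sgn j w * R.sgn j w = 1 := by
  rw [← abs_mul_abs_self, R.abs_sgn, mul_one]

namespace BoundaryLoop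

variable {R} {γ : ℝ → W} {η : ℝ → ℝ}

theorem eta_mul_s (j : ι) {t : ℝ} (ht : γ t ∈ R.ψ j '' R.D j) :
    η t * R.s (γ t) = η t * R.sgn j (γ t) * R.F j (R.φ j (γ t)) := by
  obtain ⟨z, hz, e⟩ := ht
  rw [← e, (R.chart j).left_inv z hz, R.F_eq j z hz]
  linear_combination -(η t * R.s (R.ψ j z)) * R.sgn_mul_self j (R.ψ j z)

/-- The product `η * s` is the coordinate of the section in a continuous frame along `γ`. In a chart
it is the continuous comparison sign `η * sgn j` times `F j`, although `η` and `s` may both jump. -/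
theorem continuousOn (h : R.BoundaryLoop γ η) :
    ContinuousOn (fun t => η t * R.s (γ t)) (Icc 0 1) := by
  intro t ht
  obtain ⟨j, hj⟩ := R.cover (γ t)
  have hc := R.chart j
  have hmem : γ ⁻¹' (R.ψ j '' R.D j) ∈ 𝓝[Icc 0 1] t :=
    h.cont t ht (hc.isOpen_image.mem_nhds hj)
  have h1 : ContinuousOn (fun t => η t * R.sgn j (γ t) * R.F j (R.φ j (γ t)))
      (Icc 0 1 ∩ γ ⁻¹' (R.ψ j '' R.D j)) := by
    refine (h.cont_eta j).mul ((R.cont_F j).comp (t := R.D j)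
      (hc.cont_inv.comp (h.cont.mono inter_subset_left) fun t ht => ht.2) ?_)
    rintro t ⟨-, z, hz, e⟩
    show R.φ j (γ t) ∈ R.D j
    rw [← e, hc.left_inv z hz]; exact hz
  have h2 := (h1 t ⟨ht, hj⟩).congr (g := fun t => η t * R.s (γ t))
    (fun t ht => eta_mul_s j ht.2) (eta_mul_s j hj)
  rw [inter_comm] at h2
  rwa [ContinuousWithinAt, nhdsWithin_inter_of_mem hmem] at h2

/-- At a zero of a regular section on the boundary, the sign changes. -/
theorem sign_change (h : R.BoundaryLoop γ η) {t : ℝ} (ht : t ∈ Ioo (0 : ℝ) 1)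
    (h0 : η t * R.s (γ t) = 0) : ∃ ε > 0, ∀ u ∈ Ioo (t - ε) t, ∀ v ∈ Ioo t (t + ε),
      η u * R.s (γ u) * (η v * R.s (γ v)) < 0 := by
  have htI := Ioo_subset_Icc_self ht
  have hη : ∀ t, η t ≠ 0 := fun t e => by
    have := h.abs_eta t
    rw [e, abs_zero] at this; exact zero_ne_one this
  have hs : R.s (γ t) = 0 := (mul_eq_zero.1 h0).resolve_left (hη t)
  obtain ⟨j, z, hz, hzt⟩ := R.cover (γ t)
  have hc := R.chart j
  have hF0 : R.F j z = 0 := (R.F_eq_zero_iff hz).1 (by rw [hzt, hs])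
  have hz1 : z.1 = 0 := (hc.mem_bd z hz).1 (hzt ▸ h.mem_bd t htI)
  -- On the boundary only the second alternative of regularity is excluded, so the section is
  -- transverse along the boundary line itself.
  have hdy : R.dF j z (0, 1) ≠ 0 := (R.regular j z hz hF0).resolve_right fun h => h.2 hz1
  obtain ⟨e, he, δ, hδ, y₁, y₂, hy₁, hy₂, hbox⟩ := R.exists_box_snd (S := Ici 0)
    (hc.nonneg z hz) (hc.nhds z hz) hF0 hdy
  obtain ⟨-, hmono, -, -⟩ := hbox 0 (by simp) (by simp [hz1, hδ.le])
  -- the second coordinate along `γ`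
  let y : ℝ → ℝ := fun u => (R.φ j (γ u)).2
  have hγt : ContinuousAt γ t := h.cont.continuousAt (Icc_mem_nhds ht.1 ht.2)
  have hV : R.ψ j '' R.D j ∈ 𝓝 (γ t) := hc.isOpen_image.mem_nhds ⟨z, hz, hzt⟩
  have hφt : R.φ j (γ t) = z := by rw [← hzt, hc.left_inv z hz]
  have hycont : ContinuousAt y t :=
    continuous_snd.continuousAt.comp ((hc.cont_inv.continuousAt hV).comp hγt)
  have hκ : ContinuousAt (fun u => η u * R.sgn j (γ u)) t :=
    (h.cont_eta j).continuousAt (Filter.inter_mem (Icc_mem_nhds ht.1 ht.2) (hγt hV))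
  have hκ0 : η t * R.sgn j (γ t) ≠ 0 := mul_ne_zero (hη t) (R.sgn_ne_zero _ _)
  have hyt : y t = z.2 := by simp only [y, hφt]
  have hev : ∀ᶠ u in 𝓝 t, u ∈ Ioo (0 : ℝ) 1 ∧ γ u ∈ R.ψ j '' R.D j ∧ y u ∈ Ioo y₁ y₂ ∧
      0 < η u * R.sgn j (γ u) * (η t * R.sgn j (γ t)) := by
    refine Filter.Eventually.and (Ioo_mem_nhds ht.1 ht.2) (Filter.Eventually.and (hγt hV)
      (Filter.Eventually.and (hycont (Ioo_mem_nhds (hyt ▸ hy₁) (hyt ▸ hy₂))) ?_))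
    exact (hκ.mul continuousAt_const).eventually_const_lt (mul_self_pos.2 hκ0)
  obtain ⟨ρ, hρ, hball⟩ := Metric.eventually_nhds_iff.1 hev
  have hI : ∀ u ∈ Icc (t - ρ / 2) (t + ρ / 2), u ∈ Ioo (0 : ℝ) 1 ∧ γ u ∈ R.ψ j '' R.D j ∧
      y u ∈ Ioo y₁ y₂ ∧ 0 < η u * R.sgn j (γ u) * (η t * R.sgn j (γ t)) := fun u hu => by
    refine hball ?_
    rw [Real.dist_eq, abs_lt]; constructor <;> linarith [hu.1, hu.2]
  have hγy : ∀ u ∈ Icc (t - ρ / 2) (t + ρ / 2), R.φ j (γ u) = (0, y u) := by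
    intro u hu
    obtain ⟨h1, ⟨z', hz', e'⟩, -⟩ := hI u hu
    have : z'.1 = 0 := (hc.mem_bd z' hz').1 (e' ▸ h.mem_bd u (Ioo_subset_Icc_self h1))
    simp only [y]
    rw [← e', hc.left_inv z' hz', ← this]
  have hyinj : InjOn y (Icc (t - ρ / 2) (t + ρ / 2)) := by
    intro u hu v hv huv
    have hφ : R.φ j (γ u) = R.φ j (γ v) := by rw [hγy u hu, hγy v hv, huv]
    obtain ⟨h1, ⟨z', hz', e'⟩, -⟩ := hI u hu
    obtain ⟨h2, ⟨z'', hz'', e''⟩, -⟩ := hI v hv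
    rw [← e', ← e'', hc.left_inv z' hz', hc.left_inv z'' hz''] at hφ
    exact h.inj (Ioo_subset_Ico_self h1) (Ioo_subset_Ico_self h2) (by rw [← e', ← e'', hφ])
  have hyc : ContinuousOn y (Icc (t - ρ / 2) (t + ρ / 2)) := by
    refine continuous_snd.comp_continuousOn (hc.cont_inv.comp
      (h.cont.mono fun u hu => Ioo_subset_Icc_self (hI u hu).1) fun u hu => (hI u hu).2.1)
  have hρ2 : t - ρ / 2 ≤ t + ρ / 2 := by linarith
  have htm : t ∈ Icc (t - ρ / 2) (t + ρ / 2) := ⟨by linarith, by linarith⟩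
  refine ⟨ρ / 2, by linarith, fun u hu v hv => ?_⟩
  have hu' : u ∈ Icc (t - ρ / 2) (t + ρ / 2) := ⟨hu.1.le, by linarith [hu.2]⟩
  have hv' : v ∈ Icc (t - ρ / 2) (t + ρ / 2) := ⟨by linarith [hv.1], hv.2.le⟩
  -- A continuous injective function on an interval is strictly monotone, so `γ` runs through the
  -- zero from one side to the other along the boundary line, where `e * F j` is strictly monotone
  -- too.
  have hprod : (y u - y t) * (y v - y t) < 0 := by
    rcases hyc.strictMonoOn_of_injOn_Icc' hρ2 hyinj with hm | hm
    · exact mul_neg_of_neg_of_pos (sub_neg.2 (hm hu' htm hu.2)) (sub_pos.2 (hm htm hv' hv.1))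
    · exact mul_neg_of_pos_of_neg (sub_pos.2 (hm hu' htm hu.2)) (sub_neg.2 (hm htm hv' hv.1))
  have hsgn : ∀ w ∈ Icc (t - ρ / 2) (t + ρ / 2),
      (y w < y t → e * R.F j (0, y w) < 0) ∧ (y t < y w → 0 < e * R.F j (0, y w)) := by
    intro w hw
    have hz' : e * R.F j (0, y t) = 0 := by
      rw [hyt, show ((0 : ℝ), z.2) = z from Prod.ext hz1.symm rfl, hF0, mul_zero]
    have h1 := Ioo_subset_Icc_self (hI w hw).2.2.1
    have h2 := Ioo_subset_Icc_self (hI t htm).2.2.1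
    exact ⟨fun hlt => (hmono h1 h2 hlt).trans_eq hz', fun hlt => hz'.symm.trans_lt (hmono h2 h1 hlt)⟩
  have hFF : (e * R.F j (0, y u)) * (e * R.F j (0, y v)) < 0 := by
    rcases mul_neg_iff.1 hprod with ⟨h1, h2⟩ | ⟨h1, h2⟩
    · exact mul_neg_of_pos_of_neg ((hsgn u hu').2 (sub_pos.1 h1)) ((hsgn v hv').1 (sub_neg.1 h2))
    · exact mul_neg_of_neg_of_pos ((hsgn u hu').1 (sub_neg.1 h1)) ((hsgn v hv').2 (sub_pos.1 h2))
  rw [eta_mul_s j (hI u hu').2.1, eta_mul_s j (hI v hv').2.1, hγy u hu', hγy v hv']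
  have hκκ := mul_pos (hI u hu').2.2.2 (hI v hv').2.2.2
  have he2 := mul_self_pos.2 he
  have hk2 := mul_self_pos.2 hκ0
  set κu := η u * R.sgn j (γ u)
  set κv := η v * R.sgn j (γ v)
  set κt := η t * R.sgn j (γ t)
  have h1 : 0 < κu * κv := by
    refine pos_of_mul_pos_left (b := κt * κt) ?_ hk2.le
    linarith [hκκ]
  have h2 : R.F j (0, y u) * R.F j (0, y v) < 0 := by
    by_contra hn
    have := mul_nonneg he2.le (not_lt.1 hn)
    linarith
  have := mul_neg_of_pos_of_neg h1 h2
  linarith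

/-- The zeros on the curve correspond to the zeros of `η * s` on `[0, 1]`; none is counted twice,
because the base point is not a zero. As `s (γ 1) = s (γ 0)`, the signs at the two ends agree
exactly when `η 0` and `η 1` do. -/
theorem even_ncard_iff (h : R.BoundaryLoop γ η)
    (hfin : ({w | R.s w = 0} ∩ γ '' Icc 0 1).Finite) :
    Even ({w | R.s w = 0} ∩ γ '' Icc 0 1).ncard ↔ 0 < η 0 * η 1 := by
  have hη : ∀ t, η t ≠ 0 := fun t e => by
    have := h.abs_eta t
    rw [e, abs_zero] at this; exact zero_ne_one this
  have himg : {w | R.s w = 0} ∩ γ '' Icc 0 1 = γ '' {t ∈ Icc 0 1 | η t * R.s (γ t) = 0} := by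
    ext w
    constructor
    · rintro ⟨hw, t, ht, rfl⟩
      exact ⟨t, ⟨ht, mul_eq_zero_of_right _ hw⟩, rfl⟩
    · rintro ⟨t, ⟨ht, h0⟩, rfl⟩
      exact ⟨(mul_eq_zero.1 h0).resolve_left (hη t), t, ht, rfl⟩
  have hinj : InjOn γ {t ∈ Icc 0 1 | η t * R.s (γ t) = 0} := by
    refine h.inj.mono ?_
    rintro t ⟨ht, h0⟩
    refine ⟨ht.1, lt_of_le_of_ne ht.2 ?_⟩
    rintro rfl
    rw [h.closed] at h0
    exact h.ne_zero ((mul_eq_zero.1 h0).resolve_left (hη 1))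
  rw [himg] at hfin ⊢
  rw [hinj.ncard_image, even_ncard_zeros_iff zero_le_one h.continuousOn
    (mul_ne_zero (hη 0) h.ne_zero) (mul_ne_zero (hη 1) (h.closed ▸ h.ne_zero))
    (Finite.of_finite_image hfin hinj) fun t ht h0 => h.sign_change ht h0, h.closed]
  have : 0 < R.s (γ 0) * R.s (γ 0) := mul_self_pos.2 h.ne_zero
  rw [show η 0 * R.s (γ 0) * (η 1 * R.s (γ 0)) = η 0 * η 1 * (R.s (γ 0) * R.s (γ 0)) by ring]
  exact mul_pos_iff_of_pos_right this

end BoundaryLoop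

/-- The product of the holonomies of a real line bundle over a compact surface along its two
boundary components is `1`. -/
theorem holonomy_mul_pos [T2Space W] [CompactSpace W] {γ γ' : ℝ → W} {η η' : ℝ → ℝ}
    (h : R.BoundaryLoop γ η) (h' : R.BoundaryLoop γ' η')
    (hd : Disjoint (γ '' Icc 0 1) (γ' '' Icc 0 1)) (hu : γ '' Icc 0 1 ∪ γ' '' Icc 0 1 = bd) :
    0 < η 0 * η 1 * (η' 0 * η' 1) := by
  have hZ : IsCompact {w | R.s w = 0} := R.isClosed_zeros.isCompact
  have harc : ∀ w : {w | R.s w = 0}, ∃ a J, IsArc {w | R.s w = 0} ({w | R.s w = 0} ∩ bd) a J ∧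
      ∃ N ∈ 𝓝 w.1, ∀ w' ∈ N, R.s w' = 0 → w' ∈ a '' J := fun w => R.exists_isArc w.2
  choose a J ha N hN hNa using harc
  obtain ⟨t, ht⟩ := hZ.elim_nhds_subcover' (fun w hw => N ⟨w, hw⟩) fun w hw => hN ⟨w, hw⟩
  obtain ⟨hfin, heven⟩ := even_ncard_of_arcs (Z := {w | R.s w = 0}) (B := {w | R.s w = 0} ∩ bd)
    inter_subset_left (fun k : t => a k) (fun k => J k) (fun k => ha k) fun w hw => by
      obtain ⟨k, hk, hwk⟩ := mem_iUnion₂.1 (ht hw)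
      exact ⟨⟨k, hk⟩, hNa _ w hwk hw⟩
  have hset : {w | R.s w = 0} ∩ bd =
      {w | R.s w = 0} ∩ γ '' Icc 0 1 ∪ {w | R.s w = 0} ∩ γ' '' Icc 0 1 := by
    rw [← inter_union_distrib_left]; exact congrArg _ hu.symm
  rw [hset] at hfin heven
  have hf := hfin.subset subset_union_left
  have hf' := hfin.subset subset_union_right
  -- The total number of ends is even, so the numbers of zeros on the two curves have the same
  -- parity.
  rw [ncard_union_eq (hd.mono inter_subset_right inter_subset_right) hf hf', Nat.even_add,
    h.even_ncard_iff hf, h'.even_ncard_iff hf'] at heven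
  have h1 := h.abs_eta 0
  have hne : ∀ t, η t ≠ 0 := fun t e => by
    have := h.abs_eta t
    rw [e, abs_zero] at this; exact zero_ne_one this
  have hne' : ∀ t, η' t ≠ 0 := fun t e => by
    have := h'.abs_eta t
    rw [e, abs_zero] at this; exact zero_ne_one this
  rcases lt_or_gt_of_ne (mul_ne_zero (hne 0) (hne 1)) with h2 | h2
  · have h3 := lt_of_le_of_ne (not_lt.1 (heven.not.1 h2.not_gt)) (mul_ne_zero (hne' 0) (hne' 1))
    exact mul_pos_of_neg_of_neg h2 h3
  · exact mul_pos h2 (heven.1 h2)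

end RegularSection

/-! ### Existence of regular sections -/

def planeEquiv : EuclideanSpace ℝ (Fin 2) ≃L[ℝ] ℝ × ℝ :=
  (EuclideanSpace.equiv (Fin 2) ℝ).trans (ContinuousLinearEquiv.finTwoArrow ℝ ℝ)

theorem planeEquiv_symm_apply_zero (z : ℝ × ℝ) : planeEquiv.symm z 0 = z.1 :=
  congrArg Prod.fst (planeEquiv.apply_symm_apply z)

/-! ### Half plane charts of a surface with boundary -/

section Coordinates

variable {W : Type*} [TopologicalSpace W] [ChartedSpace (EuclideanHalfSpace 2) W]

def halfParam (c : W) (z : ℝ × ℝ) : W := (extChartAt (𝓡∂ 2) c).symm (planeEquiv.symm z)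

def halfCoord (c : W) (w : W) : ℝ × ℝ := planeEquiv (extChartAt (𝓡∂ 2) c w)

/-- The half plane part of a coordinate ball. It is convex, as the dimension estimate requires, and
for the inner radius of a bump function that function equals `1` on it. -/
def halfDomain (c : W) (r : ℝ) : Set (ℝ × ℝ) :=
  planeEquiv.symm ⁻¹' (Metric.ball (extChartAt (𝓡∂ 2) c c) r ∩ range (𝓡∂ 2))

theorem halfDomain_eq (c : W) (r : ℝ) : halfDomain c r =
    planeEquiv.symm ⁻¹' (Metric.ball (extChartAt (𝓡∂ 2) c c) r) ∩ Ici 0 ×ˢ univ := by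
  rw [halfDomain, range_modelWithCornersEuclideanHalfSpace, preimage_inter]
  congr 1
  ext z
  rw [mem_preimage, mem_ofPred_eq, planeEquiv_symm_apply_zero]
  simp

theorem convex_halfDomain (c : W) (r : ℝ) : Convex ℝ (halfDomain c r) := by
  rw [halfDomain_eq]
  refine Convex.inter ?_ ((convex_Ici 0).prod convex_univ)
  exact (convex_ball _ _).linear_preimage planeEquiv.symm.toLinearMap

theorem uniqueDiffOn_halfDomain (c : W) (r : ℝ) : UniqueDiffOn ℝ (halfDomain c r) := by
  rw [halfDomain, planeEquiv.symm.uniqueDiffOn_preimage_iff, inter_comm]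
  exact (𝓡∂ 2).uniqueDiffOn.inter Metric.isOpen_ball

variable {c : W} {r : ℝ}

theorem halfDomain_subset (b : SmoothBumpFunction (𝓡∂ 2) c) {z : ℝ × ℝ}
    (hz : z ∈ halfDomain c b.rIn) : planeEquiv.symm z ∈ (extChartAt (𝓡∂ 2) c).target :=
  b.ball_subset ⟨Metric.ball_subset_ball b.rIn_lt_rOut.le hz.1, hz.2⟩

theorem halfCoord_halfParam (b : SmoothBumpFunction (𝓡∂ 2) c) {z : ℝ × ℝ}
    (hz : z ∈ halfDomain c b.rIn) : halfCoord c (halfParam c z) = z := by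
  rw [halfCoord, halfParam, (extChartAt (𝓡∂ 2) c).right_inv (halfDomain_subset b hz),
    planeEquiv.apply_symm_apply]

theorem halfParam_halfCoord {w : W} (hw : w ∈ (chartAt (EuclideanHalfSpace 2) c).source) :
    halfParam c (halfCoord c w) = w := by
  rw [halfCoord, halfParam, planeEquiv.symm_apply_apply, (extChartAt (𝓡∂ 2) c).left_inv (by rwa [extChartAt_source])]

theorem halfParam_mem_source (b : SmoothBumpFunction (𝓡∂ 2) c) {z : ℝ × ℝ}
    (hz : z ∈ halfDomain c b.rIn) :
    halfParam c z ∈ (chartAt (EuclideanHalfSpace 2) c).source := by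
  rw [← extChartAt_source (𝓡∂ 2)]
  exact (extChartAt (𝓡∂ 2) c).map_target (halfDomain_subset b hz)

theorem bump_halfParam (b : SmoothBumpFunction (𝓡∂ 2) c) {z : ℝ × ℝ}
    (hz : z ∈ halfDomain c b.rIn) : b (halfParam c z) = 1 := by
  refine b.one_of_dist_le (halfParam_mem_source b hz) ?_
  rw [halfParam, (extChartAt (𝓡∂ 2) c).right_inv (halfDomain_subset b hz)]
  exact (Metric.mem_ball.1 hz.1).le

theorem halfChart [IsManifold (𝓡∂ 2) ∞ W] (b : SmoothBumpFunction (𝓡∂ 2) c) :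
    HalfChart ((𝓡∂ 2).boundary W) (halfDomain c b.rIn) (halfParam c) (halfCoord c) where
  nonneg z hz := by
    rw [halfDomain_eq] at hz
    exact hz.2.1
  nhds z hz := by
    rw [halfDomain_eq] at hz ⊢
    exact Filter.inter_mem (mem_nhdsWithin_of_mem_nhds
      ((Metric.isOpen_ball.preimage planeEquiv.symm.continuous).mem_nhds hz.1)) self_mem_nhdsWithin
  cont := (continuousOn_extChartAt_symm c).comp planeEquiv.symm.continuous.continuousOn
    fun z hz => halfDomain_subset b hz
  left_inv z hz := halfCoord_halfParam b hz
  cont_inv := by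
    refine planeEquiv.continuous.comp_continuousOn ((continuousOn_extChartAt c).mono ?_)
    rintro _ ⟨z, hz, rfl⟩
    rw [extChartAt_source]
    exact halfParam_mem_source b hz
  isOpen O hO hOD := by
    have : halfParam c '' (O ∩ Ici 0 ×ˢ univ) = (chartAt (EuclideanHalfSpace 2) c).source ∩
        extChartAt (𝓡∂ 2) c ⁻¹' (planeEquiv ⁻¹' O) := by
      ext w
      constructor
      · rintro ⟨z, hz, rfl⟩
        refine ⟨halfParam_mem_source b (hOD hz), ?_⟩
        have := halfCoord_halfParam b (hOD hz)
        rw [halfCoord] at this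
        rw [mem_preimage, mem_preimage, this]
        exact hz.1
      · rintro ⟨hw, hwO⟩
        refine ⟨halfCoord c w, ⟨hwO, ?_, mem_univ _⟩, halfParam_halfCoord hw⟩
        have h := (extChartAt (𝓡∂ 2) c).map_source (by rwa [extChartAt_source])
        have h' := extChartAt_target_subset_range c h
        rw [range_modelWithCornersEuclideanHalfSpace] at h'
        exact h'
    rw [this]
    exact isOpen_extChartAt_preimage c (hO.preimage planeEquiv.continuous)
  mem_bd z hz := by
    have hsrc := halfParam_mem_source b hz
    have hmem : halfParam c z ∈ (𝓡∂ 2).boundary W ↔ (𝓡∂ 2).IsBoundaryPoint (halfParam c z) :=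
      Iff.rfl
    -- Whether a point is interior can be tested in any chart of the atlas, here the one at `c`,
    -- where it means that the first coordinate is positive.
    rw [hmem, ← not_iff_not, ← ModelWithCorners.isInteriorPoint_iff_not_isBoundaryPoint,
      (𝓡∂ 2).isInteriorPoint_iff_of_mem_atlas (n := ∞) (by simp)
        (chart_mem_atlas (EuclideanHalfSpace 2) c) hsrc]
    have hval : (chartAt (EuclideanHalfSpace 2) c).extend (𝓡∂ 2) (halfParam c z) =
        planeEquiv.symm z := (extChartAt (𝓡∂ 2) c).right_inv (halfDomain_subset b hz)
    have hint : planeEquiv.symm z ∈ interior (range (𝓡∂ 2)) ↔ ¬ z.1 = 0 := by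
      rw [interior_range_modelWithCornersEuclideanHalfSpace]
      have h0 : 0 ≤ z.1 := by rw [halfDomain_eq] at hz; exact hz.2.1
      rw [mem_ofPred_eq, planeEquiv_symm_apply_zero, lt_iff_le_and_ne, and_iff_right h0, ne_comm]
    rw [← hint]
    constructor
    · intro h
      rw [hval] at h
      exact interior_mono (OpenPartialHomeomorph.extend_target_subset_range _) h
    · intro h
      refine OpenPartialHomeomorph.mem_interior_extend_target _ ?_ (hval.symm ▸ h :
        (chartAt (EuclideanHalfSpace 2) c).extend (𝓡∂ 2) (halfParam c z) ∈ interior (range (𝓡∂ 2)))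
      exact (chartAt (EuclideanHalfSpace 2) c).map_source hsrc

end Coordinates

/-- A family of frames of norm 1 for a real line bundle, near each point `c` of the base, compared
with a frame which is not assumed continuous. -/
structure SignCocycle (W : Type*) [TopologicalSpace W] where
  U : W → Set W
  σ : W → W → ℝ
  isOpen : ∀ c, IsOpen (U c)
  mem : ∀ c, c ∈ U c
  abs_eq : ∀ c w, |σ c w| = 1
  cont : ∀ c d, ContinuousOn (fun w => σ c w * σ d w) (U c ∩ U d)

theorem eventually_eq_of_abs_eq_one {X : Type*} [TopologicalSpace X] {f : X → ℝ} {x : X}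
    (hf : ContinuousAt f x) (h : ∀ y, |f y| = 1) : ∀ᶠ y in 𝓝 x, f y = f x := by
  filter_upwards [Metric.continuousAt_iff'.1 hf 1 one_pos] with y hy
  rw [Real.dist_eq] at hy
  rcases (abs_eq zero_le_one).1 (h y) with h1 | h1 <;>
    rcases (abs_eq zero_le_one).1 (h x) with h2 | h2 <;> rw [h1, h2] <;> rw [h1, h2] at hy <;>
    norm_num at hy

/-! ### Generic sections of the line bundle of a sign cocycle -/

namespace SignCocycle

variable {W : Type*} [TopologicalSpace W] [ChartedSpace (EuclideanHalfSpace 2) W]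
  [IsManifold (𝓡∂ 2) ∞ W] (S : SignCocycle W)

/-- The affine functions of the coordinates at `c`. -/
def affineCoord (c : W) (l : Fin 3) (w : W) : ℝ := ![1, (halfCoord c w).1, (halfCoord c w).2] l

theorem contMDiffAt_affineCoord {c w : W} (hw : w ∈ (chartAt (EuclideanHalfSpace 2) c).source)
    (l : Fin 3) : ContMDiffAt (𝓡∂ 2) 𝓘(ℝ, ℝ) ∞ (affineCoord c l) w := by
  have h : ContMDiffAt (𝓡∂ 2) 𝓘(ℝ, ℝ × ℝ) ∞ (halfCoord c) w :=
    planeEquiv.contDiff.contMDiff.contMDiffAt.comp w (contMDiffAt_extChartAt' hw)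
  fin_cases l
  · exact contMDiffAt_const
  · exact (contDiff_fst.contMDiff.contMDiffAt (n := ∞)).comp w h
  · exact (contDiff_snd.contMDiff.contMDiffAt (n := ∞)).comp w h

variable [T2Space W]

/-- An affine function in the frame at `d`, cut off by a bump function and extended by zero, is a
global section. In the frame at `c` it acquires the factor `σ c * σ d`, which is locally constant
near points of the support; near other points the section is zero. -/
theorem contMDiffAt_basis {c d : W} (b : SmoothBumpFunction (𝓡∂ 2) d) (hb : tsupport b ⊆ S.U d)
    (l : Fin 3) {w : W} (hw : w ∈ S.U c) :
    ContMDiffAt (𝓡∂ 2) 𝓘(ℝ, ℝ) ∞ (fun w => S.σ c w * S.σ d w * (b w * affineCoord d l w)) w := by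
  by_cases hs : w ∈ tsupport b
  · have hcont := (S.cont c d).continuousAt
      (((S.isOpen c).inter (S.isOpen d)).mem_nhds ⟨hw, hb hs⟩)
    have hev := eventually_eq_of_abs_eq_one hcont fun y => by
      rw [abs_mul, S.abs_eq, S.abs_eq, one_mul]
    have hsm : ContMDiffAt (𝓡∂ 2) 𝓘(ℝ, ℝ) ∞
        (fun w' => S.σ c w * S.σ d w * (b w' * affineCoord d l w')) w :=
      contMDiffAt_const.mul (b.contMDiffAt.mul
        (contMDiffAt_affineCoord (b.tsupport_subset_chartAt_source hs) l))
    refine hsm.congr_of_eventuallyEq ?_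
    filter_upwards [hev] with y hy
    rw [hy]
  · refine (contMDiffAt_const (c := (0 : ℝ))).congr_of_eventuallyEq ?_
    filter_upwards [(isClosed_tsupport b).isOpen_compl.mem_nhds hs] with y hy
    rw [image_eq_zero_of_notMem_tsupport hy, zero_mul, mul_zero]

/-- Compactness leaves finitely many charts. On the domain of chart `j` the bump function is `1`, so
the three basis sections with first index `j` have coordinates exactly `1, x, y`. This is the
hypothesis of `exists_generic`, which supplies the coefficients of a linear combination with regular
zeros. -/
theorem exists_regularSection [CompactSpace W] {κ : Type*} [Finite κ] [Nonempty κ] (p : κ → W) :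
    ∃ (J : Finset W) (R : RegularSection W ((𝓡∂ 2).boundary W) J),
      (∀ j, R.sgn j = S.σ j ∧ R.ψ j '' R.D j ⊆ S.U j) ∧ ∀ k, R.s (p k) ≠ 0 := by
  classical
  have hb : ∀ c, ∃ b : SmoothBumpFunction (𝓡∂ 2) c, tsupport b ⊆ S.U c := fun c => by
    obtain ⟨b, hb, -⟩ := (SmoothBumpFunction.nhds_basis_support (I := 𝓡∂ 2)
      ((S.isOpen c).mem_nhds (S.mem c))).mem_iff.1 Filter.univ_mem
    exact ⟨b, hb⟩
  choose b hb using hb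
  have hopen : ∀ c, halfParam c '' halfDomain c (b c).rIn ∈ 𝓝 c := fun c => by
    refine (halfChart (b c)).isOpen_image.mem_nhds ⟨halfCoord c c, ?_,
      halfParam_halfCoord (mem_chart_source _ c)⟩
    rw [halfDomain, mem_preimage, halfCoord, planeEquiv.symm_apply_apply]
    exact ⟨Metric.mem_ball_self (b c).rIn_pos,
      extChartAt_target_subset_range c (mem_extChartAt_target c)⟩
  obtain ⟨J, hJ⟩ := isCompact_univ.elim_nhds_subcover _ fun c _ => hopen c
  have hcover : ∀ w, ∃ j : J, w ∈ halfParam j.1 '' halfDomain j.1 (b j.1).rIn := fun w => by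
    obtain ⟨c, hc, hw⟩ := mem_iUnion₂.1 (hJ.2 (mem_univ w))
    exact ⟨⟨c, hc⟩, hw⟩
  have : Nonempty J := (hcover (p (Classical.arbitrary κ))).nonempty
  let D : J → Set (ℝ × ℝ) := fun j => halfDomain j.1 (b j.1).rIn
  have hDU : ∀ j : J, ∀ z ∈ D j, halfParam j.1 z ∈ S.U j.1 := fun j z hz => by
    refine hb j.1 (subset_tsupport _ ?_)
    rw [Function.mem_support, bump_halfParam _ hz]
    exact one_ne_zero
  let g : J × Fin 3 → W → ℝ := fun q w => b q.1.1 w * affineCoord q.1.1 q.2 w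
  let G : J → J × Fin 3 → ℝ × ℝ → ℝ := fun j q z =>
    S.σ j.1 (halfParam j.1 z) * S.σ q.1.1 (halfParam j.1 z) * g q (halfParam j.1 z)
  have hsq : ∀ c w, S.σ c w * S.σ c w = 1 := fun c w => by
    rw [← abs_mul_abs_self, S.abs_eq, mul_one]
  have hG : ∀ j q, ContDiffOn ℝ 2 (G j q) (D j) := by
    intro j q
    have h1 : ContMDiffOn (𝓡∂ 2) 𝓘(ℝ, ℝ) ∞
        (fun w => S.σ j.1 w * S.σ q.1.1 w * g q w) (S.U j.1) := fun w hw =>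
      (S.contMDiffAt_basis (b q.1.1) (hb q.1.1) q.2 hw).contMDiffWithinAt
    have h2 : ContMDiffOn 𝓘(ℝ, ℝ × ℝ) (𝓡∂ 2) ∞ (halfParam j.1) (D j) :=
      (contMDiffOn_extChartAt_symm j.1).comp planeEquiv.symm.contDiff.contMDiff.contMDiffOn
        fun z hz => halfDomain_subset (b j.1) hz
    exact (contMDiffOn_iff_contDiffOn.1 (h1.comp h2 fun z hz => hDU j z hz)).of_le
      (by exact_mod_cast ENat.LEInfty.out)
  have hGj : ∀ j : J, ∀ l, ∀ z ∈ D j, G j (j, l) z = ![1, z.1, z.2] l := by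
    intro j l z hz
    simp only [G, g, affineCoord]
    rw [hsq, one_mul, bump_halfParam _ hz, one_mul, halfCoord_halfParam _ hz]
  choose c hc using fun k => hcover (p k)
  choose z hz hzp using hc
  obtain ⟨t, ht, htp⟩ := exists_generic (fun j : J => convex_halfDomain j.1 _)
    (fun j : J => uniqueDiffOn_halfDomain j.1 _) hG (fun j => hGj j 0) (fun j => hGj j 1)
    (fun j => hGj j 2) c z hz
  have hF : ∀ j : J, ∀ z, ∑ q, t q * G j q z = S.σ j.1 (halfParam j.1 z) *
      ∑ q, t q * (S.σ q.1.1 (halfParam j.1 z) * g q (halfParam j.1 z)) := by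
    intro j z
    rw [Finset.mul_sum]
    refine Finset.sum_congr rfl fun q _ => ?_
    simp only [G]; ring
  refine ⟨J,
    { D := D
      ψ := fun j => halfParam j.1
      φ := fun j => halfCoord j.1
      chart := fun j => halfChart (b j.1)
      cover := hcover
      s := fun w => ∑ q, t q * (S.σ q.1.1 w * g q w)
      sgn := fun j => S.σ j.1
      abs_sgn := fun j w => S.abs_eq j.1 w
      F := fun j z => ∑ q, t q * G j q z
      dF := fun j z => ∑ q, t q • fderivWithin ℝ (G j q) (D j) z
      F_eq := fun j z _ => hF j z
      hasFDerivWithinAt := ?_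
      cont_dF := ?_
      regular := ?_ }, fun j => ⟨rfl, ?_⟩, fun k => ?_⟩
  · intro j z hz
    refine HasFDerivWithinAt.fun_sum fun q _ => ?_
    exact (((hG j q).differentiableOn (by norm_num)) z hz).hasFDerivWithinAt.const_mul (t q)
  · intro j
    refine continuousOn_finsetSum _ fun q _ => ContinuousOn.const_smul ?_ (t q)
    exact (hG j q).continuousOn_fderivWithin (uniqueDiffOn_halfDomain j.1 _) (by norm_num)
  · intro j z hz h0
    simpa using ht j z hz h0
  · rintro _ ⟨z, hz, rfl⟩
    exact hDU j z hz
  · intro h0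
    refine htp k ?_
    rw [hF, hzp k]
    exact mul_eq_zero_of_right _ h0

end SignCocycle

/-! ### Real line bundles over surfaces -/

theorem cov_add_one (t : ℝ) : cov (t + 1) = cov t := by
  rw [cov, cov, mul_add, mul_one, Circle.exp_add, Circle.exp_two_pi, mul_one]

theorem continuous_cov : Continuous cov := Circle.exp.continuous.comp (by fun_prop)

theorem cov_zero : cov 0 = 1 := by simp [cov]

theorem cov_one : cov 1 = 1 := by simpa [cov_zero] using cov_add_one 0

theorem cov_eq_cov {s t : ℝ} : cov s = cov t ↔ ∃ m : ℤ, s = t + m := by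
  have hpi := Real.pi_pos
  rw [cov, cov, Circle.exp_eq_exp]
  refine exists_congr fun m => ⟨fun h => ?_, fun h => by rw [h]; ring⟩
  have : 2 * Real.pi * (s - (t + m)) = 0 := by linear_combination h
  have := (mul_eq_zero.1 this).resolve_left (by positivity)
  linarith

theorem injOn_cov : InjOn cov (Ico 0 1) := by
  intro s hs t ht h
  obtain ⟨m, hm⟩ := cov_eq_cov.1 h
  have h1 : (m : ℝ) < 1 := by linarith [hs.2, ht.1]
  have h2 : (-1 : ℝ) < m := by linarith [hs.1, ht.2]
  have h3 : m < 1 := by exact_mod_cast h1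
  have h4 : -1 < m := by exact_mod_cast h2
  have : m = 0 := by omega
  rw [hm, this, Int.cast_zero, add_zero]

theorem exists_cov_eq (z : Circle) : ∃ t ∈ Ico (0 : ℝ) 1, cov t = z := by
  refine ⟨Int.fract (z.1.arg / (2 * Real.pi)), ⟨Int.fract_nonneg _, Int.fract_lt_one _⟩, ?_⟩
  have : cov (z.1.arg / (2 * Real.pi)) = z := by
    rw [cov, mul_div_cancel₀ _ (by positivity), Circle.exp_arg]
  conv_rhs => rw [← this]
  rw [cov_eq_cov]
  exact ⟨-⌊z.1.arg / (2 * Real.pi)⌋, by rw [Int.fract]; push_cast; ring⟩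

theorem image_cov : cov '' Icc 0 1 = univ := eq_univ_of_forall fun z => by
  obtain ⟨t, ht, h⟩ := exists_cov_eq z
  exact ⟨t, Ico_subset_Icc_self ht, h⟩

/-- The sign of a real number, with values in `ℝ ∖ {0}`. -/
def posSign (x : ℝ) : ℝ := if 0 < x then 1 else -1

theorem abs_posSign (x : ℝ) : |posSign x| = 1 := by
  unfold posSign; split_ifs <;> simp

theorem posSign_mul {x y : ℝ} (hx : x ≠ 0) (hy : y ≠ 0) :
    posSign (x * y) = posSign x * posSign y := by
  rcases lt_or_gt_of_ne hx with h | h <;> rcases lt_or_gt_of_ne hy with h' | h' <;>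
    simp [posSign, mul_pos_iff, h, h', h.not_gt, h'.not_gt]

theorem posSign_mul_self (x : ℝ) : posSign x * posSign x = 1 := by
  rw [← abs_mul_abs_self, abs_posSign, mul_one]

theorem posSign_pos {x : ℝ} : 0 < posSign x ↔ 0 < x := by
  unfold posSign; split_ifs with h <;> simp [h]

theorem continuousOn_posSign {X : Type*} [TopologicalSpace X] {f : X → ℝ} {s : Set X}
    (hf : ContinuousOn f s) (h0 : ∀ x ∈ s, f x ≠ 0) : ContinuousOn (fun x => posSign (f x)) s := by
  intro x hx
  rcases lt_or_gt_of_ne (h0 x hx) with h | h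
  · refine (continuousWithinAt_const (b := (-1 : ℝ))).congr_of_eventuallyEq ?_ (if_neg h.not_gt)
    filter_upwards [(hf x hx).eventually_lt_const h] with y hy
    exact if_neg hy.not_gt
  · refine (continuousWithinAt_const (b := (1 : ℝ))).congr_of_eventuallyEq ?_ (if_pos h)
    filter_upwards [(hf x hx).eventually_const_lt h] with y hy
    exact if_pos hy

/-! ### Signs and holonomy of a real line bundle -/

section LineBundle

variable {W : Type*} [TopologicalSpace W] {E : W → Type*} [TopologicalSpace (TotalSpace ℝ E)]
  [∀ x, AddCommGroup (E x)] [∀ x, TopologicalSpace (E x)] [FiberBundle ℝ E]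

variable (E) in
/-- The coordinate of a vector in the preferred trivialization at the point `c`. -/
def lineCoord (c w : W) (v : E w) : ℝ := (trivializationAt ℝ E c ⟨w, v⟩).2

variable (E) in
/-- The unit vector at `w` of the preferred trivialization at `w`. -/
def unitVec (w : W) : E w := (trivializationAt ℝ E w).symm w 1

theorem lineCoord_symm {c w : W} (hw : w ∈ (trivializationAt ℝ E c).baseSet) (x : ℝ) :
    lineCoord E c w ((trivializationAt ℝ E c).symm w x) = x := by
  rw [lineCoord, Trivialization.apply_mk_symm _ hw]

theorem symm_lineCoord {c w : W} (hw : w ∈ (trivializationAt ℝ E c).baseSet) (v : E w) :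
    (trivializationAt ℝ E c).symm w (lineCoord E c w v) = v :=
  Trivialization.symm_apply_apply_mk _ hw v

theorem lineCoord_unitVec (w : W) : lineCoord E w w (unitVec E w) = 1 :=
  lineCoord_symm (FiberBundle.mem_baseSet_trivializationAt' w) 1

variable [∀ x, Module ℝ (E x)] [VectorBundle ℝ ℝ E]

theorem lineCoord_smul {c w : W} (hw : w ∈ (trivializationAt ℝ E c).baseSet) (a : ℝ) (v : E w) :
    lineCoord E c w (a • v) = a * lineCoord E c w v :=
  ((trivializationAt ℝ E c).linear ℝ hw).map_smul a v

theorem lineCoord_ne_zero {c w : W} (hw : w ∈ (trivializationAt ℝ E c).baseSet) {v : E w}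
    (hv : v ≠ 0) : lineCoord E c w v ≠ 0 := fun h => hv <| by
  have h0 : lineCoord E c w 0 = 0 := by
    simpa using lineCoord_smul hw 0 (0 : E w)
  rw [← symm_lineCoord hw v, h, ← h0, symm_lineCoord hw]

variable (E) in
/-- The quotient of the coordinates in the preferred trivializations at `d` and at `c`. -/
def coordRatio (c d w : W) : ℝ :=
  Trivialization.coordChangeL ℝ (trivializationAt ℝ E c) (trivializationAt ℝ E d) w 1

theorem lineCoord_eq {c d w : W} (hc : w ∈ (trivializationAt ℝ E c).baseSet)
    (hd : w ∈ (trivializationAt ℝ E d).baseSet) (v : E w) :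
    lineCoord E d w v = coordRatio E c d w * lineCoord E c w v := by
  conv_lhs => rw [← symm_lineCoord hc v]
  rw [lineCoord, ← Trivialization.coordChangeL_apply (R := ℝ) _ _ ⟨hc, hd⟩, coordRatio, mul_comm,
    ← smul_eq_mul, ← map_smul, smul_eq_mul, mul_one]

theorem coordRatio_ne_zero {c d w : W} (hc : w ∈ (trivializationAt ℝ E c).baseSet)
    (hd : w ∈ (trivializationAt ℝ E d).baseSet) : coordRatio E c d w ≠ 0 := fun h => by
  have h1 := lineCoord_eq hd hc ((trivializationAt ℝ E c).symm w 1)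
  have h2 := lineCoord_eq hc hd ((trivializationAt ℝ E c).symm w 1)
  rw [lineCoord_symm hc] at h1 h2
  rw [h2, h, zero_mul, mul_zero] at h1
  exact one_ne_zero h1

theorem lineCoord_unitVec_eq {c w : W} (hc : w ∈ (trivializationAt ℝ E c).baseSet) :
    lineCoord E c w (unitVec E w) = coordRatio E w c w := by
  rw [lineCoord_eq (FiberBundle.mem_baseSet_trivializationAt' w) hc, lineCoord_unitVec, mul_one]

variable (E) in
/-- The signs of a real line bundle: its local frames compared with `unitVec`. -/
def lineSigns : SignCocycle W where
  U c := (trivializationAt ℝ E c).baseSet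
  σ c w := posSign (lineCoord E c w (unitVec E w))
  isOpen c := (trivializationAt ℝ E c).open_baseSet
  mem c := FiberBundle.mem_baseSet_trivializationAt' c
  abs_eq _ _ := abs_posSign _
  cont c d := by
    have hκ : ContinuousOn (coordRatio E c d)
        ((trivializationAt ℝ E c).baseSet ∩ (trivializationAt ℝ E d).baseSet) :=
      (continuousOn_coordChange ℝ _ _).clm_apply continuousOn_const
    refine (continuousOn_posSign hκ fun w hw => coordRatio_ne_zero hw.1 hw.2).congr fun w hw => ?_
    have h1 := coordRatio_ne_zero hw.1 hw.2
    have h2 : lineCoord E c w (unitVec E w) ≠ 0 := by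
      rw [lineCoord_unitVec_eq hw.1]
      exact coordRatio_ne_zero (FiberBundle.mem_baseSet_trivializationAt' w) hw.1
    simp only
    rw [lineCoord_eq hw.1 hw.2 (unitVec E w), posSign_mul h1 h2, mul_left_comm, posSign_mul_self,
      mul_one]

variable (E) in
/-- The orientation of a vector, compared with `unitVec`. -/
def orientSign (p : TotalSpace ℝ E) : ℝ := posSign (lineCoord E p.1 p.1 p.2)

theorem orientSign_mul_pos {p q : TotalSpace ℝ E} {a : ℝ} (hp : p.2 ≠ 0)
    (h : q = ⟨p.1, a • p.2⟩) (ha : a ≠ 0) : 0 < orientSign E p * orientSign E q ↔ 0 < a := by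
  have hm : p.1 ∈ (trivializationAt ℝ E p.1).baseSet :=
    FiberBundle.mem_baseSet_trivializationAt' p.1
  rw [h, orientSign, orientSign, lineCoord_smul hm, posSign_mul ha (lineCoord_ne_zero hm hp),
    mul_left_comm, posSign_mul_self, mul_one, posSign_pos]

/-- If the boundary of a compact surface with a real line bundle consists of two simple closed
curves, then the product of the holonomies of the line bundle along the two curves is positive. -/
theorem line_holonomy_mul_pos [ChartedSpace (EuclideanHalfSpace 2) W] [IsManifold (𝓡∂ 2) ∞ W]
    [T2Space W] [CompactSpace W] {γ : Bool → ℝ → W} (hγ : ∀ i, ContinuousOn (γ i) (Icc 0 1))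
    (hinj : ∀ i, InjOn (γ i) (Ico 0 1)) (hcl : ∀ i, γ i 1 = γ i 0)
    (hd : Disjoint (γ true '' Icc 0 1) (γ false '' Icc 0 1))
    (hu : γ true '' Icc 0 1 ∪ γ false '' Icc 0 1 = (𝓡∂ 2).boundary W)
    (e : ∀ i t, E (γ i t)) (a : Bool → ℝ)
    (he : ∀ i, ContinuousOn (fun t => (⟨γ i t, e i t⟩ : TotalSpace ℝ E)) (Icc 0 1))
    (he0 : ∀ i, ∀ t ∈ Icc (0 : ℝ) 1, e i t ≠ 0) (ha : ∀ i, a i ≠ 0)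
    (he1 : ∀ i, (⟨γ i 1, e i 1⟩ : TotalSpace ℝ E) = ⟨γ i 0, a i • e i 0⟩) :
    0 < a true * a false := by
  obtain ⟨J, R, hR, hp⟩ := (lineSigns E).exists_regularSection (fun i => γ i 0)
  have hloop : ∀ i, R.BoundaryLoop (γ i) fun t => orientSign E ⟨γ i t, e i t⟩ := fun i =>
    { cont := hγ i
      inj := hinj i
      closed := hcl i
      mem_bd := fun t ht => by
        rw [← hu]
        cases i
        · exact .inr ⟨t, ht, rfl⟩
        · exact .inl ⟨t, ht, rfl⟩
      abs_eta := fun t => abs_posSign _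
      ne_zero := hp i
      -- `unitVec` occurs in both factors and cancels: their product is the sign of the coordinate
      -- of `e` in the trivialization at `j`, which is continuous and nowhere zero.
      cont_eta := fun j => by
        have hU : ∀ t ∈ Icc 0 1 ∩ γ i ⁻¹' (R.ψ j '' R.D j),
            γ i t ∈ (trivializationAt ℝ E j.1).baseSet := fun t ht => (hR j).2 ht.2
        have hc : ContinuousOn (fun t => lineCoord E j.1 (γ i t) (e i t))
            (Icc 0 1 ∩ γ i ⁻¹' (R.ψ j '' R.D j)) := by
          refine continuous_snd.comp_continuousOn
            ((trivializationAt ℝ E j.1).continuousOn.comp ((he i).mono inter_subset_left) ?_)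
          intro t ht
          rw [Trivialization.mem_source]
          exact hU t ht
        refine (continuousOn_posSign hc fun t ht =>
          lineCoord_ne_zero (hU t ht) (he0 i t ht.1)).congr fun t ht => ?_
        rw [(hR j).1]
        simp only [lineSigns, orientSign]
        have hm := FiberBundle.mem_baseSet_trivializationAt' (F := ℝ) (E := E) (γ i t)
        rw [lineCoord_unitVec_eq (hU t ht), lineCoord_eq hm (hU t ht) (e i t),
          posSign_mul (coordRatio_ne_zero hm (hU t ht)) (lineCoord_ne_zero hm (he0 i t ht.1)),
          mul_comm] }
  have h := R.holonomy_mul_pos (hloop true) (hloop false) hd hu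
  have h1 : ∀ i, 0 < orientSign E ⟨γ i 0, e i 0⟩ * orientSign E ⟨γ i 1, e i 1⟩ ↔ 0 < a i :=
    fun i => orientSign_mul_pos (he0 i 0 (by simp)) (he1 i) (ha i)
  rcases lt_or_gt_of_ne (ha true) with ht | ht
  · have h2 : orientSign E ⟨γ true 0, e true 0⟩ * orientSign E ⟨γ true 1, e true 1⟩ ≤ 0 :=
      not_lt.1 ((h1 true).not.2 ht.not_gt)
    have h3 : a false < 0 := by
      refine lt_of_le_of_ne (not_lt.1 fun hf => ?_) (ha false)
      exact (mul_nonpos_of_nonpos_of_nonneg h2 ((h1 false).2 hf).le).not_gt h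
    exact mul_pos_of_neg_of_neg ht h3
  · exact mul_pos ht ((h1 false).1 (pos_of_mul_pos_right h ((h1 true).2 ht).le))

end LineBundle

/-- If real line bundles over two circles are cobordant, then their holonomies have the same
sign. -/
theorem Cobordant.mul_pos {L L' : Circle → Type} [TopologicalSpace (TotalSpace ℝ L)]
    [∀ x, AddCommGroup (L x)] [∀ x, Module ℝ (L x)] [∀ x, TopologicalSpace (L x)] [FiberBundle ℝ L]
    [VectorBundle ℝ ℝ L] [TopologicalSpace (TotalSpace ℝ L')] [∀ x, AddCommGroup (L' x)]
    [∀ x, Module ℝ (L' x)] [∀ x, TopologicalSpace (L' x)] [FiberBundle ℝ L']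
    [VectorBundle ℝ ℝ L'] (h : Cobordant 1 L L')
    {e : ∀ t, L (cov t)} {e' : ∀ t, L' (cov t)} {a a' : ℝ}
    (he : ContinuousOn (fun t => (⟨cov t, e t⟩ : TotalSpace ℝ L)) (Icc 0 1))
    (he' : ContinuousOn (fun t => (⟨cov t, e' t⟩ : TotalSpace ℝ L')) (Icc 0 1))
    (he0 : ∀ t ∈ Icc (0 : ℝ) 1, e t ≠ 0) (he0' : ∀ t ∈ Icc (0 : ℝ) 1, e' t ≠ 0)
    (ha : a ≠ 0) (ha' : a' ≠ 0)
    (he1 : (⟨cov 1, e 1⟩ : TotalSpace ℝ L) = ⟨cov 0, a • e 0⟩)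
    (he1' : (⟨cov 1, e' 1⟩ : TotalSpace ℝ L') = ⟨cov 0, a' • e' 0⟩) : 0 < a * a' := by
  obtain ⟨W, _, _, _, _, _, ι, ι', E, _, _, _, _, _, _, hι, hι', hd, hu, ⟨φ, hφ⟩, ⟨φ', hφ'⟩⟩ := h
  have himg : ∀ f : Circle → W, (fun t => f (cov t)) '' Icc 0 1 = range f := fun f => by
    rw [← image_image, image_cov, image_univ]
  have hcl : cov 1 = cov 0 := by rw [cov_one, cov_zero]
  refine line_holonomy_mul_pos (E := E) (W := W)
    (γ := fun i t => if i = true then ι (cov t) else ι' (cov t)) (fun i => ?_) (fun i => ?_)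
    (fun i => ?_) ?_ ?_
    (fun i t => match i with
      | true => φ (cov t) (e t)
      | false => φ' (cov t) (e' t)) (fun i => if i then a else a') (fun i => ?_) (fun i => ?_)
      (fun i => ?_) fun i => ?_
  · cases i
    · exact (hι'.isEmbedding.continuous.comp continuous_cov).continuousOn
    · exact (hι.isEmbedding.continuous.comp continuous_cov).continuousOn
  · cases i
    · exact hι'.isEmbedding.injective.injOn.comp injOn_cov (mapsTo_univ _ _)
    · exact hι.isEmbedding.injective.injOn.comp injOn_cov (mapsTo_univ _ _)
  · simp only [hcl]
  · simpa [himg] using hd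
  · simpa [himg] using hu
  · cases i
    · exact hφ'.comp_continuousOn he'
    · exact hφ.comp_continuousOn he
  · intro t ht
    cases i
    · exact (map_ne_zero_iff _ (φ' _).injective).2 (he0' t ht)
    · exact (map_ne_zero_iff _ (φ _).injective).2 (he0 t ht)
  · cases i
    · exact ha'
    · exact ha
  · cases i
    · have := congrArg (fun q : TotalSpace ℝ L' => (⟨ι' q.1, φ' q.1 q.2⟩ : TotalSpace ℝ E)) he1'
      simpa using this
    · have := congrArg (fun q : TotalSpace ℝ L => (⟨ι q.1, φ q.1 q.2⟩ : TotalSpace ℝ E)) he1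
      simpa using this

/-! ### Bundles obtained by clutching -/

/-! ### Coordinates in a bundle given by transition functions -/

section Core

variable {B F ι S : Type*} [TopologicalSpace B] [NormedAddCommGroup F] [NormedSpace ℝ F]
  [TopologicalSpace S] (Z : VectorBundleCore ℝ B F ι)

/-- The coordinate with respect to the local trivialization with index `i`. -/
def coord (i : ι) (x : B) (y : Z.Fiber x) : F := Z.coordChange (Z.indexAt x) i x y

/-- The vector with a given coordinate in the local trivialization with index `i`. -/
def vec (i : ι) (x : B) (y : F) : Z.Fiber x := Z.coordChange i (Z.indexAt x) x y

variable {Z}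

theorem coordChange_coord {i j : ι} {x : B} (hi : x ∈ Z.baseSet i) (hj : x ∈ Z.baseSet j)
    (y : Z.Fiber x) : Z.coordChange i j x (coord Z i x y) = coord Z j x y :=
  Z.coordChange_comp _ _ _ x ⟨⟨Z.mem_baseSet_at x, hi⟩, hj⟩ y

theorem coord_vec {i : ι} {x : B} (hi : x ∈ Z.baseSet i) (y : F) : coord Z i x (vec Z i x y) = y :=
  (Z.coordChange_comp _ _ _ x ⟨⟨hi, Z.mem_baseSet_at x⟩, hi⟩ y).trans (Z.coordChange_self i x hi y)

theorem vec_coord {i : ι} {x : B} (hi : x ∈ Z.baseSet i) (y : Z.Fiber x) :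
    vec Z i x (coord Z i x y) = y :=
  (Z.coordChange_comp _ _ _ x ⟨⟨Z.mem_baseSet_at x, hi⟩, Z.mem_baseSet_at x⟩ y).trans
    (Z.coordChange_self _ x (Z.mem_baseSet_at x) y)

theorem coord_smul (i : ι) (x : B) (a : ℝ) (y : Z.Fiber x) :
    coord Z i x (a • y) = a • coord Z i x y :=
  (Z.coordChange (Z.indexAt x) i x).map_smul a y

theorem coord_add (i : ι) (x : B) (y y' : Z.Fiber x) :
    coord Z i x (y + y') = coord Z i x y + coord Z i x y' :=
  (Z.coordChange (Z.indexAt x) i x).map_add y y'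

theorem coord_injective {i : ι} {x : B} (hi : x ∈ Z.baseSet i) :
    Function.Injective (coord Z i x) :=
  Function.LeftInverse.injective fun y => vec_coord hi y

theorem coord_zero (i : ι) (x : B) : coord Z i x 0 = 0 :=
  (Z.coordChange (Z.indexAt x) i x).map_zero

theorem coord_ne_zero {i : ι} {x : B} (hi : x ∈ Z.baseSet i) {y : Z.Fiber x} (hy : y ≠ 0) :
    coord Z i x y ≠ 0 := fun h => hy (coord_injective hi (h.trans (coord_zero i x).symm))

theorem ne_zero_of_coord {i : ι} {x : B} {y : Z.Fiber x} (hy : coord Z i x y ≠ 0) : y ≠ 0 :=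
  fun h => hy (by rw [h, coord_zero])

theorem continuousWithinAt_core {q : S → TotalSpace F Z.Fiber} {A : Set S} {s : S} {i : ι}
    (h : (q s).1 ∈ Z.baseSet i) : ContinuousWithinAt q A s ↔
      ContinuousWithinAt (fun s => (q s).1) A s ∧
        ContinuousWithinAt (fun s => coord Z i (q s).1 (q s).2) A s :=
  (Z.localTriv i).tendsto_nhds_iff h

theorem continuousOn_core {γ : S → B} {e : ∀ s, Z.Fiber (γ s)} {A : Set S} {i : ι}
    (hγ : ContinuousOn γ A) (h : ∀ s ∈ A, γ s ∈ Z.baseSet i) :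
    ContinuousOn (fun s => (⟨γ s, e s⟩ : TotalSpace F Z.Fiber)) A ↔
      ContinuousOn (fun s => coord Z i (γ s) (e s)) A :=
  ⟨fun he s hs => ((continuousWithinAt_core (q := fun s => ⟨γ s, e s⟩) (h s hs)).1 (he s hs)).2,
    fun he s hs => (continuousWithinAt_core (q := fun s => ⟨γ s, e s⟩) (h s hs)).2
      ⟨hγ s hs, he s hs⟩⟩

end Core

theorem coe_cov (t : ℝ) :
    (cov t : ℂ) = Real.cos (2 * Real.pi * t) + Real.sin (2 * Real.pi * t) * Complex.I := by
  rw [cov, Circle.coe_exp, Complex.exp_mul_I, Complex.ofReal_cos, Complex.ofReal_sin]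

theorem cov_half : cov (1 / 2) = -1 := by
  apply Circle.ext
  rw [coe_cov, show 2 * Real.pi * (1 / 2) = Real.pi by ring]
  simp

theorem im_cov (t : ℝ) : (cov t : ℂ).im = Real.sin (2 * Real.pi * t) := by
  rw [cov, Circle.coe_exp, Complex.exp_ofReal_mul_I_im]

theorem im_cov_nonneg {t : ℝ} (ht : t ∈ Icc (0 : ℝ) (1 / 2)) : 0 ≤ (cov t : ℂ).im := by
  rw [im_cov]
  exact Real.sin_nonneg_of_nonneg_of_le_pi (by have := ht.1; positivity)
    (by nlinarith [Real.pi_pos, ht.2])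

theorem im_cov_nonpos {t : ℝ} (ht : t ∈ Icc (1 / 2 : ℝ) 1) : (cov t : ℂ).im ≤ 0 := by
  rw [im_cov, ← Real.sin_sub_two_pi]
  exact Real.sin_nonpos_of_nonpos_of_neg_pi_le (by nlinarith [Real.pi_pos, ht.2])
    (by nlinarith [Real.pi_pos, ht.1])

section Clutch

variable {X : Type*} [TopologicalSpace X] {F : Type*} [NormedField F] [NormedAlgebra ℝ F]
  {c : C(X, Circle)} {u v : C(X, F)} {hu : ∀ x, u x ≠ 0} {hv : ∀ x, v x ≠ 0} {x : X}

theorem mem_baseSet_true (h : 0 ≤ (c x : ℂ).im) : x ∈ (clutch F c u v hu hv).baseSet true := by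
  simp only [clutch, if_true, mem_ofPred_eq]
  intro e
  rw [e] at h
  norm_num at h

theorem mem_baseSet_false (h : (c x : ℂ).im ≤ 0) :
    x ∈ (clutch F c u v hu hv).baseSet false := by
  simp only [clutch, Bool.false_eq_true, if_false, mem_ofPred_eq]
  intro e
  rw [e] at h
  norm_num at h

theorem coordChange_true_false_of_pos (h : 0 < (c x : ℂ).re) (y : F) :
    (clutch F c u v hu hv).coordChange true false x y = u x * y := by
  simp [clutch, h]

theorem coordChange_true_false_of_neg (h : (c x : ℂ).re < 0) (y : F) :
    (clutch F c u v hu hv).coordChange true false x y = v x * y := by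
  simp [clutch, h.not_gt]

theorem coord_false_of_one (h : c x = 1) (y : (clutch F c u v hu hv).Fiber x) :
    coord (clutch F c u v hu hv) false x y = u x * coord (clutch F c u v hu hv) true x y := by
  have h0 : (c x : ℂ) = 1 := by rw [h, Circle.coe_one]
  rw [← coordChange_true_false_of_pos (c := c) (hu := hu) (hv := hv) (by simp [h0]),
    coordChange_coord (mem_baseSet_true (by simp [h0])) (mem_baseSet_false (by simp [h0]))]

theorem coord_false_of_neg_one (h : c x = -1) (y : (clutch F c u v hu hv).Fiber x) :
    coord (clutch F c u v hu hv) false x y = v x * coord (clutch F c u v hu hv) true x y := by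
  have h0 : (c x : ℂ) = -1 := by rw [h, Circle.coe_neg, Circle.coe_one]
  rw [← coordChange_true_false_of_neg (c := c) (hu := hu) (hv := hv) (by simp [h0]),
    coordChange_coord (mem_baseSet_true (by simp [h0])) (mem_baseSet_false (by simp [h0]))]

end Clutch

/-! ### Holonomy and `w₁` of line bundles over the circle -/

section Circle

variable {u v : ℝ} {hu : ∀ x, ContinuousMap.const Circle u x ≠ 0}
  {hv : ∀ x, ContinuousMap.const Circle v x ≠ 0}

variable (u v hu hv) in
/-- The real line bundle over the circle with transition functions `u` at `1` and `v` at `-1`. -/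
abbrev circleClutch : VectorBundleCore ℝ Circle ℝ Bool :=
  clutch ℝ (ContinuousMap.id Circle) (ContinuousMap.const _ u) (ContinuousMap.const _ v) hu hv

theorem circleClutch_coord_neg_one (y : (circleClutch u v hu hv).Fiber (cov (1 / 2))) :
    coord (circleClutch u v hu hv) false (cov (1 / 2)) y =
      v * coord (circleClutch u v hu hv) true (cov (1 / 2)) y :=
  coord_false_of_neg_one (c := .id _) cov_half y

theorem circleClutch_coord_one (y : (circleClutch u v hu hv).Fiber (cov 0)) :
    coord (circleClutch u v hu hv) false (cov 0) y =
      u * coord (circleClutch u v hu hv) true (cov 0) y :=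
  coord_false_of_one (c := .id _) cov_zero y

/-- A nowhere zero section of the real line bundle `L` along the loop `cov`, with holonomy `a`. -/
structure LoopSection (L : Circle → Type*) [TopologicalSpace (TotalSpace ℝ L)]
    [∀ x, AddCommGroup (L x)] [∀ x, Module ℝ (L x)] (e : ∀ t, L (cov t)) (a : ℝ) : Prop where
  cont : ContinuousOn (fun t => (⟨cov t, e t⟩ : TotalSpace ℝ L)) (Icc 0 1)
  ne_zero : ∀ t ∈ Icc (0 : ℝ) 1, e t ≠ 0
  hol : (⟨cov 1, e 1⟩ : TotalSpace ℝ L) = ⟨cov 0, a • e 0⟩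

/-- The `true` coordinate keeps its sign on the upper half circle, the `false` coordinate on the
lower one. They are related by `v` at `-1` and by `u` at `1`, and the closing condition contributes
`a`. -/
theorem LoopSection.mul_pos {e : ∀ t, (circleClutch u v hu hv).Fiber (cov t)} {a : ℝ}
    (h : LoopSection (circleClutch u v hu hv).Fiber e a) : 0 < u * v * a := by
  let Z := circleClutch u v hu hv
  have hT : ∀ t ∈ Icc (0 : ℝ) (1 / 2), cov t ∈ Z.baseSet true := fun t ht =>
    mem_baseSet_true (im_cov_nonneg ht)
  have hF : ∀ t ∈ Icc (1 / 2 : ℝ) 1, cov t ∈ Z.baseSet false := fun t ht =>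
    mem_baseSet_false (im_cov_nonpos ht)
  have s1 : Icc (0 : ℝ) (1 / 2) ⊆ Icc 0 1 := Icc_subset_Icc_right (by norm_num)
  have s2 : Icc (1 / 2 : ℝ) 1 ⊆ Icc 0 1 := Icc_subset_Icc_left (by norm_num)
  have h1 := mul_pos_of_ne_zero_on_Icc (by norm_num)
    ((continuousOn_core continuous_cov.continuousOn hT).1 (h.cont.mono s1))
    fun t ht => coord_ne_zero (hT t ht) (h.ne_zero t (s1 ht))
  have h2 := mul_pos_of_ne_zero_on_Icc (by norm_num)
    ((continuousOn_core continuous_cov.continuousOn hF).1 (h.cont.mono s2))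
    fun t ht => coord_ne_zero (hF t ht) (h.ne_zero t (s2 ht))
  have e1 := circleClutch_coord_neg_one (e (1 / 2))
  have e2 : coord Z false (cov 1) (e 1) = u * (a * coord Z true (cov 0) (e 0)) := by
    refine (congrArg (fun q : TotalSpace ℝ Z.Fiber => coord Z false q.1 q.2) h.hol).trans ?_
    exact (circleClutch_coord_one _).trans (congrArg (u * ·) (coord_smul _ _ _ _))
  have h3 : coord Z false (cov (1 / 2)) (e (1 / 2)) * coord Z false (cov 1) (e 1) =
      (u * v * a) * (coord Z true (cov 0) (e 0) * coord Z true (cov (1 / 2)) (e (1 / 2))) := by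
    rw [e2]
    refine (congrArg (· * _) e1).trans ?_
    ring
  rw [h3] at h2
  exact pos_of_mul_pos_left h2 h1.le

variable (u v hu hv) in
theorem exists_loopSection :
    ∃ e, LoopSection (circleClutch u v hu hv).Fiber e (u⁻¹ * v) := by
  set Z := circleClutch u v hu hv
  have hu0 : u ≠ 0 := hu 1
  have hv0 : v ≠ 0 := hv 1
  have hT : ∀ t ∈ Icc (0 : ℝ) (1 / 2), cov t ∈ Z.baseSet true := fun t ht =>
    mem_baseSet_true (im_cov_nonneg ht)
  have hF : ∀ t ∈ Icc (1 / 2 : ℝ) 1, cov t ∈ Z.baseSet false := fun t ht =>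
    mem_baseSet_false (im_cov_nonpos ht)
  -- The value `v` on the lower half is forced: it is the `false` coordinate, at `-1`, of the vector
  -- whose `true` coordinate is `1`.
  set e : ∀ t, Z.Fiber (cov t) := fun t =>
    if t ≤ 1 / 2 then vec Z true (cov t) 1 else vec Z false (cov t) v
  have eT : ∀ t ∈ Icc (0 : ℝ) (1 / 2), coord Z true (cov t) (e t) = 1 := fun t ht => by
    simp only [e, if_pos ht.2]
    exact coord_vec (hT t ht) 1
  have eF : ∀ t ∈ Icc (1 / 2 : ℝ) 1, coord Z false (cov t) (e t) = v := fun t ht => by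
    rcases ht.1.eq_or_lt with rfl | h
    · exact (circleClutch_coord_neg_one _).trans (by rw [eT _ (by norm_num), mul_one])
    · simp only [e, if_neg h.not_ge]
      exact coord_vec (hF t ht) v
  refine ⟨e, ?_, fun t ht => ?_, ?_⟩
  · rw [← Icc_union_Icc_eq_Icc (show (0 : ℝ) ≤ 1 / 2 by norm_num) (by norm_num)]
    exact ContinuousOn.union_of_isClosed
      ((continuousOn_core continuous_cov.continuousOn hT).2 (continuousOn_const.congr eT))
      ((continuousOn_core continuous_cov.continuousOn hF).2 (continuousOn_const.congr eF))
      isClosed_Icc isClosed_Icc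
  · rcases le_total t (1 / 2) with h | h
    · exact ne_zero_of_coord (i := true) (by rw [eT t ⟨ht.1, h⟩]; exact one_ne_zero)
    · exact ne_zero_of_coord (i := false) (by rw [eF t ⟨h, ht.2⟩]; exact hv0)
  · have h1 := eF 1 (by norm_num)
    have hc : cov 1 = cov 0 := by rw [cov_one, cov_zero]
    -- The fibres over `cov 1` and `cov 0` are different types until the equality of the base points
    -- is substituted, so `e 1` is generalized to an arbitrary vector beforehand.
    revert h1
    generalize e 1 = w
    revert w
    rw [hc]
    intro w h1
    congr 1
    refine coord_injective (Z := Z) (hT 0 (by norm_num)) (mul_left_cancel₀ hu0 ?_)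
    have h2 := circleClutch_coord_one w
    rw [coord_smul, eT 0 (by norm_num), smul_eq_mul, mul_one, mul_inv_cancel_left₀ hu0, ← h1]
    exact h2.symm

theorem w₁_circleClutch : w₁ (circleClutch u v hu hv).Fiber = if u * v < 0 then 1 else 0 := by
  have hu0 : u ≠ 0 := hu 1
  classical
  unfold w₁
  refine if_congr ⟨?_, fun h => ?_⟩ rfl rfl
  · rintro ⟨e, a, h1, h2, h3, h4⟩
    have h := LoopSection.mul_pos (a := a) ⟨h1, h2, h4⟩
    nlinarith
  · obtain ⟨e, he⟩ := exists_loopSection u v hu hv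
    refine ⟨e, _, he.cont, he.ne_zero, ?_, he.hol⟩
    have := he.mul_pos
    nlinarith

end Circle

/-! ### The cylinder -/

/-! ### Transport of a manifold structure to another model space -/

section ChangeModel

variable {E E' H H' : Type*} [NormedAddCommGroup E] [NormedSpace ℝ E] [NormedAddCommGroup E']
  [NormedSpace ℝ E'] [TopologicalSpace H] [TopologicalSpace H'] (Φ : H ≃ₜ H') (W : Type*)
  [TopologicalSpace W] [ChartedSpace H W]

/-- The charted space obtained by composing the charts with a homeomorphism of the model spaces. -/
@[reducible] def changeModel : ChartedSpace H' W where
  atlas := (fun e => e.transHomeomorph Φ) '' atlas H W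
  chartAt x := (chartAt H x).transHomeomorph Φ
  mem_chart_source x := mem_chart_source H x
  chart_mem_atlas x := ⟨_, chart_mem_atlas H x, rfl⟩

variable {Φ W} {I : ModelWithCorners ℝ E H} {I' : ModelWithCorners ℝ E' H'} (L : E ≃L[ℝ] E')
  (hΦ : ∀ h, I' (Φ h) = L (I h))

-- In the new model the transition maps are conjugated by the linear isomorphism `L`, so they remain
-- smooth. This turns the product structure of the cylinder, modelled on a line times a half line,
-- into one modelled on `EuclideanHalfSpace 2`.
include hΦ in
theorem isManifold_changeModel [IsManifold I ∞ W] :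
    @IsManifold ℝ _ E' _ _ H' _ I' ∞ W _ (changeModel Φ W) := by
  let _ := changeModel Φ W
  refine isManifold_of_contDiffOn I' ∞ W ?_
  rintro _ _ ⟨e, he, rfl⟩ ⟨e', he', rfl⟩
  have h := (contDiffGroupoid ∞ I).compatible he he'
  rw [contDiffGroupoid, mem_groupoid_of_pregroupoid] at h
  have h1 : ContDiffOn ℝ ∞ (I ∘ (e.symm ≫ₕ e') ∘ I.symm)
    (I.symm ⁻¹' (e.symm ≫ₕ e').source ∩ range I) := h.1
  have hs : ∀ y ∈ range I', L.symm y ∈ range I ∧ Φ.symm (I'.symm y) = I.symm (L.symm y) := by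
    rintro _ ⟨k, rfl⟩
    have : L.symm (I' k) = I (Φ.symm k) := by
      rw [← Φ.apply_symm_apply k, hΦ, L.symm_apply_apply, Φ.symm_apply_apply]
    rw [this, I'.left_inv, I.left_inv]
    exact ⟨mem_range_self _, rfl⟩
  have h2 := L.contDiff.comp_contDiffOn (h1.comp L.symm.contDiff.contDiffOn
    (s := I'.symm ⁻¹' ((e.transHomeomorph Φ).symm ≫ₕ e'.transHomeomorph Φ).source ∩ range I')
    fun y hy => by
      refine ⟨?_, (hs y hy.2).1⟩
      have := hy.1
      simp only [mfld_simps] at this ⊢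
      simpa [(hs y hy.2).2] using this)
  refine h2.congr fun y hy => ?_
  change I' (Φ (e' (e.symm (Φ.symm (I'.symm y))))) = L (I (e' (e.symm (I.symm (L.symm y)))))
  rw [hΦ, (hs y hy.2).2]

include hΦ in
theorem boundary_changeModel :
    @ModelWithCorners.boundary ℝ _ E' _ _ H' _ I' W _ (changeModel Φ W) = I.boundary W := by
  let _ := changeModel Φ W
  have hr : range I' = L '' range I := by
    rw [← range_comp, ← Φ.surjective.range_comp]
    exact congrArg range (funext hΦ)
  ext x
  change I'.IsBoundaryPoint x ↔ I.IsBoundaryPoint x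
  rw [ModelWithCorners.isBoundaryPoint_iff, ModelWithCorners.isBoundaryPoint_iff, hr]
  have : extChartAt I' x x = L (extChartAt I x x) := hΦ _
  rw [this]
  have h := L.toHomeomorph.image_frontier (range I)
  have h2 : frontier (L '' range I) = L '' frontier (range I) := h.symm
  rw [h2, L.injective.mem_set_image]

end ChangeModel

/-- The coordinates of the half plane as a product of a line and a half line. -/
def halfPlaneEquiv : (EuclideanSpace ℝ (Fin 1) × EuclideanSpace ℝ (Fin 1)) ≃L[ℝ]
    EuclideanSpace ℝ (Fin 2) :=
  LinearEquiv.toContinuousLinearEquiv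
    -- The half line comes first, because `EuclideanHalfSpace 2` constrains the coordinate with
    -- index `0`.
    { toFun := fun p => !₂[p.2 0, p.1 0]
      invFun := fun x => (!₂[x 1], !₂[x 0])
      map_add' := fun p q => by ext i; fin_cases i <;> simp
      map_smul' := fun a p => by ext i; fin_cases i <;> simp
      left_inv := fun p => by
        ext i <;> fin_cases i <;> simp
      right_inv := fun x => by ext i; fin_cases i <;> simp }

/-- The half plane as a product of a line and a half line. -/
def halfPlaneHomeomorph :
    ModelProd (EuclideanSpace ℝ (Fin 1)) (EuclideanHalfSpace 1) ≃ₜ EuclideanHalfSpace 2 where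
  toFun p := ⟨halfPlaneEquiv (p.1, p.2.1), p.2.2⟩
  invFun x := ((halfPlaneEquiv.symm x.1).1, ⟨(halfPlaneEquiv.symm x.1).2, x.2⟩)
  left_inv p := by
    have h := halfPlaneEquiv.symm_apply_apply (p.1, p.2.1)
    exact Prod.ext (congrArg Prod.fst h :) (Subtype.ext (congrArg Prod.snd h :))
  right_inv x := Subtype.ext (halfPlaneEquiv.apply_symm_apply x.1)
  continuous_toFun := by
    refine Continuous.subtype_mk (halfPlaneEquiv.continuous.comp ?_) _
    exact continuous_fst.prodMk (continuous_subtype_val.comp continuous_snd)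
  continuous_invFun := by
    have h := halfPlaneEquiv.symm.continuous.comp
      (continuous_subtype_val (p := fun x : EuclideanSpace ℝ (Fin 2) => 0 ≤ x 0))
    exact (continuous_fst.comp h).prodMk ((continuous_snd.comp h).subtype_mk _)

/-- The cylinder over the circle. -/
abbrev Cylinder : Type := Circle × Icc (0 : ℝ) 1

/-- The charts of the cylinder with values in the half plane. -/
instance cylinderCharts : ChartedSpace (EuclideanHalfSpace 2) Cylinder :=
  changeModel halfPlaneHomeomorph Cylinder

theorem halfPlane_compat (h : ModelProd (EuclideanSpace ℝ (Fin 1)) (EuclideanHalfSpace 1)) :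
    (𝓡∂ 2) (halfPlaneHomeomorph h) = halfPlaneEquiv (((𝓡 1).prod (𝓡∂ 1)) h) := rfl

instance isManifold_cylinder : IsManifold (𝓡∂ 2) ∞ Cylinder :=
  isManifold_changeModel (I := (𝓡 1).prod (𝓡∂ 1)) halfPlaneEquiv halfPlane_compat

theorem boundary_cylinder :
    (𝓡∂ 2).boundary Cylinder =
      range (fun z : Circle => ((z, ⊥) : Cylinder)) ∪ range fun z : Circle => (z, ⊤) := by
  refine (boundary_changeModel (I := (𝓡 1).prod (𝓡∂ 1)) halfPlaneEquiv halfPlane_compat).trans ?_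
  rw [ModelWithCorners.boundary_of_boundaryless_left, boundary_Icc]
  ext ⟨z, t⟩
  simp [Set.prod, eq_comm]

/-- In product charts the inclusion reads `u ↦ (u, 0)`, the normal form of an immersion, as soon as
`b` is the origin of its own chart. Both end points of the interval have this property. -/
theorem isSmoothEmbedding_cylinder {b : Icc (0 : ℝ) 1}
    (hb : extChartAt (𝓡∂ 1) b b = 0) :
    IsSmoothEmbedding (𝓡 1) (𝓡∂ 2) ∞ fun z : Circle => ((z, b) : Cylinder) := by
  refine ⟨IsImmersionOfComplement.isImmersion (F := EuclideanSpace ℝ (Fin 1)) fun x => ?_, ?_⟩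
  · refine IsImmersionAtOfComplement.mk_of_charts halfPlaneEquiv (chartAt _ x)
      (chartAt (EuclideanHalfSpace 2) ((x, b) : Cylinder)) (mem_chart_source _ x)
      (mem_chart_source _ _) (IsManifold.chart_mem_maximalAtlas x)
      (IsManifold.chart_mem_maximalAtlas _) (fun z hz => ?_) fun u hu => ?_
    · exact ⟨hz, mem_chart_source (EuclideanHalfSpace 1) b⟩
    · change halfPlaneEquiv (extChartAt (𝓡 1) x ((extChartAt (𝓡 1) x).symm u),
        extChartAt (𝓡∂ 1) b b) = halfPlaneEquiv (u, 0)
      rw [hb, (extChartAt (𝓡 1) x).right_inv hu]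
  · exact isEmbedding_prodMkLeft b

/-- The isomorphism is multiplication by `κ` in the `false` trivialization and the identity in the
`true` one; it carries the transition constants `u', v'` to `κ * u', κ * v'`. -/
theorem isRestriction_clutch {X Y : Type*} [TopologicalSpace X] [TopologicalSpace Y] (f : C(Y, X))
    {c : C(X, Circle)} {c' : C(Y, Circle)} (hc : ∀ y, c (f y) = c' y) {u v u' v' κ : ℝ}
    {hu : ∀ x, ContinuousMap.const X u x ≠ 0} {hv : ∀ x, ContinuousMap.const X v x ≠ 0}
    {hu' : ∀ x, ContinuousMap.const Y u' x ≠ 0} {hv' : ∀ x, ContinuousMap.const Y v' x ≠ 0}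
    (hκ : κ ≠ 0) (hκu : u = κ * u') (hκv : v = κ * v') :
    IsRestriction f (clutch ℝ c' (.const Y u') (.const Y v') hu' hv').Fiber
      (clutch ℝ c (.const X u) (.const X v) hu hv).Fiber := by
  set Z := clutch ℝ c (.const X u) (.const X v) hu hv
  set Z' := clutch ℝ c' (.const Y u') (.const Y v') hu' hv'
  have hi : ∀ y, Z.indexAt (f y) = Z'.indexAt y := fun y => by simp [Z, Z', clutch, hc]
  have hb : ∀ i y, y ∈ Z'.baseSet i → f y ∈ Z.baseSet i := fun i y h => by
    cases i
    · have h' : (c' y : ℂ) ≠ Complex.I := h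
      rwa [← hc] at h'
    · have h' : (c' y : ℂ) ≠ -Complex.I := h
      rwa [← hc] at h'
  have hk : ∀ i : Bool, (if i then 1 else κ) ≠ 0 := fun i => by cases i <;> simp [hκ]
  refine ⟨fun y => LinearEquiv.smulOfNeZero ℝ ℝ (if Z'.indexAt y then 1 else κ) (hk _), ?_⟩
  have key : ∀ (i j : Bool) y (w : ℝ), Z.coordChange j i (f y) ((if j then 1 else κ) * w) =
      (if i then 1 else κ) * Z'.coordChange j i y w := by
    intro i j y w
    cases i <;> cases j <;> simp [Z, Z', clutch, hc, hκu, hκv]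
    · split_ifs <;> ring
    · split_ifs <;> field_simp
  have key' : ∀ i y (w : Z'.Fiber y), coord Z i (f y)
      (LinearEquiv.smulOfNeZero ℝ ℝ (if Z'.indexAt y then 1 else κ) (hk _) w) =
      (if i then 1 else κ) * coord Z' i y w := by
    intro i y w
    unfold coord
    rw [hi]
    exact key _ _ _ _
  rw [continuous_iff_continuousAt]
  intro q
  rw [← continuousWithinAt_univ]
  have hq : q.1 ∈ Z'.baseSet (Z'.indexAt q.1) := Z'.mem_baseSet_at q.1
  refine (continuousWithinAt_core (Z := Z) (i := Z'.indexAt q.1) (hb _ _ hq)).2 ⟨?_, ?_⟩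
  · exact (f.continuous.comp Z'.continuous_proj).continuousWithinAt
  · have h := ((continuousWithinAt_core (Z := Z') (q := id) (A := univ) (s := q) hq).1
      continuousWithinAt_id).2
    refine (h.const_mul (if Z'.indexAt q.1 then 1 else κ)).congr (fun q' _ => key' _ _ _)
      (key' _ _ _)

/-- Clutching functions which differ by a constant factor give cobordant line bundles. -/
theorem cobordant_circleClutch {u v u' v' κ : ℝ} {hu hv hu' hv'} (hκ : κ ≠ 0) (hκu : u = κ * u')
    (hκv : v = κ * v') :
    Cobordant 1 (circleClutch u v hu hv).Fiber (circleClutch u' v' hu' hv').Fiber := by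
  have hu0 : u ≠ 0 := hu 1
  have hv0 : v ≠ 0 := hv 1
  let Z : VectorBundleCore ℝ Cylinder ℝ Bool :=
    clutch ℝ ⟨Prod.fst, continuous_fst⟩ (.const _ u) (.const _ v) (fun _ => hu0) fun _ => hv0
  refine ⟨Cylinder, inferInstance, inferInstance, inferInstance, cylinderCharts,
    isManifold_cylinder, fun z => (z, ⊥), fun z => (z, ⊤), Z.Fiber, inferInstance, inferInstance,
    inferInstance, inferInstance, inferInstance, inferInstance,
    isSmoothEmbedding_cylinder (b := ⊥) ?_, isSmoothEmbedding_cylinder (b := ⊤) ?_, ?_, boundary_cylinder.symm,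
    isRestriction_clutch ⟨fun z => (z, ⊥), by fun_prop⟩ (fun _ => rfl) one_ne_zero
      (one_mul u).symm (one_mul v).symm,
    isRestriction_clutch ⟨fun z => (z, ⊤), by fun_prop⟩ (fun _ => rfl) hκ hκu hκv⟩
  · rw [extChartAt, Icc_chartedSpaceChartAt_of_le_top (by simp)]
    exact IccLeftChart_extend_bot
  · rw [extChartAt, Icc_chartedSpaceChartAt_of_top_le (by simp)]
    exact IccRightChart_extend_top
  · rw [disjoint_left]
    rintro _ ⟨z, rfl⟩ ⟨z', h⟩
    have := congrArg (fun p : Cylinder => (p.2 : ℝ)) h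
    simp at this

/-! ### Turning numbers -/

theorem exists_lift {A : Type*} [TopologicalSpace A] [SimplyConnectedSpace A]
    [LocallyPathConnectedSpace A] (F : C(A, Circle)) :
    ∃ β : C(A, ℝ), ∀ a, Circle.exp (β a) = F a := by
  obtain ⟨a₀⟩ : Nonempty A := inferInstance
  obtain ⟨β, hβ, -⟩ := Circle.isCoveringMap_exp.existsUnique_continuousMap_lifts F a₀
    (F a₀ : ℂ).arg (Circle.exp_arg _)
  exact ⟨β, fun a => congrFun hβ.2 a⟩

/-- A continuous function with values in a fibre of `Circle.exp`, which is discrete, is constant.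
Phase increments along different sides of the square are compared in this way. -/
theorem eq_of_exp_const {φ : ℝ → ℝ} {a b : ℝ} (hab : a ≤ b) (hφ : ContinuousOn φ (Icc a b))
    {w : Circle} (h : ∀ t ∈ Icc a b, Circle.exp (φ t) = w) : φ a = φ b :=
  Circle.isCoveringMap_exp.constOn_of_comp isPreconnected_Icc hφ
    (fun s hs t ht => (h s hs).trans (h t ht).symm) (left_mem_Icc.2 hab) (right_mem_Icc.2 hab)

/-- The retraction of the line onto the unit interval. -/
def clamp (x : ℝ) : ℝ := max 0 (min 1 x)

theorem continuous_clamp : Continuous clamp := by unfold clamp; fun_prop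

theorem clamp_mem (x : ℝ) : clamp x ∈ Icc (0 : ℝ) 1 :=
  ⟨le_max_left _ _, max_le zero_le_one (min_le_left _ _)⟩

theorem clamp_of_mem {x : ℝ} (hx : x ∈ Icc (0 : ℝ) 1) : clamp x = x := by
  rw [clamp, min_eq_right hx.2, max_eq_right hx.1]

theorem clamp_of_le {x : ℝ} (hx : x ≤ 0) : clamp x = 0 :=
  max_eq_left ((min_le_right _ _).trans hx)

theorem clamp_of_ge {x : ℝ} (hx : 1 ≤ x) : clamp x = 1 := by
  rw [clamp, min_eq_left hx, max_eq_right zero_le_one]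

/-- The unit square. -/
abbrev unitSquare : Set (ℝ × ℝ) := Icc 0 1 ×ˢ Icc 0 1

/-- The retraction `clamp` extends `A / ‖A‖` from the square to the plane, which is simply
connected, so the covering `Circle.exp` provides a lift. -/
theorem exists_phase {A : ℝ × ℝ → ℂ} (hA : ContinuousOn A unitSquare)
    (h0 : ∀ p ∈ unitSquare, A p ≠ 0) :
    ∃ α : C(ℝ × ℝ, ℝ), ∀ p ∈ unitSquare, A p = ‖A p‖ * Circle.exp (α p) := by
  let ρ : ℝ × ℝ → ℝ × ℝ := fun p => (clamp p.1, clamp p.2)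
  have hρ : Continuous ρ := (continuous_clamp.comp continuous_fst).prodMk
    (continuous_clamp.comp continuous_snd)
  have hm : ∀ p, ρ p ∈ unitSquare := fun p => ⟨clamp_mem _, clamp_mem _⟩
  have hc : Continuous fun p => A (ρ p) := hA.comp_continuous hρ hm
  have hn : ∀ p, (‖A (ρ p)‖ : ℂ) ≠ 0 := fun p =>
    Complex.ofReal_ne_zero.2 (norm_ne_zero_iff.2 (h0 _ (hm p)))
  obtain ⟨α, hα⟩ := exists_lift (A := ℝ × ℝ) ⟨fun p => ⟨A (ρ p) / ‖A (ρ p)‖, mem_sphere_zero_iff_norm.2 <| by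
    rw [norm_div, Complex.norm_real, norm_norm, div_self]
    exact norm_ne_zero_iff.2 (h0 _ (hm p))⟩,
    (hc.div (Complex.continuous_ofReal.comp hc.norm) hn).subtype_mk _⟩
  refine ⟨α, fun p hp => ?_⟩
  have hp' : ρ p = p := Prod.ext (clamp_of_mem hp.1) (clamp_of_mem hp.2)
  have := hn p
  rw [hα]
  change A p = ‖A p‖ * (A (ρ p) / ‖A (ρ p)‖)
  rw [hp'] at this ⊢
  field_simp

/-- The frame `1, c` is positively oriented, so `cos θ + sin θ * c` never points opposite to `exp
(iθ)`: if the quotient is real, it is positive. Its argument can thus be chosen continuously. -/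
theorem frame_mem_slitPlane {c : ℂ} (hc : 0 < c.im) (θ : ℝ) :
    (Real.cos θ + Real.sin θ * c) * (Circle.exp (-θ) : ℂ) ∈ Complex.slitPlane := by
  have he : (Circle.exp (-θ) : ℂ) = Real.cos θ - Real.sin θ * Complex.I := by
    rw [Circle.coe_exp, Complex.exp_mul_I]; simp [sub_eq_add_neg]
  have h1 := Real.sin_sq_add_cos_sq θ
  rw [he, Complex.mem_slitPlane_iff]
  by_contra! h
  obtain ⟨hre, him⟩ := h
  simp only [Complex.mul_re, Complex.mul_im, Complex.add_re, Complex.add_im, Complex.sub_re,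
    Complex.sub_im, Complex.ofReal_re, Complex.ofReal_im, Complex.I_re, Complex.I_im] at hre him
  generalize Real.sin θ = y at *
  generalize Real.cos θ = x at *
  have h2 : y * (x * c.im - x - y * c.re) = 0 := by linarith
  rcases mul_eq_zero.1 h2 with h | h
  · subst h
    nlinarith
  · have : x ^ 2 + x * y * c.re + y ^ 2 * c.im = c.im := by
      linear_combination (-x) * h + c.im * h1
    nlinarith

/-- The phase is the sum of the phase of `A₁`, the angle `θ` and the argument of a function with
values in the slit plane. The first and the last return to their initial values along the closed
curve, so the total turn is that of `θ`. -/
theorem exists_phase_frame {A₁ A₂ : ℝ × ℝ → ℂ} (h₁ : ContinuousOn A₁ unitSquare)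
    (h₂ : ContinuousOn A₂ unitSquare)
    (hd : ∀ p ∈ unitSquare, 0 < (A₁ p).re * (A₂ p).im - (A₁ p).im * (A₂ p).re)
    {γ : ℝ → ℝ × ℝ} (hγ : ContinuousOn γ (Icc 0 4)) (hm : MapsTo γ (Icc 0 4) unitSquare)
    (hγ4 : γ 4 = γ 0) {θ : ℝ → ℝ} (hθ : ContinuousOn θ (Icc 0 4)) {n : ℤ}
    (hn : θ 4 - θ 0 = 2 * Real.pi * n) :
    ∃ Ψ : ℝ → ℝ, ContinuousOn Ψ (Icc 0 4) ∧ Ψ 4 - Ψ 0 = 2 * Real.pi * n ∧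
      ∀ t ∈ Icc (0 : ℝ) 4, ∃ r : ℝ, 0 < r ∧
        Real.cos (θ t) * A₁ (γ t) + Real.sin (θ t) * A₂ (γ t) = r * Circle.exp (Ψ t) := by
  have h0 : ∀ p ∈ unitSquare, A₁ p ≠ 0 := fun p hp h => by
    have := hd p hp
    simp [h] at this
  have hc : ∀ p ∈ unitSquare, 0 < (A₂ p / A₁ p).im := fun p hp => by
    rw [Complex.div_im]
    have h1 := hd p hp
    have h2 := Complex.normSq_pos.2 (h0 p hp)
    rw [div_sub_div_same]
    exact div_pos (by linarith) h2
  obtain ⟨α, hα⟩ := exists_phase h₁ h0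
  set m : ℝ → ℂ := fun t => (Real.cos (θ t) + Real.sin (θ t) * (A₂ (γ t) / A₁ (γ t))) *
    (Circle.exp (-θ t) : ℂ) with hmdef
  have hmc : ContinuousOn m (Icc 0 4) := by
    have hq : ContinuousOn (fun t => A₂ (γ t) / A₁ (γ t)) (Icc 0 4) :=
      (h₂.comp hγ hm).div (h₁.comp hγ hm) fun t ht => h0 _ (hm ht)
    refine ContinuousOn.mul (ContinuousOn.add ?_ (ContinuousOn.mul ?_ hq)) ?_
    · exact Complex.continuous_ofReal.comp_continuousOn (Real.continuous_cos.comp_continuousOn hθ)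
    · exact Complex.continuous_ofReal.comp_continuousOn (Real.continuous_sin.comp_continuousOn hθ)
    · exact continuous_subtype_val.comp_continuousOn
        (Circle.exp.continuous.comp_continuousOn hθ.neg)
  have hms : ∀ t ∈ Icc (0 : ℝ) 4, m t ∈ Complex.slitPlane := fun t ht =>
    frame_mem_slitPlane (hc _ (hm ht)) _
  refine ⟨fun t => α (γ t) + θ t + (m t).arg, ?_, ?_, fun t ht => ?_⟩
  · refine ((α.continuous.comp_continuousOn hγ).add hθ).add fun t ht => ?_
    exact (Complex.continuousAt_arg (hms t ht)).comp_continuousWithinAt (hmc t ht)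
  · have h4 : θ 4 = θ 0 + n * (2 * Real.pi) := by linarith
    have e1 : Circle.exp (-θ 4) = Circle.exp (-θ 0) := by
      rw [Circle.exp_eq_exp]
      exact ⟨-n, by rw [h4]; push_cast; ring⟩
    have : m 4 = m 0 := by
      simp only [hmdef]
      rw [e1, hγ4, h4, Real.cos_add_int_mul_two_pi, Real.sin_add_int_mul_two_pi]
    simp only [this, hγ4]
    linarith
  · have hm0 : m t ≠ 0 := Complex.slitPlane_ne_zero (hms t ht)
    have hA := h0 _ (hm ht)
    refine ⟨‖A₁ (γ t)‖ * ‖m t‖, by positivity, ?_⟩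
    have e1 : (‖m t‖ : ℂ) * Circle.exp (m t).arg = m t := by
      rw [Circle.coe_exp, Complex.norm_mul_exp_arg_mul_I]
    have e2 : (Circle.exp (-θ t) : ℂ) * Circle.exp (θ t) = 1 := by
      rw [← Circle.coe_mul, ← Circle.exp_add, neg_add_cancel, Circle.exp_zero, Circle.coe_one]
    calc _ = A₁ (γ t) * (m t * Circle.exp (θ t)) := by
          simp only [hmdef]
          rw [mul_assoc _ _ (Circle.exp (θ t) : ℂ), e2]
          field_simp
      _ = (‖A₁ (γ t)‖ * Circle.exp (α (γ t))) * (‖m t‖ * Circle.exp (m t).arg *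
          Circle.exp (θ t)) := by rw [e1, ← hα _ (hm ht)]
      _ = _ := by
        rw [Circle.exp_add, Circle.exp_add, Circle.coe_mul, Circle.coe_mul]
        push_cast
        ring

/-- The phase of a vector with turning coordinates in a moving frame of the plane. -/
theorem Turns.exists_phase {f : ℝ → ℂ} {n : ℤ} (hf : Turns f 0 4 n) {A₁ A₂ : ℝ × ℝ → ℂ}
    (h₁ : ContinuousOn A₁ unitSquare) (h₂ : ContinuousOn A₂ unitSquare)
    (hd : ∀ p ∈ unitSquare, (A₁ p).re * (A₂ p).im - (A₁ p).im * (A₂ p).re ≠ 0)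
    {γ : ℝ → ℝ × ℝ} (hγ : ContinuousOn γ (Icc 0 4)) (hm : MapsTo γ (Icc 0 4) unitSquare)
    (hγ4 : γ 4 = γ 0) :
    ∃ Ψ : ℝ → ℝ, ContinuousOn Ψ (Icc 0 4) ∧
      (Ψ 4 - Ψ 0 = 2 * Real.pi * n ∨ Ψ 4 - Ψ 0 = -(2 * Real.pi * n)) ∧
      ∀ t ∈ Icc (0 : ℝ) 4, ∃ r : ℝ, 0 < r ∧
        (f t).re * A₁ (γ t) + (f t).im * A₂ (γ t) = r * Circle.exp (Ψ t) := by
  obtain ⟨θ, hθ, hfθ, hn⟩ := hf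
  have hre : ∀ t ∈ Icc (0 : ℝ) 4, (f t).re = ‖f t‖ * Real.cos (θ t) ∧
      (f t).im = ‖f t‖ * Real.sin (θ t) := fun t ht => by
    have h := (hfθ t ht).2
    have h1 := congrArg Complex.re h
    have h2 := congrArg Complex.im h
    rw [Complex.re_ofReal_mul, Complex.exp_ofReal_mul_I_re] at h1
    rw [Complex.im_ofReal_mul, Complex.exp_ofReal_mul_I_im] at h2
    exact ⟨h1, h2⟩
  have hdc : ContinuousOn (fun p => (A₁ p).re * (A₂ p).im - (A₁ p).im * (A₂ p).re) unitSquare :=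
    ((Complex.continuous_re.comp_continuousOn h₁).mul
      (Complex.continuous_im.comp_continuousOn h₂)).sub
      ((Complex.continuous_im.comp_continuousOn h₁).mul
      (Complex.continuous_re.comp_continuousOn h₂))
  have hpre : IsPreconnected unitSquare := isPreconnected_Icc.prod isPreconnected_Icc
  have hsign : (∀ p ∈ unitSquare, 0 < (A₁ p).re * (A₂ p).im - (A₁ p).im * (A₂ p).re) ∨
      ∀ p ∈ unitSquare, (A₁ p).re * (A₂ p).im - (A₁ p).im * (A₂ p).re < 0 := by
    by_contra! h
    obtain ⟨⟨p, hp, hp0⟩, q, hq, hq0⟩ := h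
    obtain ⟨x, hx, hx0⟩ := hpre.intermediate_value hp hq hdc ⟨hp0, hq0⟩
    exact hd x hx hx0
  rcases hsign with hs | hs
  · obtain ⟨Ψ, hΨ, hΨn, hΨr⟩ := exists_phase_frame h₁ h₂ hs hγ hm hγ4 hθ hn
    refine ⟨Ψ, hΨ, .inl hΨn, fun t ht => ?_⟩
    obtain ⟨r, hr, h⟩ := hΨr t ht
    refine ⟨‖f t‖ * r, mul_pos (norm_pos_iff.2 (hfθ t ht).1) hr, ?_⟩
    rw [(hre t ht).1, (hre t ht).2]
    simp only [Complex.ofReal_mul]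
    rw [mul_assoc (‖f t‖ : ℂ) r, ← h]
    ring
  -- For a negatively oriented frame, reversing `A₂` together with `θ` keeps the vector but changes
  -- `n` to `-n`. This is the source of the sign ambiguity.
  · obtain ⟨Ψ, hΨ, hΨn, hΨr⟩ := exists_phase_frame (A₂ := fun p => -A₂ p) (n := -n)
      (θ := fun t => -θ t) h₁ h₂.neg (fun p hp => by
        have := hs p hp
        simp only [Complex.neg_im, Complex.neg_re]
        linarith) hγ hm hγ4 hθ.neg (by push_cast; linarith)
    refine ⟨Ψ, hΨ, .inr (by rw [hΨn]; push_cast; ring), fun t ht => ?_⟩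
    obtain ⟨r, hr, h⟩ := hΨr t ht
    refine ⟨‖f t‖ * r, mul_pos (norm_pos_iff.2 (hfθ t ht).1) hr, ?_⟩
    rw [(hre t ht).1, (hre t ht).2]
    simp only [Complex.ofReal_mul]
    rw [mul_assoc (‖f t‖ : ℂ) r, ← h, Real.cos_neg, Real.sin_neg, Complex.ofReal_neg]
    ring

theorem circle_eq_of_mul_eq {r r' : ℝ} (hr : 0 < r) (hr' : 0 < r') {z z' : Circle}
    (h : (r : ℂ) * z = r' * z') : z = z' := by
  have hn := congrArg norm h
  rw [norm_mul, norm_mul, Circle.norm_coe, Circle.norm_coe, mul_one, mul_one, Complex.norm_real,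
    Complex.norm_real, Real.norm_of_nonneg hr.le, Real.norm_of_nonneg hr'.le] at hn
  rw [← hn] at h
  exact Circle.ext (mul_left_cancel₀ (Complex.ofReal_ne_zero.2 hr.ne') h)

theorem squareLoop_bottom {t : ℝ} (ht : t ∈ Icc (0 : ℝ) 1) : squareLoop t = (t, 0) :=
  if_pos ht.2

theorem squareLoop_right {r : ℝ} (hr : r ∈ Icc (0 : ℝ) 1) : squareLoop (1 + r) = (1, r) := by
  rcases hr.1.eq_or_lt with rfl | h
  · simp [squareLoop]
  · rw [squareLoop, if_neg (by linarith), if_pos (by linarith [hr.2])]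
    simp

theorem squareLoop_top {t : ℝ} (ht : t ∈ Icc (0 : ℝ) 1) : squareLoop (3 - t) = (t, 1) := by
  rcases ht.2.eq_or_lt with rfl | h
  · norm_num [squareLoop]
  · rw [squareLoop, if_neg (by linarith), if_neg (by linarith), if_pos (by linarith [ht.1])]
    simp

theorem squareLoop_left {r : ℝ} (hr : r ∈ Icc (0 : ℝ) 1) : squareLoop (4 - r) = (0, r) := by
  rcases hr.2.eq_or_lt with rfl | h
  · norm_num [squareLoop]
  · rw [squareLoop, if_neg (by linarith), if_neg (by linarith), if_neg (by linarith)]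
    simp

theorem squareLoop_cases {t : ℝ} (ht : t ∈ Icc (0 : ℝ) 4) : t ∈ Icc (0 : ℝ) 1 ∨
    (∃ r ∈ Icc (0 : ℝ) 1, t = 1 + r) ∨ (∃ r ∈ Icc (0 : ℝ) 1, t = 3 - r) ∨
      ∃ r ∈ Icc (0 : ℝ) 1, t = 4 - r := by
  rcases le_total t 1 with h1 | h1
  · exact .inl ⟨ht.1, h1⟩
  rcases le_total t 2 with h2 | h2
  · exact .inr (.inl ⟨t - 1, ⟨by linarith, by linarith⟩, by ring⟩)
  rcases le_total t 3 with h3 | h3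
  · exact .inr (.inr (.inl ⟨3 - t, ⟨by linarith, by linarith⟩, by ring⟩))
  · exact .inr (.inr (.inr ⟨4 - t, ⟨by linarith [ht.2], by linarith⟩, by ring⟩))

theorem squareLoop_mem {t : ℝ} (ht : t ∈ Icc (0 : ℝ) 4) : squareLoop t ∈ unitSquare := by
  rcases squareLoop_cases ht with h | ⟨r, h, rfl⟩ | ⟨r, h, rfl⟩ | ⟨r, h, rfl⟩
  · rw [squareLoop_bottom h]; exact ⟨h, by simp⟩
  · rw [squareLoop_right h]; exact ⟨by simp, h⟩
  · rw [squareLoop_top h]; exact ⟨h, by simp⟩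
  · rw [squareLoop_left h]; exact ⟨by simp, h⟩

theorem squareLoop_eq_clamp {t : ℝ} (ht : t ∈ Icc (0 : ℝ) 4) :
    squareLoop t = (clamp t - clamp (t - 2), clamp (t - 1) - clamp (t - 3)) := by
  rcases squareLoop_cases ht with h | ⟨r, h, rfl⟩ | ⟨r, h, rfl⟩ | ⟨r, h, rfl⟩
  · rw [squareLoop_bottom h, clamp_of_mem h, clamp_of_le (x := t - 2) (by linarith [h.2]),
      clamp_of_le (x := t - 1) (by linarith [h.2]), clamp_of_le (x := t - 3) (by linarith [h.2])]
    simp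
  · rw [squareLoop_right h, clamp_of_ge (x := 1 + r) (by linarith [h.1]),
      clamp_of_le (x := 1 + r - 2) (by linarith [h.2]), add_sub_cancel_left, clamp_of_mem h,
      clamp_of_le (x := 1 + r - 3) (by linarith [h.2])]
    simp
  · have e : 3 - r - 2 = 1 - r := by ring
    rw [squareLoop_top h, clamp_of_ge (x := 3 - r) (by linarith [h.2]), e,
      clamp_of_mem (x := 1 - r) ⟨by linarith [h.2], by linarith [h.1]⟩,
      clamp_of_ge (x := 3 - r - 1) (by linarith [h.2]),
      clamp_of_le (x := 3 - r - 3) (by linarith [h.1])]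
    simp
  · have e : 4 - r - 3 = 1 - r := by ring
    rw [squareLoop_left h, clamp_of_ge (x := 4 - r) (by linarith [h.2]), e,
      clamp_of_mem (x := 1 - r) ⟨by linarith [h.2], by linarith [h.1]⟩,
      clamp_of_ge (x := 4 - r - 1) (by linarith [h.2]),
      clamp_of_ge (x := 4 - r - 2) (by linarith [h.2])]
    simp

theorem continuousOn_squareLoop : ContinuousOn squareLoop (Icc 0 4) := by
  refine Continuous.continuousOn ?_ |>.congr fun t ht => squareLoop_eq_clamp ht
  have h := continuous_clamp
  fun_prop

/-- The degree of a map between circles, computed with a lift, with respect to the symmetry `τ`. -/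
theorem lift_sub_eq {g : C(Circle, Circle)} (hg : ∀ z, g z⁻¹ = (g z)⁻¹) {β : C(ℝ, ℝ)}
    (hβ : ∀ t, Circle.exp (β t) = g (cov t)) : β 1 - β 0 = 2 * (β (1 / 2) - β 0) := by
  -- Since `cov (1 - t)` is the inverse of `cov t`, the sum `β (1 - t) + β t` takes values in `2πℤ`
  -- and is constant; its values at `0` and `1/2` are compared.
  have h : ∀ t, Circle.exp (β (1 - t) + β t) = 1 := fun t => by
    have : cov (1 - t) = (cov t)⁻¹ := by
      rw [sub_eq_neg_add, cov_add_one, cov, cov, ← Circle.exp_neg, mul_neg]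
    rw [Circle.exp_add, hβ, hβ, this, hg, inv_mul_cancel]
  have := eq_of_exp_const (a := 0) (b := 1 / 2) (φ := fun t => β (1 - t) + β t) (by norm_num)
    (by fun_prop) fun t _ => h t
  norm_num at this
  linarith

/-! ### Obstruction numbers of complex line bundles over the torus -/

section Torus

variable (gN gS : C(Circle, Circle))

/-- The complex line bundle over the torus with transition functions `gN` along the circle
`T × {1}` and `gS` along the circle `T × {-1}`. -/
abbrev torusClutch : VectorBundleCore ℝ (Circle × Circle) ℂ Bool :=
  clutch ℂ ⟨Prod.snd, continuous_snd⟩ ⟨fun p => (gN p.1 : ℂ), by fun_prop⟩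
    ⟨fun p => (gS p.1 : ℂ), by fun_prop⟩ (fun _ => Circle.coe_ne_zero _)
    (fun _ => Circle.coe_ne_zero _)

variable {gN gS}

theorem torusClutch_coord_one {x : Circle × Circle} (h : x.2 = 1)
    (y : (torusClutch gN gS).Fiber x) : coord (torusClutch gN gS) false x y =
      gN x.1 * coord (torusClutch gN gS) true x y :=
  coord_false_of_one (c := ⟨Prod.snd, continuous_snd⟩) h y

theorem torusClutch_coord_neg_one {x : Circle × Circle} (h : x.2 = -1)
    (y : (torusClutch gN gS).Fiber x) : coord (torusClutch gN gS) false x y =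
      gS x.1 * coord (torusClutch gN gS) true x y :=
  coord_false_of_neg_one (c := ⟨Prod.snd, continuous_snd⟩) h y

theorem mem_torus_true {x : Circle × Circle} (h : 0 ≤ (x.2 : ℂ).im) :
    x ∈ (torusClutch gN gS).baseSet true :=
  mem_baseSet_true (c := ⟨Prod.snd, continuous_snd⟩) h

theorem mem_torus_false {x : Circle × Circle} (h : (x.2 : ℂ).im ≤ 0) :
    x ∈ (torusClutch gN gS).baseSet false :=
  mem_baseSet_false (c := ⟨Prod.snd, continuous_snd⟩) h

variable (gN gS) in
/-- The coordinate in a trivialization of the pull-back of the bundle to the square. -/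
def squareCoord (r : ℝ) (x : Circle × Circle) (y : (torusClutch gN gS).Fiber x) : ℂ :=
  if r ≤ 1 / 2 then coord (torusClutch gN gS) true x y
  else (gS x.1 : ℂ)⁻¹ * coord (torusClutch gN gS) false x y

variable (gN gS) in
/-- The vector with a given coordinate with respect to `squareCoord`. -/
def squareVec (r : ℝ) (x : Circle × Circle) (w : ℂ) : (torusClutch gN gS).Fiber x :=
  if r ≤ 1 / 2 then vec (torusClutch gN gS) true x w
  else vec (torusClutch gN gS) false x (gS x.1 * w)

theorem squareCoord_of_le {r : ℝ} (hr : r ≤ 1 / 2) (x : Circle × Circle)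
    (y : (torusClutch gN gS).Fiber x) :
    squareCoord gN gS r x y = coord (torusClutch gN gS) true x y := if_pos hr

/-- At `r = 1/2` the second coordinate on the torus is `-1`, where the transition function is `gS`.
The factor `gS⁻¹` in `squareCoord` makes the two branches agree there. -/
theorem squareCoord_of_ge {r : ℝ} (hr : 1 / 2 ≤ r) (z : Circle)
    (y : (torusClutch gN gS).Fiber (z, cov r)) : squareCoord gN gS r (z, cov r) y =
      (gS z : ℂ)⁻¹ * coord (torusClutch gN gS) false (z, cov r) y := by
  rcases hr.eq_or_lt with rfl | h
  · rw [squareCoord_of_le le_rfl, torusClutch_coord_neg_one cov_half,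
      inv_mul_cancel_left₀ (Circle.coe_ne_zero _)]
  · exact if_neg h.not_ge

theorem squareCoord_lincomb (r : ℝ) (x : Circle × Circle) (a b : ℝ)
    (y y' : (torusClutch gN gS).Fiber x) : squareCoord gN gS r x (a • y + b • y') =
      a * squareCoord gN gS r x y + b * squareCoord gN gS r x y' := by
  unfold squareCoord
  split_ifs <;> rw [coord_add, coord_smul, coord_smul, Complex.real_smul,
    Complex.real_smul]
  ring

theorem squareCoord_squareVec {r : ℝ} (hr : r ∈ Icc (0 : ℝ) 1) (z : Circle) (w : ℂ) :
    squareCoord gN gS r (z, cov r) (squareVec gN gS r (z, cov r) w) = w := by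
  unfold squareCoord squareVec
  split_ifs with h
  · exact coord_vec (mem_torus_true (im_cov_nonneg ⟨hr.1, h⟩)) w
  · refine (congrArg _ (coord_vec (mem_torus_false
      (im_cov_nonpos ⟨(not_le.1 h).le, hr.2⟩)) _)).trans ?_
    exact inv_mul_cancel_left₀ (Circle.coe_ne_zero _) _

theorem squareCoord_injective {r : ℝ} (hr : r ∈ Icc (0 : ℝ) 1) (z : Circle) :
    Function.Injective (squareCoord gN gS r (z, cov r)) := by
  intro y y' h
  unfold squareCoord at h
  split_ifs at h with h'
  · exact coord_injective (mem_torus_true (im_cov_nonneg ⟨hr.1, h'⟩)) h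
  · exact coord_injective (mem_torus_false (im_cov_nonpos ⟨(not_le.1 h').le, hr.2⟩))
      (mul_left_cancel₀ (inv_ne_zero (Circle.coe_ne_zero _)) h)

theorem continuous_cov₂ : Continuous cov₂ :=
  (continuous_cov.comp continuous_fst).prodMk (continuous_cov.comp continuous_snd)

theorem unitSquare_eq : unitSquare = Icc 0 1 ×ˢ Icc 0 (1 / 2) ∪ Icc 0 1 ×ˢ Icc (1 / 2) 1 := by
  rw [← prod_union, Icc_union_Icc_eq_Icc (by norm_num) (by norm_num)]

theorem continuousOn_squareCoord_iff {e : ∀ p : ℝ × ℝ, (torusClutch gN gS).Fiber (cov₂ p)} :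
    ContinuousOn (fun p => (⟨cov₂ p, e p⟩ : TotalSpace ℂ (torusClutch gN gS).Fiber)) unitSquare ↔
      ContinuousOn (fun p => squareCoord gN gS p.2 (cov₂ p) (e p)) unitSquare := by
  have h1 : IsClosed (Icc (0 : ℝ) 1 ×ˢ Icc (0 : ℝ) (1 / 2)) := isClosed_Icc.prod isClosed_Icc
  have h2 : IsClosed (Icc (0 : ℝ) 1 ×ˢ Icc (1 / 2 : ℝ) 1) := isClosed_Icc.prod isClosed_Icc
  have hg : Continuous fun p : ℝ × ℝ => (gS (cov p.1) : ℂ) := continuous_subtype_val.comp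
    (gS.continuous.comp (continuous_cov.comp continuous_fst))
  rw [unitSquare_eq, continuousOn_union_iff_of_isClosed h1 h2, continuousOn_union_iff_of_isClosed h1 h2]
  refine and_congr ?_ ?_
  · rw [continuousOn_core (i := true) continuous_cov₂.continuousOn fun p hp =>
      mem_torus_true (im_cov_nonneg hp.2)]
    exact continuousOn_congr fun p hp => (squareCoord_of_le hp.2.2 _ _).symm
  · rw [continuousOn_core (i := false) continuous_cov₂.continuousOn fun p hp =>
      mem_torus_false (im_cov_nonpos hp.2)]
    have hne : ∀ p : ℝ × ℝ, (gS (cov p.1) : ℂ) ≠ 0 := fun p => Circle.coe_ne_zero _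
    constructor
    · intro h
      exact ((hg.inv₀ hne).continuousOn.mul h).congr fun p hp => squareCoord_of_ge hp.2.1 _ _
    · intro h
      refine (hg.continuousOn.mul h).congr fun p hp => ?_
      have := squareCoord_of_ge (gN := gN) (gS := gS) hp.2.1 (cov p.1) (e p)
      change _ = _ * squareCoord gN gS p.2 (cov p.1, cov p.2) (e p)
      rw [this, mul_inv_cancel_left₀ (hne p)]
      rfl

theorem det_ne_zero_of_linearIndependent {p : ℝ × ℝ} (hp : p ∈ unitSquare)
    {y y' : (torusClutch gN gS).Fiber (cov₂ p)} (h : LinearIndependent ℝ ![y, y']) :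
    (squareCoord gN gS p.2 (cov₂ p) y).re * (squareCoord gN gS p.2 (cov₂ p) y').im -
      (squareCoord gN gS p.2 (cov₂ p) y).im * (squareCoord gN gS p.2 (cov₂ p) y').re ≠ 0 := by
  intro h0
  rw [LinearIndependent.pair_iff] at h
  have hz : squareCoord gN gS p.2 (cov₂ p) 0 = 0 := by
    have := squareCoord_lincomb (gN := gN) (gS := gS) p.2 (cov₂ p) 0 0 0 0
    simpa using this
  have key : ∀ a b : ℝ, a * squareCoord gN gS p.2 (cov₂ p) y +
      b * squareCoord gN gS p.2 (cov₂ p) y' = 0 → a = 0 ∧ b = 0 := fun a b hab =>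
    h a b (squareCoord_injective hp.2 (cov p.1)
      ((squareCoord_lincomb p.2 (cov₂ p) a b y y').trans (hab.trans hz.symm)))
  generalize squareCoord gN gS p.2 (cov₂ p) y = A at *
  generalize squareCoord gN gS p.2 (cov₂ p) y' = B at *
  -- If the determinant vanishes, the combinations with coefficients `(Im B, -Im A)` and `(Re B, -Re
  -- A)` are both zero, which forces `A = 0`.
  have k1 := key B.im (-A.im) (by
    apply Complex.ext
    · simp; linarith
    · simp; ring)
  have k2 := key B.re (-A.re) (by
    apply Complex.ext
    · simp; ring
    · simp; linarith)
  have hA : A = 0 := Complex.ext (by simpa using k2.2) (by simpa using k1.2)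
  exact one_ne_zero (key 1 0 (by simp [hA])).1

theorem cov₂_bottom (t : ℝ) : cov₂ (t, 0) = (cov t, 1) := by rw [cov₂, cov_zero]

theorem cov₂_top (t : ℝ) : cov₂ (t, 1) = (cov t, 1) := by rw [cov₂, cov_one]

theorem cov₂_left (r : ℝ) : cov₂ (0, r) = (1, cov r) := by rw [cov₂, cov_zero]

theorem cov₂_right (r : ℝ) : cov₂ (1, r) = (1, cov r) := by rw [cov₂, cov_one]

theorem squareCoord_section_right (s : ∀ x, (torusClutch gN gS).Fiber x) (r : ℝ) :
    squareCoord gN gS r (cov₂ (1, r)) (s (cov₂ (1, r))) =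
      squareCoord gN gS r (cov₂ (0, r)) (s (cov₂ (0, r))) := by
  rw [cov₂_left, cov₂_right]

/-- The bottom and the top side map to the same circle `T × {1}`, but the coordinate is taken in the
`true` trivialization below and in the `false` one above. This factor is the only source of turning.
-/
theorem squareCoord_section_top (s : ∀ x, (torusClutch gN gS).Fiber x) (t : ℝ) :
    squareCoord gN gS 1 (cov₂ (t, 1)) (s (cov₂ (t, 1))) =
      (gS (cov t) : ℂ)⁻¹ * gN (cov t) *
        squareCoord gN gS 0 (cov₂ (t, 0)) (s (cov₂ (t, 0))) := by
  rw [cov₂_bottom, cov₂_top, squareCoord_of_le (r := 0) (by norm_num)]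
  unfold squareCoord
  rw [if_neg (by norm_num), torusClutch_coord_one rfl, mul_assoc]

/-- The obstruction numbers are, up to the sign, the difference of the degrees. -/
theorem IsObstructionNumber.eq_or_eq_neg {n : ℤ}
    (h : IsObstructionNumber (torusClutch gN gS).Fiber n) {βN βS : C(ℝ, ℝ)}
    (hN : ∀ t, Circle.exp (βN t) = gN (cov t)) (hS : ∀ t, Circle.exp (βS t) = gS (cov t)) :
    (βN 1 - βN 0) - (βS 1 - βS 0) = 2 * Real.pi * n ∨
      (βN 1 - βN 0) - (βS 1 - βS 0) = -(2 * Real.pi * n) := by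
  obtain ⟨s, e₁, e₂, f, -, -, h1, h2, hli, hs, hf⟩ := h
  obtain ⟨Ψ, hΨ, hn, hr⟩ := hf.exists_phase (continuousOn_squareCoord_iff.1 h1)
    (continuousOn_squareCoord_iff.1 h2)
    (fun p hp => det_ne_zero_of_linearIndependent hp (hli p hp)) continuousOn_squareLoop
    (fun t ht => squareLoop_mem ht)
    (by
      have a := squareLoop_left (r := 0) (by simp)
      have b := squareLoop_bottom (t := 0) (by simp)
      rw [sub_zero] at a
      rw [a, b])
  have hr' : ∀ t ∈ Icc (0 : ℝ) 4, ∃ r : ℝ, 0 < r ∧ squareCoord gN gS (squareLoop t).2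
      (cov₂ (squareLoop t)) (s (cov₂ (squareLoop t))) = r * Circle.exp (Ψ t) := fun t ht => by
    obtain ⟨r, hr0, h⟩ := hr t ht
    exact ⟨r, hr0, by rw [hs t ht, squareCoord_lincomb, ← h]⟩
  -- The two vertical sides carry equal values of the section, so their contributions to the total
  -- turn cancel.
  have eV : Ψ 1 - Ψ 4 = Ψ 2 - Ψ 3 := by
    have := eq_of_exp_const (a := 0) (b := 1) (φ := fun r => Ψ (1 + r) - Ψ (4 - r)) zero_le_one
      (ContinuousOn.sub
        (hΨ.comp (by fun_prop) fun r hr => ⟨by linarith [hr.1], by linarith [hr.2]⟩)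
        (hΨ.comp (by fun_prop) fun r hr => ⟨by linarith [hr.2], by linarith [hr.1]⟩)) (w := 1)
      fun r hr => by
        obtain ⟨a, ha, hA⟩ := hr' (1 + r) ⟨by linarith [hr.1], by linarith [hr.2]⟩
        obtain ⟨b, hb, hB⟩ := hr' (4 - r) ⟨by linarith [hr.2], by linarith [hr.1]⟩
        rw [squareLoop_right hr] at hA
        rw [squareLoop_left hr] at hB
        have := circle_eq_of_mul_eq ha hb
          (hA.symm.trans ((squareCoord_section_right s r).trans hB))
        rw [Circle.exp_sub, this, div_self']
    norm_num at this
    exact this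
  -- The horizontal sides differ by the factor `gN / gS`, with phase `βN - βS`, so their
  -- contributions leave the difference of the degrees.
  have eH : Ψ 3 - Ψ 0 - (βN 0 - βS 0) = Ψ 2 - Ψ 1 - (βN 1 - βS 1) := by
    have := eq_of_exp_const (a := 0) (b := 1)
      (φ := fun t => Ψ (3 - t) - Ψ t - (βN t - βS t)) zero_le_one
      (ContinuousOn.sub (ContinuousOn.sub
        (hΨ.comp (by fun_prop) fun r hr => ⟨by linarith [hr.2], by linarith [hr.1]⟩)
        (hΨ.mono (Icc_subset_Icc_right (by norm_num)))) (by fun_prop)) (w := 1)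
      fun t ht => by
        obtain ⟨a, ha, hA⟩ := hr' (3 - t) ⟨by linarith [ht.2], by linarith [ht.1]⟩
        obtain ⟨b, hb, hB⟩ := hr' t ⟨ht.1, by linarith [ht.2]⟩
        rw [squareLoop_top ht, squareCoord_section_top] at hA
        rw [squareLoop_bottom ht] at hB
        rw [hB] at hA
        have := circle_eq_of_mul_eq (z := (gS (cov t))⁻¹ * gN (cov t) * Circle.exp (Ψ t)) hb ha
          (by rw [← hA, Circle.coe_mul, Circle.coe_mul, Circle.coe_inv]; ring)
        rw [Circle.exp_sub, Circle.exp_sub, Circle.exp_sub, ← this, hN, hS, mul_div_cancel_right,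
          inv_mul_eq_div, div_self']
    norm_num at this
    exact this
  rcases hn with hn | hn
  · right; linarith
  · left; linarith

end Torus

theorem eq_one_or_eq_neg_one_of_im {z : Circle} (h : (z : ℂ).im = 0) : z = 1 ∨ z = -1 := by
  have hn := Circle.normSq_coe z
  rw [Complex.normSq_apply, h] at hn
  have : ((z : ℂ).re - 1) * ((z : ℂ).re + 1) = 0 := by linarith
  rcases mul_eq_zero.1 this with h' | h'
  · exact .inl (Circle.ext (Complex.ext (by simp; linarith) (by simp [h])))
  · exact .inr (Circle.ext (Complex.ext (by simp; linarith) (by simp [h])))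

/-- The parameter of a point of the upper half circle. -/
def halfAngle (z : Circle) : ℝ := Real.arccos (z : ℂ).re / (2 * Real.pi)

theorem continuous_halfAngle : Continuous halfAngle :=
  (Real.continuous_arccos.comp (Complex.continuous_re.comp continuous_subtype_val)).div_const _

theorem halfAngle_one : halfAngle 1 = 0 := by simp [halfAngle]

theorem halfAngle_neg_one : halfAngle (-1) = 1 / 2 := by
  have := Real.pi_ne_zero
  simp [halfAngle]
  field_simp

theorem re_cov (t : ℝ) : (cov t : ℂ).re = Real.cos (2 * Real.pi * t) := by
  rw [cov, Circle.coe_exp, Complex.exp_ofReal_mul_I_re]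

theorem halfAngle_cov_of_le {r : ℝ} (hr : r ∈ Icc (0 : ℝ) (1 / 2)) : halfAngle (cov r) = r := by
  have := Real.pi_pos
  rw [halfAngle, re_cov, Real.arccos_cos (by have := hr.1; positivity) (by nlinarith [hr.2])]
  field_simp

theorem halfAngle_cov_of_ge {r : ℝ} (hr : r ∈ Icc (1 / 2 : ℝ) 1) : halfAngle (cov r) = 1 - r := by
  have := Real.pi_pos
  rw [halfAngle, re_cov, ← Real.cos_two_pi_sub,
    Real.arccos_cos (by nlinarith [hr.2]) (by nlinarith [hr.1])]
  field_simp

/-! ### Existence of an obstruction number -/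

section Torus

variable {gN gS : C(Circle, Circle)}

/-- A section is written down with `squareCoord` equal to `1` on the bottom side and to a phase `q`
on the vertical sides. With respect to the frame `1, I` its turning is computed side by side. -/
theorem exists_isObstructionNumber {βN βS : C(ℝ, ℝ)}
    (hN : ∀ t, Circle.exp (βN t) = gN (cov t)) (hS : ∀ t, Circle.exp (βS t) = gS (cov t)) {n : ℤ}
    (hn : (βS 1 - βS 0) - (βN 1 - βN 0) = 2 * Real.pi * n) :
    IsObstructionNumber (torusClutch gN gS).Fiber n := by
  obtain ⟨B, hB⟩ : ∃ B : C(ℝ, ℝ), ∀ t, B t = βN t - βS t := ⟨βN - βS, fun _ => rfl⟩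
  have hBexp : ∀ t, (Circle.exp (B t) : ℂ) = (gS (cov t) : ℂ)⁻¹ * gN (cov t) := fun t => by
    rw [hB, Circle.exp_sub, hN, hS, Circle.coe_div, div_eq_inv_mul]
  have hBn : B 1 = B 0 - n * (2 * Real.pi) := by rw [hB, hB]; linarith
  have hB1 : (Circle.exp (B 0) : ℂ) = (gS 1 : ℂ)⁻¹ * gN 1 := by rw [hBexp, cov_zero]
  have hper : ∀ x : ℝ, Circle.exp (x + n * (2 * Real.pi)) = Circle.exp x := fun x =>
    Circle.exp_eq_exp.2 ⟨n, rfl⟩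
  have hne : ∀ z, (gS z : ℂ) ≠ 0 := fun z => Circle.coe_ne_zero _
  set Z := torusClutch gN gS
  -- A phase from `1` to `gS(1)⁻¹ gN(1)`: exactly the two values that a single vector over `(1, 1)`
  -- has at the lower and at the upper end of a vertical side.
  let q : ℝ → ℂ := fun r => Circle.exp (B 0 * r)
  have hq : Continuous q := continuous_subtype_val.comp (Circle.exp.continuous.comp (by fun_prop))
  have hq0 : q 0 = 1 := by simp [q]
  have hq1 : q 1 = (gS 1 : ℂ)⁻¹ * gN 1 := by simp only [q, mul_one, hB1]
  -- On the lower half circle `1 - halfAngle` is the parameter `r`. The section is defined on the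
  -- whole torus, but continuity is needed only over the 1-skeleton.
  let s : ∀ x, Z.Fiber x := fun x => open Classical in
    if 0 ≤ (x.2 : ℂ).im then vec Z true x (q (halfAngle x.2))
    else vec Z false x (gS x.1 * q (1 - halfAngle x.2))
  have sT : ∀ x : Circle × Circle, 0 ≤ (x.2 : ℂ).im →
      coord Z true x (s x) = q (halfAngle x.2) := fun x hx => by
    simp only [s, if_pos hx]
    exact coord_vec (mem_torus_true hx) _
  have sF : ∀ x : Circle × Circle, x.1 = 1 → (x.2 : ℂ).im ≤ 0 →
      coord Z false x (s x) = gS 1 * q (1 - halfAngle x.2) := fun x hx1 hx => by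
    rcases hx.lt_or_eq with h | h
    · simp only [s, if_neg h.not_ge]
      exact (coord_vec (mem_torus_false hx) _).trans (by rw [hx1])
    · rcases eq_one_or_eq_neg_one_of_im h with h' | h'
      · refine (torusClutch_coord_one h' _).trans ?_
        rw [sT x h.ge, h', halfAngle_one, hq0, sub_zero, hq1, hx1, mul_one,
          mul_inv_cancel_left₀ (hne 1)]
      · refine (torusClutch_coord_neg_one h' _).trans ?_
        rw [sT x h.ge, h', halfAngle_neg_one, hx1]
        norm_num
  have sB : ∀ t, squareCoord gN gS 0 (cov₂ (t, 0)) (s (cov₂ (t, 0))) = 1 := fun t => by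
    rw [cov₂_bottom, squareCoord_of_le (by norm_num), sT _ (by simp), halfAngle_one, hq0]
  have sL : ∀ r ∈ Icc (0 : ℝ) 1,
      squareCoord gN gS r (cov₂ (0, r)) (s (cov₂ (0, r))) = q r := fun r hr => by
    rw [cov₂_left]
    rcases le_total r (1 / 2) with h | h
    · rw [squareCoord_of_le h, sT _ (im_cov_nonneg ⟨hr.1, h⟩), halfAngle_cov_of_le ⟨hr.1, h⟩]
    · rw [squareCoord_of_ge h, sF _ rfl (im_cov_nonpos ⟨h, hr.2⟩),
        halfAngle_cov_of_ge ⟨h, hr.2⟩, sub_sub_cancel, inv_mul_cancel_left₀ (hne 1)]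
  let f : ℝ → ℂ := fun t =>
    squareCoord gN gS (squareLoop t).2 (cov₂ (squareLoop t)) (s (cov₂ (squareLoop t)))
  -- Each clamped term varies on one side only: `B 0` is gained on the right side, `B` runs
  -- backwards from `B 1` to `B 0` on the top, and `B 0` is lost on the left. The total is `B 0 - B
  -- 1 = 2πn`.
  let θ : ℝ → ℝ := fun t =>
    B 0 * clamp (t - 1) + B (1 - clamp (t - 2)) - B 1 - B 0 * clamp (t - 3)
  have hf : ∀ t ∈ Icc (0 : ℝ) 4, f t = Circle.exp (θ t) := by
    intro t ht
    simp only [f, θ]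
    rcases squareLoop_cases ht with h | ⟨r, h, rfl⟩ | ⟨r, h, rfl⟩ | ⟨r, h, rfl⟩
    · rw [squareLoop_bottom h, clamp_of_le (x := t - 2) (by linarith [h.2]),
        clamp_of_le (x := t - 1) (by linarith [h.2]), clamp_of_le (x := t - 3) (by linarith [h.2]),
        sB]
      simp
    · rw [squareLoop_right h, clamp_of_le (x := 1 + r - 2) (by linarith [h.2]),
        add_sub_cancel_left, clamp_of_mem h, clamp_of_le (x := 1 + r - 3) (by linarith [h.2]),
        squareCoord_section_right, sL r h]
      simp [q]
    · rw [squareLoop_top h, clamp_of_ge (x := 3 - r - 1) (by linarith [h.2]),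
        clamp_of_mem (x := 3 - r - 2) ⟨by linarith [h.2], by linarith [h.1]⟩,
        clamp_of_le (x := 3 - r - 3) (by linarith [h.1]), squareCoord_section_top, sB, ← hBexp,
        mul_one, ← hper (B r), hBn]
      ring_nf
    · rw [squareLoop_left h, clamp_of_ge (x := 4 - r - 1) (by linarith [h.2]),
        clamp_of_ge (x := 4 - r - 2) (by linarith [h.2]),
        clamp_of_mem (x := 4 - r - 3) ⟨by linarith [h.2], by linarith [h.1]⟩, sL r h]
      simp only [q]
      rw [← hper (B 0 * r), hBn]
      ring_nf
  refine ⟨s, fun p => squareVec gN gS p.2 (cov₂ p) 1, fun p => squareVec gN gS p.2 (cov₂ p)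
    Complex.I, f, ?_, fun x hx => ?_, ?_, ?_, fun p hp => ?_, fun t ht => ?_, θ, ?_,
    fun t ht => ?_, ?_⟩
  · have c2 : Continuous fun x : Circle × Circle => (x.2 : ℂ).im :=
      Complex.continuous_im.comp (continuous_subtype_val.comp continuous_snd)
    have k1 : IsClosed {x : Circle × Circle | x.2 = 1} := isClosed_eq continuous_snd continuous_const
    have k2 : IsClosed {x : Circle × Circle | x.1 = 1 ∧ 0 ≤ (x.2 : ℂ).im} :=
      (isClosed_eq continuous_fst continuous_const).inter (isClosed_le continuous_const c2)
    have k3 : IsClosed {x : Circle × Circle | x.1 = 1 ∧ (x.2 : ℂ).im ≤ 0} :=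
      (isClosed_eq continuous_fst continuous_const).inter (isClosed_le c2 continuous_const)
    have hu : {x : Circle × Circle | x.1 = 1 ∨ x.2 = 1} ⊆ {x | x.2 = 1} ∪
        ({x | x.1 = 1 ∧ 0 ≤ (x.2 : ℂ).im} ∪ {x | x.1 = 1 ∧ (x.2 : ℂ).im ≤ 0}) := by
      rintro x (h | h)
      · exact .inr ((le_total 0 (x.2 : ℂ).im).imp (fun h' => ⟨h, h'⟩) fun h' => ⟨h, h'⟩)
      · exact .inl h
    have hqa : Continuous fun x : Circle × Circle => halfAngle x.2 :=
      continuous_halfAngle.comp continuous_snd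
    refine ContinuousOn.mono (ContinuousOn.union_of_isClosed ?_
      (ContinuousOn.union_of_isClosed ?_ ?_ k2 k3) k1 (k2.union k3)) hu
    · have h0 : ∀ x ∈ {x : Circle × Circle | x.2 = 1}, 0 ≤ (x.2 : ℂ).im := fun x hx => by
        rw [show x.2 = 1 from hx]; simp
      refine (continuousOn_core (γ := id) (e := s) (i := true) continuousOn_id
        fun x hx => mem_torus_true (h0 x hx)).2 ?_
      exact (hq.comp hqa).continuousOn.congr fun x hx => sT x (h0 x hx)
    · refine (continuousOn_core (γ := id) (e := s) (i := true) continuousOn_id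
        fun x hx => mem_torus_true hx.2).2 ?_
      exact (hq.comp hqa).continuousOn.congr fun x hx => sT x hx.2
    · refine (continuousOn_core (γ := id) (e := s) (i := false) continuousOn_id
        fun x hx => mem_torus_false hx.2).2 ?_
      exact (continuous_const.mul (hq.comp (continuous_const.sub hqa))).continuousOn.congr
        fun x hx => sF x hx.1 hx.2
  · have hq' : ∀ r, q r ≠ 0 := fun r => Circle.coe_ne_zero _
    rcases le_total 0 (x.2 : ℂ).im with h | h
    · exact ne_zero_of_coord (i := true) (by rw [sT x h]; exact hq' _)
    · rcases hx with h1 | h1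
      · exact ne_zero_of_coord (i := false) (by rw [sF x h1 h]; exact mul_ne_zero (hne 1) (hq' _))
      · exact ne_zero_of_coord (i := true) (by rw [sT x (by rw [h1]; simp)]; exact hq' _)
  · exact continuousOn_squareCoord_iff.2 (continuousOn_const.congr fun p hp =>
      squareCoord_squareVec hp.2 (cov p.1) 1)
  · exact continuousOn_squareCoord_iff.2 (continuousOn_const.congr fun p hp =>
      squareCoord_squareVec hp.2 (cov p.1) Complex.I)
  · rw [LinearIndependent.pair_iff]
    intro a b hab
    have hz : squareCoord gN gS p.2 (cov₂ p) 0 = 0 := by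
      have := squareCoord_lincomb (gN := gN) (gS := gS) p.2 (cov₂ p) 0 0 0 0
      simpa using this
    have h := congrArg (squareCoord gN gS p.2 (cov₂ p)) hab
    have e1 : squareCoord gN gS p.2 (cov₂ p) (squareVec gN gS p.2 (cov₂ p) 1) = 1 :=
      squareCoord_squareVec hp.2 (cov p.1) 1
    have e2 : squareCoord gN gS p.2 (cov₂ p) (squareVec gN gS p.2 (cov₂ p) Complex.I) =
      Complex.I := squareCoord_squareVec hp.2 (cov p.1) Complex.I
    have h' := (squareCoord_lincomb (gN := gN) (gS := gS) p.2 (cov₂ p) a b _ _).symm.trans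
      (h.trans hz)
    rw [e1, e2] at h'
    exact ⟨by simpa using congrArg Complex.re h', by simpa using congrArg Complex.im h'⟩
  · have hp := squareLoop_mem ht
    have e1 : squareCoord gN gS (squareLoop t).2 (cov₂ (squareLoop t))
        (squareVec gN gS (squareLoop t).2 (cov₂ (squareLoop t)) 1) = 1 :=
      squareCoord_squareVec hp.2 (cov (squareLoop t).1) 1
    have e2 : squareCoord gN gS (squareLoop t).2 (cov₂ (squareLoop t))
        (squareVec gN gS (squareLoop t).2 (cov₂ (squareLoop t)) Complex.I) = Complex.I :=
      squareCoord_squareVec hp.2 (cov (squareLoop t).1) Complex.I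
    refine squareCoord_injective (gN := gN) (gS := gS) hp.2 (cov (squareLoop t).1) ?_
    refine Eq.trans ?_ (squareCoord_lincomb (gN := gN) (gS := gS) (squareLoop t).2
      (cov₂ (squareLoop t)) (f t).re (f t).im _ _).symm
    rw [e1, e2, mul_one, Complex.re_add_im]
    rfl
  · have := continuous_clamp
    exact Continuous.continuousOn (by fun_prop)
  · rw [hf t ht, Circle.norm_coe, Complex.ofReal_one, one_mul, Circle.coe_exp]
    exact ⟨Complex.exp_ne_zero _, rfl⟩
  · simp only [θ]
    rw [clamp_of_ge (x := 4 - 1) (by norm_num), clamp_of_ge (x := 4 - 2) (by norm_num),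
      clamp_of_ge (x := 4 - 3) (by norm_num), clamp_of_le (x := 0 - 1) (by norm_num),
      clamp_of_le (x := 0 - 2) (by norm_num), clamp_of_le (x := 0 - 3) (by norm_num), hBn]
    norm_num
    rw [hBn]
    ring

end Torus

/-! ### Characteristic classes of the Pfaffian bundles -/

/-- The class in `ℤ/2` of a sign. -/
def signClass (ε : ℤˣ) : ZMod 2 := if ε = -1 then 1 else 0

theorem neg_one_pow_signClass : ∀ ε : ℤˣ, (-1 : ℤˣ) ^ (signClass ε).val = ε := by decide

theorem signClass_mul : ∀ ε δ : ℤˣ, signClass (ε * δ) = signClass ε + signClass δ := by decide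

theorem signClass_eq_zero : ∀ ε : ℤˣ, signClass ε = 0 ↔ ε = 1 := by decide

theorem signClass_inj : ∀ ε δ : ℤˣ, signClass ε = signClass δ ↔ ε = δ := by decide

theorem odd_iff_neg_one_zpow {n : ℤ} : Odd n ↔ (-1 : ℤˣ) ^ n = -1 := by
  refine ⟨fun h => h.neg_one_zpow, fun h => ?_⟩
  by_contra hn
  rw [Int.not_odd_iff_even] at hn
  rw [hn.neg_one_zpow] at h
  exact absurd h (by decide)

/-- By `lift_sub_eq` the lift has advanced by `π d` at `t = 1/2`, that is, at the point `-1`. Hence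
`g(-1) = (-1)^d g(1)`. -/
theorem exists_degree {g : C(Circle, Circle)} (hg : ∀ z, g z⁻¹ = (g z)⁻¹) {a b : ℤˣ}
    (h1 : (g 1 : ℂ) = (a : ℤ)) (h2 : (g (-1) : ℂ) = (b : ℤ)) :
    ∃ (β : C(ℝ, ℝ)) (d : ℤ), (∀ t, Circle.exp (β t) = g (cov t)) ∧
      β 1 - β 0 = 2 * Real.pi * d ∧ (-1 : ℤˣ) ^ d = a * b := by
  obtain ⟨β, hβ⟩ := exists_lift (A := ℝ) (g.comp ⟨cov, continuous_cov⟩)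
  have hβ' : ∀ t, Circle.exp (β t) = g (cov t) := hβ
  obtain ⟨d, hd⟩ := Circle.exp_eq_exp.1 (show Circle.exp (β 1) = Circle.exp (β 0) by
    rw [hβ', hβ', cov_one, cov_zero])
  refine ⟨β, d, hβ', by linarith, ?_⟩
  have hs := lift_sub_eq hg hβ'
  have e : β (1 / 2) = d * Real.pi + β 0 := by linarith
  have hz : (Circle.exp (β (1 / 2)) : ℂ) = (-1) ^ d * Circle.exp (β 0) := by
    rw [e, Circle.exp_add, Circle.coe_mul, Circle.coe_exp (d * Real.pi)]
    push_cast
    rw [mul_assoc, Complex.exp_int_mul, Complex.exp_pi_mul_I]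
  rw [hβ', hβ', cov_half, cov_zero, h1, h2] at hz
  have hz' : b = (-1) ^ d * a := by
    rcases Int.even_or_odd d with h | h
    · rw [h.neg_one_zpow] at hz ⊢
      rw [one_mul] at hz ⊢
      exact Units.ext (by exact_mod_cast hz)
    · rw [h.neg_one_zpow] at hz ⊢
      exact Units.ext (by push_cast; exact_mod_cast hz)
  rw [hz', mul_left_comm, Int.units_mul_self, mul_one]

/-- Every obstruction number is plus or minus the difference of the degrees, and `dS - dN` occurs,
so the class is the parity of `dS - dN`; `exists_degree` expresses it by the values at the fixed
points. -/
theorem w₂_torusClutch {gN gS : C(Circle, Circle)} (hN : ∀ z, gN z⁻¹ = (gN z)⁻¹)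
    (hS : ∀ z, gS z⁻¹ = (gS z)⁻¹) {a b c d : ℤˣ} (ha : (gN 1 : ℂ) = (a : ℤ))
    (hb : (gN (-1) : ℂ) = (b : ℤ)) (hc : (gS 1 : ℂ) = (c : ℤ)) (hd : (gS (-1) : ℂ) = (d : ℤ)) :
    w₂ (torusClutch gN gS).Fiber = signClass (a * b * (c * d)) := by
  obtain ⟨βN, dN, hβN, hdN, hab⟩ := exists_degree hN ha hb
  obtain ⟨βS, dS, hβS, hdS, hcd⟩ := exists_degree hS hc hd
  have hpi := Real.pi_pos
  have hsign : (-1 : ℤˣ) ^ (dS - dN) = a * b * (c * d) := by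
    rw [zpow_sub, hab, hcd, Int.units_inv_eq_self, mul_comm]
  classical
  unfold w₂ signClass
  refine if_congr ?_ rfl rfl
  rw [← hsign, ← odd_iff_neg_one_zpow]
  constructor
  · rintro ⟨n, hn, ho⟩
    rcases hn.eq_or_eq_neg hβN hβS with h | h
    · have : ((dS - dN : ℤ) : ℝ) = (-n : ℤ) := by
        refine mul_left_cancel₀ (show 2 * Real.pi ≠ 0 by positivity) ?_
        push_cast
        linarith
      rw [Int.cast_injective this]
      exact ho.neg
    · have : ((dS - dN : ℤ) : ℝ) = (n : ℤ) := by
        refine mul_left_cancel₀ (show 2 * Real.pi ≠ 0 by positivity) ?_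
        push_cast
        linarith
      rwa [Int.cast_injective this]
  · intro ho
    exact ⟨_, exists_isObstructionNumber hβN hβS (by rw [hdN, hdS]; push_cast; ring), ho⟩

theorem Circle.inv_eq_self_iff {z : Circle} : z⁻¹ = z ↔ z = 1 ∨ z = -1 := by
  rw [inv_eq_iff_mul_eq_one]
  constructor
  · intro h
    have h' : (z : ℂ) * z = 1 := by rw [← Circle.coe_mul, h, Circle.coe_one]
    rcases mul_self_eq_one_iff.1 h' with h | h
    · exact .inl (Circle.ext (by simpa using h))
    · exact .inr (Circle.ext (by simpa using h))
  · rintro (rfl | rfl) <;> simp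

theorem Circle.one_ne_neg_one : (1 : Circle) ≠ -1 := fun h => by
  have := congrArg (fun z : Circle => (z : ℂ).re) h
  norm_num at this

/-! ### The invariants in terms of the signs at the fixed points -/

namespace PfaffianDatum

section Restrict

variable {X Y V : Type*} [TopologicalSpace X] [InvolutiveInv X] [TopologicalSpace Y]
  [InvolutiveInv Y] [NormedAddCommGroup V] [InnerProductSpace ℂ V]

theorem sgn_restrict (D : PfaffianDatum X V) (f : C(Y, X)) (hf : ∀ y, f y⁻¹ = (f y)⁻¹) (y : Y) :
    (D.restrict f hf).sgn y = D.sgn (f y) := by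
  have h : (D.restrict f hf).pf y = D.pf (f y) := by
    simp [HilbertFrame.pf, HilbertFrame.w, restrict, hf]
  unfold sgn
  rw [h]
  rfl

end Restrict

variable {V : Type*} [NormedAddCommGroup V] [InnerProductSpace ℂ V]

theorem kaneMele_circle (D : PfaffianDatum Circle V) : D.kaneMele = D.sgn 1 * D.sgn (-1) := by
  have h : {z : Circle | z⁻¹ = z} = {1, -1} := by
    ext z
    exact Circle.inv_eq_self_iff
  change ∏ᶠ (z : Circle) (_ : z ∈ {z : Circle | z⁻¹ = z}), D.sgn z = _
  rw [h, finprod_mem_pair Circle.one_ne_neg_one]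

theorem kaneMele_torus (D : PfaffianDatum (Circle × Circle) V) : D.kaneMele =
    D.sgn (1, 1) * D.sgn (-1, 1) * (D.sgn (1, -1) * D.sgn (-1, -1)) := by
  have h : {z : Circle × Circle | z⁻¹ = z} = {(1, 1), (-1, 1), (1, -1), (-1, -1)} := by
    ext ⟨z, y⟩
    simp only [mem_ofPred_eq, Prod.inv_mk, Prod.mk.injEq, Circle.inv_eq_self_iff,
      mem_insert_iff, mem_singleton_iff]
    tauto
  have hne := Circle.one_ne_neg_one
  change ∏ᶠ (z : Circle × Circle) (_ : z ∈ {z : Circle × Circle | z⁻¹ = z}), D.sgn z = _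
  rw [h, finprod_mem_insert _ (by simp [hne]) (toFinite _),
    finprod_mem_insert _ (by simp [hne, hne.symm]) (toFinite _),
    finprod_mem_pair (by simp [hne]), mul_assoc]

theorem w₁_circleBundle (D : PfaffianDatum Circle V) :
    w₁ D.circleBundle.Fiber = signClass (D.sgn 1 * D.sgn (-1)) := by
  refine (w₁_circleClutch (u := (D.sgn 1 : ℤ)) (v := (D.sgn (-1) : ℤ))).trans ?_
  rcases Int.units_eq_one_or (D.sgn 1) with h | h <;>
    rcases Int.units_eq_one_or (D.sgn (-1)) with h' | h' <;> rw [h, h'] <;>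
    norm_num [signClass]

theorem w₂_torusBundle (D : PfaffianDatum (Circle × Circle) V) (gN : D.north.PhaseExtension)
    (gS : D.south.PhaseExtension) : w₂ (D.torusBundle gN gS).Fiber =
      signClass (D.north.sgn 1 * D.north.sgn (-1) * (D.south.sgn 1 * D.south.sgn (-1))) :=
  w₂_torusClutch gN.map_inv gS.map_inv gN.map_one gN.map_neg_one gS.map_one gS.map_neg_one

/-- A cobordism makes the product of the two holonomies positive, and their signs are the two sides
of the equation. Conversely, equal products mean that the two pairs of signs differ by the common
factor `D.sgn 1 * D'.sgn 1`, so the cylinder is a cobordism. -/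
theorem cobordant_circleBundle (D D' : PfaffianDatum Circle V) :
    Cobordant 1 D.circleBundle.Fiber D'.circleBundle.Fiber ↔
      D.sgn 1 * D.sgn (-1) = D'.sgn 1 * D'.sgn (-1) := by
  constructor
  · intro h
    obtain ⟨e, he⟩ := exists_loopSection (D.sgn 1 : ℤ) (D.sgn (-1) : ℤ) (fun _ => by simp)
      (fun _ => by simp)
    obtain ⟨e', he'⟩ := exists_loopSection (D'.sgn 1 : ℤ) (D'.sgn (-1) : ℤ) (fun _ => by simp)
      (fun _ => by simp)
    have key := Cobordant.mul_pos h he.cont he'.cont he.ne_zero he'.ne_zero (by simp) (by simp)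
      he.hol he'.hol
    revert key
    rcases Int.units_eq_one_or (D.sgn 1) with h1 | h1 <;>
      rcases Int.units_eq_one_or (D.sgn (-1)) with h2 | h2 <;>
      rcases Int.units_eq_one_or (D'.sgn 1) with h3 | h3 <;>
      rcases Int.units_eq_one_or (D'.sgn (-1)) with h4 | h4 <;>
      rw [h1, h2, h3, h4] <;> norm_num
  · intro h
    have hu : ∀ a b c d : ℤˣ, a * b = c * d → a = a * c * c ∧ b = a * c * d := by decide
    obtain ⟨h1, h2⟩ := hu _ _ _ _ h
    have hr : ∀ a c d : ℤˣ, a = d * c → ((a : ℤ) : ℝ) = ((d : ℤ) : ℝ) * ((c : ℤ) : ℝ) :=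
      fun a c d h => by rw [h]; push_cast; ring
    exact cobordant_circleClutch (κ := ((D.sgn 1 * D'.sgn 1 : ℤˣ) : ℤ)) (by simp) (hr _ _ _ h1)
      (hr _ _ _ h2)

variable (D : PfaffianDatum (Circle × Circle) V) (z : Circle)

theorem sgn_north : D.north.sgn z = D.sgn (z, 1) := D.sgn_restrict _ _ z

theorem sgn_south : D.south.sgn z = D.sgn (z, -1) := D.sgn_restrict _ _ z

theorem sgn_swap (x : Circle × Circle) : D.swap.sgn x = D.sgn x.swap := D.sgn_restrict _ _ x

end PfaffianDatum

end TopIns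

end

theorem mainTheorem3 {V : Type*} [NormedAddCommGroup V] [InnerProductSpace ℂ V]
    (D : TopIns.PfaffianDatum (Circle × Circle) V)
    (gN : D.north.PhaseExtension) (gS : D.south.PhaseExtension) :
    -- the Stiefel--Whitney relation
    TopIns.w₂ (D.torusBundle gN gS).Fiber =
        TopIns.w₁ D.north.circleBundle.Fiber + TopIns.w₁ D.south.circleBundle.Fiber ∧
    -- its relation with the Kane--Mele invariants
    D.kaneMele = (-1) ^ (TopIns.w₂ (D.torusBundle gN gS).Fiber).val ∧
    D.north.kaneMele = (-1) ^ (TopIns.w₁ D.north.circleBundle.Fiber).val ∧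
    D.south.kaneMele = (-1) ^ (TopIns.w₁ D.south.circleBundle.Fiber).val ∧
    D.kaneMele = D.north.kaneMele * D.south.kaneMele ∧
    -- vanishing of `w₂`, triviality of the invariant, and cobordism of the restrictions
    (TopIns.w₂ (D.torusBundle gN gS).Fiber = 0 ↔ D.kaneMele = 1) ∧
    (TopIns.w₂ (D.torusBundle gN gS).Fiber = 0 ↔
      TopIns.Cobordant 1 D.north.circleBundle.Fiber D.south.circleBundle.Fiber) ∧
    (TopIns.Cobordant 1 D.north.circleBundle.Fiber D.south.circleBundle.Fiber ↔
      TopIns.w₁ D.north.circleBundle.Fiber = TopIns.w₁ D.south.circleBundle.Fiber) ∧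
    -- independence of the pairing of the fixed points
    D.swap.kaneMele = D.kaneMele ∧
    D.swap.north.kaneMele * D.swap.south.kaneMele = D.north.kaneMele * D.south.kaneMele ∧
    TopIns.w₁ D.swap.north.circleBundle.Fiber + TopIns.w₁ D.swap.south.circleBundle.Fiber =
      TopIns.w₁ D.north.circleBundle.Fiber + TopIns.w₁ D.south.circleBundle.Fiber ∧
    (∀ (gN' : D.swap.north.PhaseExtension) (gS' : D.swap.south.PhaseExtension),
      TopIns.w₂ (D.swap.torusBundle gN' gS').Fiber = TopIns.w₂ (D.torusBundle gN gS).Fiber) ∧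
    (TopIns.Cobordant 1 D.swap.north.circleBundle.Fiber D.swap.south.circleBundle.Fiber ↔
      TopIns.Cobordant 1 D.north.circleBundle.Fiber D.south.circleBundle.Fiber) := by
  -- Exchanging the coordinates of the torus exchanges the signs at `(-1, 1)` and `(1, -1)`; `hsq`
  -- is the resulting regrouping of the four signs. `hone` turns equality of the two circle
  -- invariants, the criterion for cobordism, into triviality of their product.
  have hsq : ∀ a b c d : ℤˣ, a * c * (b * d) = a * b * (c * d) := by decide
  have hone : ∀ a b : ℤˣ, a = b ↔ a * b = 1 := by decide
  simp only [TopIns.PfaffianDatum.w₂_torusBundle, TopIns.PfaffianDatum.w₁_circleBundle,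
    TopIns.PfaffianDatum.kaneMele_torus, TopIns.PfaffianDatum.kaneMele_circle,
    TopIns.PfaffianDatum.cobordant_circleBundle, TopIns.PfaffianDatum.sgn_north,
    TopIns.PfaffianDatum.sgn_south, TopIns.PfaffianDatum.sgn_swap, Prod.swap_prod_mk,
    TopIns.neg_one_pow_signClass, TopIns.signClass_eq_zero, TopIns.signClass_inj,
    ← TopIns.signClass_mul, true_and]
  generalize D.sgn (1, 1) = a
  generalize D.sgn (-1, 1) = b
  generalize D.sgn (1, -1) = c
  generalize D.sgn (-1, -1) = d
  refine ⟨(hone _ _).symm, hsq _ _ _ _, hsq _ _ _ _, hsq _ _ _ _, fun _ _ => hsq _ _ _ _, ?_⟩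
  rw [hone, hone (a * b), hsq]
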